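/- **Setting.** A tensor network is a finite hypergraph whose vertices are tensors and whose hyperedges are dimensions, each of a positive integer size; a hyperedge is uncontracted if it has a dangling end. For a set $A$ of vertices let $E(A)$ be the set of hyperedges adjacent to $A$ that are uncontracted or adjacent to a vertex outside $A$. A contraction tree is a rooted binary tree whose leaves are the vertices, each once; contracting (the outputs of) disjoint $A,B$ costs $\prod_{e\in E(A)\cup E(B)}\mathrm{size}(e)$, and the cost of a tree is the sum over its contractions. The data is a tensor network $G_D$ with a nonempty set $\bar E$ of $N$ uncontracted dimensions to be sketched, each adjacent to exactly one tensor, with at most one of them on each tensor, and with a contraction tree $T_0$. An embedding for the data is a tensor network $G_E$ joined to $G_D$ exactly through the edges in $\bar E$, each adjacent to one tensor of $G_E$, and such that each output (uncontracted) edge of $G_E$ is adjacent to one tensor and every other edge to two. A contraction tree $T_B$ of $(G_D,G_E)$ is constrained on $T_0$ if for each contraction $(A,B)$ of $T_0$ there is a contraction $(\hat A,\hat B)$ of $T_B$ whose sets of data vertices are $A$ and $B$. Let $\epsilon>0$, $0<\delta<1$, and let $c_1,c_2>0$ be the constants hidden in $\Omega$ and $\Theta$. Let $\mathcal G^{(\epsilon,\delta)}$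 be the set of embeddings, with $N_E$ denoting the number of tensors, such that (i) for some ordering of the tensors of $G_E$, each tensor has row size at least $c_1N_E\log(1/\delta)/\epsilon^2$, the row size being the product of the sizes of its output edges and of its edges to later tensors; (ii) there is exactly one output edge, and its size $m_E$ (the sketch size) satisfies $c_1N_E\log(1/\delta)/\epsilon^2\le m_E\le c_2N_E\log(1/\delta)/\epsilon^2$. Let $c_{\mathrm{opt}}$ be the minimum of the cost of $T_B$ over all $G_E\in\mathcal G^{(\epsilon,\delta)}$ whose sketch size also satisfies $m_E\ge c_1N\log(1/\delta)/\epsilon^2$ and all contraction trees $T_B$ of $(G_D,G_E)$ constrained on $T_0$. **Algorithm.** Let $m$ be an integer with $c_1N\log(1/\delta)/\epsilon^2\le m\le c_2N\log(1/\delta)/\epsilon^2$, and let every dimension in $\bar E$ have size greater than $m$. The algorithm follows $T_0$. * For each $e\in\bar E$ a matrix of sketch size $m$ is contracted with one of the tensors formed in $T_0$ whose only dimension in $\bar E$ is $e$; the tensor is chosen so that the contractions of $T_0$ whose output has $e$ as its only dimension in $\bar E$, together with this sketching step, are cheapest (carrying $e$ below that tensor and a dimension of size $m$ above it). * For each contraction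 $(U,V)$ of $T_0$ such that both $U$ and $V$ are adjacent to $\bar E$, name $U,V$ so that the product of the sizes of the dimensions of $U$ that are neither dimensions of $V$ nor in $\bar E$ is at most the same product with $U,V$ exchanged. A network of two tensors $v_1,v_2$, joined by an edge of size $m$, is used: the sketch dimension of $\hat U$ (size $m$) goes to $v_1$, that of $\hat V$ goes to $v_1$ by an edge of size $p$ and to $v_2$ by an edge of size $q=\lceil m/p\rceil$, and $v_2$ carries the outgoing sketch dimension; the order is $(((\hat U,v_1),\hat V),v_2)$. Here $\hat U,\hat V$ are the sketched versions of $U,V$, and $p\in\{1,\dots,m\}$ minimizes the cost of these three contractions, counted with incoming dimension $m$ for $\hat U$, incoming dimensions $p,q$ for $\hat V$ and outgoing dimension $m$. * All other contractions are performed as in $T_0$. The output edge of the embedding has size $m$. Let $c$ be the cost of the resulting contraction tree of the data and the constructed embedding. **Theorem.** For all $c_1,c_2>0$ there is a constant $C>0$ depending only on $c_1,c_2$ such that, for all data, $T_0$, $\epsilon$, $\delta$ and $m$ as above, $$c\le C\,\sqrt m\;c_{\mathrm{opt}},$$ and, if moreover $G_D$ is a graph (every contracted edge is adjacent to at most two tensors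 and every uncontracted edge to at most one), then $$c\le C\,m^{0.375}\,c_{\mathrm{opt}}.$$ -/

import Mathlib

/-! ### Tensor networks, contraction trees and their cost -/

/-- A tensor network with vertex (tensor) names in `V` and hyperedge (dimension) names in `E`:
the finite set of its vertices, the hyperedges adjacent to each vertex, the set of hyperedges that
have a dangling end (the uncontracted ones), and the dimension size `exp (w e)` of each hyperedge.
A hyperedge may be adjacent to any number of vertices. -/
structure TensorNetwork (V E : Type*) where
  verts : Finset V
  inc : V → Finset E
  dangling : Finset E
  size : E → ℕ

/-- A rooted binary tree whose leaves carry vertices; an internal vertex is the contraction of the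
tensors formed by its two children. -/
inductive ContractionTree (V : Type*) where
  | leaf (v : V) : ContractionTree V
  | node (l r : ContractionTree V) : ContractionTree V

namespace ContractionTree

variable {V W : Type*}

def leaves : ContractionTree V → List V
  | leaf v => [v]
  | node l r => l.leaves ++ r.leaves

def map (f : V → W) : ContractionTree V → ContractionTree W
  | leaf v => leaf (f v)
  | node l r => node (l.map f) (r.map f)

/-- The set of vertices whose contraction is formed at the root of the tree. -/
def verts [DecidableEq V] (T : ContractionTree V) : Finset V := T.leaves.toFinset

/-- `T` contracts exactly the vertices in `S`, each of them once. -/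
def IsTreeOn [DecidableEq V] (T : ContractionTree V) (S : Finset V) : Prop :=
  T.leaves.Nodup ∧ T.verts = S

/-- The tensors formed in the tree (leaves included), each given by its set of vertices. -/
def tensors [DecidableEq V] : ContractionTree V → List (Finset V)
  | leaf v => [{v}]
  | node l r => (l.verts ∪ r.verts) :: (l.tensors ++ r.tensors)

/-- The contractions `(A, B)` performed in the tree. -/
def contractions [DecidableEq V] : ContractionTree V → List (Finset V × Finset V)
  | leaf _ => []
  | node l r => (l.verts, r.verts) :: (l.contractions ++ r.contractions)

/-- The contraction tree `T` of data and embedding is constrained on the contraction tree `T₀` of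
the data: for each contraction `(A, B)` of `T₀` there is a contraction `(A', B')` of `T` whose data
vertices are `A' ∩ V_D = A` and `B' ∩ V_D = B`. Contractions are unordered pairs. -/
def ConstrainedOn [DecidableEq V] [DecidableEq W]
    (T : ContractionTree (V ⊕ W)) (T₀ : ContractionTree V) : Prop :=
  ∀ p ∈ T₀.contractions, ∃ q ∈ T.contractions,
    (q.1.toLeft = p.1 ∧ q.2.toLeft = p.2) ∨ (q.1.toLeft = p.2 ∧ q.2.toLeft = p.1)

end ContractionTree

namespace TensorNetwork

variable {V E : Type*} [DecidableEq V] [DecidableEq E]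

/-- `E(A) = E(A, V ∖ A) ∪ E(A, *)`: the hyperedges adjacent to `A` that have a dangling end or are
adjacent to a vertex outside `A`, that is, the dimensions of the contraction output of `A`. -/
def boundary (G : TensorNetwork V E) (A : Finset V) : Finset E :=
  (A.biUnion G.inc).filter fun e => e ∈ G.dangling ∨ ∃ v ∈ G.verts \ A, e ∈ G.inc v

/-- The number of vertices adjacent to the hyperedge `e`. -/
def degree (G : TensorNetwork V E) (e : E) : ℕ := (G.verts.filter fun v => e ∈ G.inc v).card

/-- The cost `exp (cut A + cut B - cut (A, B))` of contracting (the outputs of) the disjoint sets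
`A` and `B` by dense matrix multiplication. The hyperedges connecting `A` and `B` are those in
`E(A) ∩ E(B)`, so this is the product of the sizes of the hyperedges in `E(A) ∪ E(B)`. -/
def contractionCost (G : TensorNetwork V E) (A B : Finset V) : ℕ :=
  ∏ e ∈ G.boundary A ∪ G.boundary B, G.size e

/-- The cost of a contraction tree: the sum of the costs of its contractions. -/
def treeCost (G : TensorNetwork V E) (T : ContractionTree V) : ℕ :=
  (T.contractions.map fun p => G.contractionCost p.1 p.2).sum

end TensorNetwork

/-! ### Data tensor networks -/

/-- A data tensor network together with the set `sketch` of the dimensions to be sketched. -/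
structure DataNetwork (VD ED : Type*) extends TensorNetwork VD ED where
  sketch : Finset ED

namespace DataNetwork

variable {VD ED : Type*} [DecidableEq VD] [DecidableEq ED]

/-- The standing assumptions on the data: dimension sizes are positive; there is a dimension to
sketch; the dimensions to be sketched are uncontracted and each is a dimension of only one tensor;
each tensor has at most one of them. -/
structure IsValid (D : DataNetwork VD ED) : Prop where
  size_pos : ∀ e, 0 < D.size e
  sketch_nonempty : D.sketch.Nonempty
  sketch_dangling : D.sketch ⊆ D.dangling
  sketch_degree : ∀ e ∈ D.sketch, D.degree e = 1
  sketch_unique : ∀ v ∈ D.verts, (D.sketch ∩ D.inc v).card ≤ 1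

/-- The data network is a graph: a contracted edge joins two vertices and an uncontracted edge is
adjacent to one vertex. -/
def IsGraph (D : DataNetwork VD ED) : Prop :=
  ∀ e, (e ∈ D.dangling → D.degree e ≤ 1) ∧ (e ∉ D.dangling → D.degree e ≤ 2)

/-- The dimensions to be sketched that are adjacent to the set of vertices `A`. -/
def sketchOf (D : DataNetwork VD ED) (A : Finset VD) : Finset ED :=
  A.biUnion D.inc ∩ D.sketch

/-- The dimensions of the contraction output of `A` that are not to be sketched. -/
def plainBoundary (D : DataNetwork VD ED) (A : Finset VD) : Finset ED :=
  D.boundary A \ D.sketch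

end DataNetwork

/-! ### Embeddings -/

/-- A tensor network embedding for data with dimension names in `ED`. A tensor `x` of the embedding
is adjacent to data dimensions `Sum.inl e` and to embedding edges `Sum.inr f`; `outs` is the set
of the output (uncontracted) edges, which index the rows of the embedding matrix. -/
structure Embedding (ED VE FE : Type*) where
  verts : Finset VE
  inc : VE → Finset (ED ⊕ FE)
  outs : Finset FE
  size : FE → ℕ

namespace Embedding

variable {VD ED VE FE : Type*} [DecidableEq VD] [DecidableEq ED] [DecidableEq VE] [DecidableEq FE]

/-- The number of tensors of the embedding that are adjacent to an edge. -/
def degree (S : Embedding ED VE FE) (e : ED ⊕ FE) : ℕ :=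
  (S.verts.filter fun x => e ∈ S.inc x).card

/-- `S` is a graph embedding for the data `D`: it is connected to the data exactly through the
dimensions to be sketched, each of which is adjacent to one tensor of `S`; each output edge is
adjacent to one tensor of `S` and every other edge to two. -/
structure IsGraphEmbedding (S : Embedding ED VE FE) (D : DataNetwork VD ED) : Prop where
  size_pos : ∀ f, 0 < S.size f
  data_mem : ∀ x ∈ S.verts, ∀ e, Sum.inl e ∈ S.inc x → e ∈ D.sketch
  data_degree : ∀ e ∈ D.sketch, S.degree (Sum.inl e) = 1
  out_degree : ∀ f ∈ S.outs, S.degree (Sum.inr f) = 1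
  inner_degree : ∀ x ∈ S.verts, ∀ f, f ∉ S.outs → Sum.inr f ∈ S.inc x → S.degree (Sum.inr f) = 2

/-- The output sketch size: the number of rows of the embedding matrix. -/
def sketchSize (S : Embedding ED VE FE) : ℕ := ∏ f ∈ S.outs, S.size f

/-- The row size of the matricization of the tensor at `x` in the linearization in which the tensors
are ordered by `ord`: its rows combine the output edges at `x` and the edges from `x` to later
tensors. -/
def rowSize (S : Embedding ED VE FE) (ord : VE → ℕ) (x : VE) : ℕ :=
  ∏ f ∈ (S.inc x).toRight.filter
    (fun f => f ∈ S.outs ∨ ∃ y ∈ S.verts, ord x < ord y ∧ Sum.inr f ∈ S.inc y), S.size f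

/-- There is a linearization in which every tensor of `S` has row size at least `r`. -/
def HasRowSizes (S : Embedding ED VE FE) (r : ℝ) : Prop :=
  ∃ ord : VE → ℕ, Set.InjOn ord S.verts ∧ ∀ x ∈ S.verts, r ≤ (S.rowSize ord x : ℝ)

/-- The overall tensor network formed by the data and the embedding. -/
def total (D : DataNetwork VD ED) (S : Embedding ED VE FE) : TensorNetwork (VD ⊕ VE) (ED ⊕ FE) where
  verts := D.verts.disjSum S.verts
  inc := Sum.elim (fun v => (D.inc v).map Function.Embedding.inl) S.inc
  dangling := (D.dangling \ D.sketch).disjSum S.outs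
  size := Sum.elim D.size S.size

end Embedding

/-- The sketch size `log (1 / δ) / ε ^ 2` required per tensor. -/
noncomputable def sketchUnit (ε δ : ℝ) : ℝ := Real.log (1 / δ) / ε ^ 2

/-- The class of graph embeddings for `D`, with `c₁, c₂` the constants hidden in `Ω` and `Θ`:
with `n` the number of tensors of the embedding, there is a linearization in which each tensor has
row size at least `c₁ n log (1 / δ) / ε ^ 2` (the sufficient condition for accuracy), and there is a
single output dimension, of size between `c₁ n log (1 / δ) / ε ^ 2` and
`c₂ n log (1 / δ) / ε ^ 2`. -/
structure IsAdmissible {VD ED VE FE : Type*} [DecidableEq VD] [DecidableEq ED] [DecidableEq VE]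
    [DecidableEq FE] (D : DataNetwork VD ED) (c₁ c₂ ε δ : ℝ) (S : Embedding ED VE FE) :
    Prop where
  graph : S.IsGraphEmbedding D
  accurate : S.HasRowSizes (c₁ * S.verts.card * sketchUnit ε δ)
  one_output : S.outs.card = 1
  sketchSize_ge : c₁ * S.verts.card * sketchUnit ε δ ≤ S.sketchSize
  sketchSize_le : (S.sketchSize : ℝ) ≤ c₂ * S.verts.card * sketchUnit ε δ

/-- The costs over which the optimization problem minimizes: those of the contraction trees,
constrained on `T₀`, of `D` with an admissible embedding whose sketch size is at least
`c₁ N log (1 / δ) / ε ^ 2`, where `N` is the number of dimensions to be sketched. (The names of the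
tensors and edges of the finite embedding are taken in `ℕ`, without loss of generality.) -/
def feasibleCosts {VD ED : Type*} [DecidableEq VD] [DecidableEq ED] (D : DataNetwork VD ED)
    (T₀ : ContractionTree VD) (c₁ c₂ ε δ : ℝ) : Set ℕ :=
  {c | ∃ (S : Embedding ED ℕ ℕ) (T : ContractionTree (VD ⊕ ℕ)),
    IsAdmissible D c₁ c₂ ε δ S ∧
    c₁ * D.sketch.card * sketchUnit ε δ ≤ S.sketchSize ∧
    T.IsTreeOn (Embedding.total D S).verts ∧
    T.ConstrainedOn T₀ ∧
    c = (Embedding.total D S).treeCost T}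

/-! ### The sketching algorithm

Given the data, its contraction tree and the sketch size `m`, the algorithm builds an embedding and
a contraction tree. For each `e` to be sketched, one Gaussian matrix (with about `m` rows) is applied
to one of the tensors of `T₀` whose only dimension to be sketched is `e`, at the cheapest place.
For each contraction `(U, V)` of `T₀` such that both `U` and `V` have dimensions to be sketched, a
network of two tensors is applied to their sketched versions. All other contractions are
performed as in `T₀`. -/

/-- The tensors of the embedding, named after tensors `W` of the data contraction tree: the matrix
applied to the data tensor `W`, and the first and second tensor of the small network used in
the contraction with output `W`. -/
inductive AlgVertex (VD : Type*) where
  | kron (W : Finset VD) : AlgVertex VD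
  | fst (W : Finset VD) : AlgVertex VD
  | snd (W : Finset VD) : AlgVertex VD
  deriving DecidableEq

/-- The edges of the embedding. The small network of a contraction of `U` and `V` with output
`W`, say with `U` contracted first, receives the sketch dimension of `U` through `whole W` (into its
first tensor), and that of `V` through the two edges `splitFst W` (into its first tensor) and
`splitSnd W` (into its second tensor); `mid W` joins its two tensors. `out` is the output. -/
inductive AlgEdge (VD : Type*) where
  | whole (W : Finset VD) : AlgEdge VD
  | splitFst (W : Finset VD) : AlgEdge VD
  | splitSnd (W : Finset VD) : AlgEdge VD
  | mid (W : Finset VD) : AlgEdge VD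
  | out : AlgEdge VD
  deriving DecidableEq

/-- The choices made by the algorithm: the tensor of the data contraction tree to which the matrix
for `e` is applied, and the size of the edge `splitFst W` of each small network. -/
structure AlgChoices (VD ED : Type*) where
  place : ED → Finset VD
  split : Finset VD → ℕ

/-- The size of `splitSnd` for a given size `p` of `splitFst`: the least `q` with `m ≤ p * q`. -/
def splitRest (m p : ℕ) : ℕ := (m + p - 1) / p

section Algorithm

variable {VD ED : Type*} [DecidableEq VD] [DecidableEq ED]

/-- Both tensors have dimensions to be sketched. -/
def BothSketched (D : DataNetwork VD ED) (U V : Finset VD) : Prop :=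
  (D.sketchOf U).Nonempty ∧ (D.sketchOf V).Nonempty

instance (D : DataNetwork VD ED) (U V : Finset VD) : Decidable (BothSketched D U V) :=
  inferInstanceAs (Decidable (_ ∧ _))

/-- `U` is contracted first: the size of the dimensions that only `U` has is at most the size of
those that only `V` has (dimensions to be sketched left aside). -/
def GoesFirst (D : DataNetwork VD ED) (U V : Finset VD) : Prop :=
  ∏ e ∈ D.plainBoundary U \ D.plainBoundary V, D.size e ≤
    ∏ e ∈ D.plainBoundary V \ D.plainBoundary U, D.size e

instance (D : DataNetwork VD ED) (U V : Finset VD) : Decidable (GoesFirst D U V) :=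
  inferInstanceAs (Decidable (_ ≤ _))

/-- The cost of sketching the part of `T₀` in which `e` is the only dimension to be sketched, when
a matrix with `m` rows is applied to its tensor `W`: contractions inside `W` still carry `e`, those
above `W` carry the sketch dimension instead. -/
def placeCost (D : DataNetwork VD ED) (T₀ : ContractionTree VD) (m : ℕ) (e : ED)
    (W : Finset VD) : ℕ :=
  ((T₀.contractions.filter fun p => D.sketchOf (p.1 ∪ p.2) = {e}).map fun p =>
      (∏ i ∈ D.plainBoundary p.1 ∪ D.plainBoundary p.2, D.size i) *
        (if p.1 ∪ p.2 ⊆ W then D.size e else m)).sum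
    + (∏ i ∈ D.plainBoundary W, D.size i) * D.size e * m

/-- The cost of sketching the contraction of `U` and `V`, both carrying a sketch dimension (of size
`m`, for `V` split into `p` and `splitRest m p`): contract `U` with the first tensor of the
small network, then with `V`, then with the second tensor. -/
def splitCost (D : DataNetwork VD ED) (m : ℕ) (U V : Finset VD) (p : ℕ) : ℕ :=
  (∏ i ∈ D.plainBoundary U, D.size i) * m * p * m
    + (∏ i ∈ D.plainBoundary U ∪ D.plainBoundary V, D.size i) * m * p * splitRest m p
    + (∏ i ∈ D.plainBoundary (U ∪ V), D.size i) * m * splitRest m p * m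

/-- The choices are cheapest possible. -/
structure AlgChoices.IsOptimal (ch : AlgChoices VD ED) (D : DataNetwork VD ED)
    (T₀ : ContractionTree VD) (m : ℕ) : Prop where
  place_mem : ∀ e ∈ D.sketch, ch.place e ∈ T₀.tensors ∧ D.sketchOf (ch.place e) = {e}
  place_min : ∀ e ∈ D.sketch, ∀ W ∈ T₀.tensors, D.sketchOf W = {e} →
    placeCost D T₀ m e (ch.place e) ≤ placeCost D T₀ m e W
  split_mem : ∀ p ∈ T₀.contractions, BothSketched D p.1 p.2 →
    ch.split (p.1 ∪ p.2) ∈ Finset.Icc 1 m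
  split_min : ∀ p ∈ T₀.contractions, BothSketched D p.1 p.2 → ∀ k ∈ Finset.Icc 1 m,
    if GoesFirst D p.1 p.2 then
      splitCost D m p.1 p.2 (ch.split (p.1 ∪ p.2)) ≤ splitCost D m p.1 p.2 k
    else
      splitCost D m p.2 p.1 (ch.split (p.1 ∪ p.2)) ≤ splitCost D m p.2 p.1 k

open ContractionTree in
/-- The contraction tree of data and embedding built by the algorithm. -/
def algTree (D : DataNetwork VD ED) (ch : AlgChoices VD ED) :
    ContractionTree VD → ContractionTree (VD ⊕ AlgVertex VD)
  | leaf v =>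
    if {v} ∈ D.sketch.image ch.place then
      node (leaf (Sum.inl v)) (leaf (Sum.inr (.kron {v})))
    else leaf (Sum.inl v)
  | node l r =>
    let W := l.verts ∪ r.verts
    if W ∈ D.sketch.image ch.place then
      node ((node l r).map Sum.inl) (leaf (Sum.inr (.kron W)))
    else if BothSketched D l.verts r.verts then
      if GoesFirst D l.verts r.verts then
        node (node (node (algTree D ch l) (leaf (Sum.inr (.fst W)))) (algTree D ch r))
          (leaf (Sum.inr (.snd W)))
      else
        node (node (node (algTree D ch r) (leaf (Sum.inr (.fst W)))) (algTree D ch l))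
          (leaf (Sum.inr (.snd W)))
    else node (algTree D ch l) (algTree D ch r)

open ContractionTree in
/-- The edges adjacent to the tensor `x` in the embedding of a subtree whose sketch dimension leaves
through the edges in `o`. -/
def algInc (D : DataNetwork VD ED) (ch : AlgChoices VD ED) :
    ContractionTree VD → Finset (AlgEdge VD) → AlgVertex VD → Finset (ED ⊕ AlgEdge VD)
  | leaf v, o, x =>
    if {v} ∈ D.sketch.image ch.place ∧ x = .kron {v} then (D.sketchOf {v}).disjSum o else ∅
  | node l r, o, x =>
    let W := l.verts ∪ r.verts
    if W ∈ D.sketch.image ch.place then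
      if x = .kron W then (D.sketchOf W).disjSum o else ∅
    else if BothSketched D l.verts r.verts then
      if x = .fst W then {Sum.inr (.whole W), Sum.inr (.splitFst W), Sum.inr (.mid W)}
      else if x = .snd W then
        (∅ : Finset ED).disjSum ({AlgEdge.mid W, AlgEdge.splitSnd W} ∪ o)
      else if GoesFirst D l.verts r.verts then
        algInc D ch l {.whole W} x ∪ algInc D ch r {.splitFst W, .splitSnd W} x
      else
        algInc D ch r {.whole W} x ∪ algInc D ch l {.splitFst W, .splitSnd W} x
    else algInc D ch l o x ∪ algInc D ch r o x

/-- The sizes of the edges of the embedding built by the algorithm. -/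
def algSize (ch : AlgChoices VD ED) (m : ℕ) : AlgEdge VD → ℕ
  | .splitFst W => ch.split W
  | .splitSnd W => splitRest m (ch.split W)
  | .whole _ => m
  | .mid _ => m
  | .out => m

/-- The embedding built by the algorithm. -/
def algEmbedding (D : DataNetwork VD ED) (ch : AlgChoices VD ED) (T₀ : ContractionTree VD) (m : ℕ) :
    Embedding ED (AlgVertex VD) (AlgEdge VD) where
  verts := (algTree D ch T₀).verts.toRight
  inc := algInc D ch T₀ {.out}
  outs := {.out}
  size := algSize ch m

/-- The cost of the algorithm: that of its contraction tree for the data and its embedding. -/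
def algCost (D : DataNetwork VD ED) (ch : AlgChoices VD ED) (T₀ : ContractionTree VD) (m : ℕ) : ℕ :=
  (Embedding.total D (algEmbedding D ch T₀ m)).treeCost (algTree D ch T₀)

end Algorithm

/-!
Lower bound. Direct every dimension to be sketched into the embedding, and every edge of the
embedding along its linearization, so that the edges leaving a tensor have total size at least some
`σ ^ 2` of order `m`. The last tensor of a set sends all its edges out of the set, so each side of a
contraction has outgoing edges of size at least `σ ^ 2`. When sets `A` and `B` with ingoing edges of
size at most `s` merge, the last tensor of one of them may lose its edges into the other, so the
union still has outgoing edges of size at least `σ ^ 4 / s`. Hence, if the directed edges of a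
contraction have total size below `σ ^ 5`, each side has outgoing edges below `σ ^ 3` and the union
has ingoing edges below `σ`, but one side has ingoing edges of size at least `σ`, or the union
outgoing edges of size at least `σ ^ 3`. Such a contraction uses up ingoing edges or produces
outgoing ones, so an induction over the tree and the size `O(m)` of the output leave at least
`(N - 1) / 5` contractions that carry directed edges of size `Ω(m ^ (5 / 2))`.

Upper bound. The algorithm places its matrices optimally. When two sketched tensors meet, let `a`,
`b`, `c` be the sizes of the dimensions of `U` only, `V` only, and both, with `a ≤ b`. The small
network costs at most `m ^ 2` times the sum of `a c p`, `2 a b c` and, if `G_D` is a graph,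
`4 a b m / p`. In general `p = √m` loses a factor `√m`. For a graph `p = √(m b / c)` gives
`a √(b c) √m`, which is at most `m ^ (3 / 8) (a b c + √m)` because `a ≤ b`; the additional
`m ^ (5 / 2)` per contraction is paid for by the heavy contractions of the lower bound.
-/

/-! ### Contraction trees -/

namespace ContractionTree

variable {V : Type*}

theorem nodup_left {l r : ContractionTree V} (h : (node l r).leaves.Nodup) : l.leaves.Nodup :=
  (List.nodup_append'.1 h).1

theorem nodup_right {l r : ContractionTree V} (h : (node l r).leaves.Nodup) : r.leaves.Nodup :=
  (List.nodup_append'.1 h).2.1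

variable [DecidableEq V]

@[simp] theorem verts_leaf (v : V) : (leaf v).verts = {v} := rfl

@[simp] theorem verts_node (l r : ContractionTree V) : (node l r).verts = l.verts ∪ r.verts := by
  simp only [verts, leaves, List.toFinset_append]

theorem mem_tensors_node {l r : ContractionTree V} {A : Finset V} :
    A ∈ (node l r).tensors ↔ A = l.verts ∪ r.verts ∨ A ∈ l.tensors ∨ A ∈ r.tensors := by
  simp only [tensors, List.mem_cons, List.mem_append]

theorem mem_contractions_node {l r : ContractionTree V} {p : Finset V × Finset V} :
    p ∈ (node l r).contractions ↔
      p = (l.verts, r.verts) ∨ p ∈ l.contractions ∨ p ∈ r.contractions := by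
  simp only [contractions, List.mem_cons, List.mem_append]

theorem verts_nonempty (t : ContractionTree V) : t.verts.Nonempty := by
  induction t with
  | leaf v => exact Finset.singleton_nonempty v
  | node l r hl _ => simpa using hl.mono Finset.subset_union_left

theorem disjoint_verts {l r : ContractionTree V} (h : (node l r).leaves.Nodup) :
    Disjoint l.verts r.verts :=
  Finset.disjoint_left.2 fun _ ha hb =>
    (List.nodup_append'.1 h).2.2 (List.mem_toFinset.1 ha) (List.mem_toFinset.1 hb)

theorem verts_mem_tensors (t : ContractionTree V) : t.verts ∈ t.tensors := by
  cases t <;> simp [tensors]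

theorem subset_verts_of_mem_tensors {t : ContractionTree V} {A : Finset V} (h : A ∈ t.tensors) :
    A ⊆ t.verts := by
  induction t with
  | leaf v => exact (List.mem_singleton.1 h).subset
  | node l r hl hr =>
    rw [verts_node]
    rcases mem_tensors_node.1 h with h | h | h
    · exact h.le
    · exact (hl h).trans Finset.subset_union_left
    · exact (hr h).trans Finset.subset_union_right

theorem nonempty_of_mem_tensors {t : ContractionTree V} {A : Finset V} (h : A ∈ t.tensors) :
    A.Nonempty := by
  induction t with
  | leaf v => exact List.mem_singleton.1 h ▸ Finset.singleton_nonempty v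
  | node l r hl hr =>
    rcases mem_tensors_node.1 h with rfl | h | h
    · exact l.verts_nonempty.mono Finset.subset_union_left
    · exact hl h
    · exact hr h

theorem mem_tensors_of_mem_contractions {t : ContractionTree V} {p : Finset V × Finset V}
    (h : p ∈ t.contractions) : p.1 ∈ t.tensors ∧ p.2 ∈ t.tensors ∧ p.1 ∪ p.2 ∈ t.tensors := by
  induction t with
  | leaf v => exact absurd h List.not_mem_nil
  | node l r hl hr =>
    simp only [mem_tensors_node]
    rcases mem_contractions_node.1 h with rfl | h | h
    · exact ⟨.inr (.inl l.verts_mem_tensors), .inr (.inr r.verts_mem_tensors), .inl rfl⟩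
    · have := hl h; tauto
    · have := hr h; tauto

theorem union_subset_of_mem_contractions {t : ContractionTree V} {p : Finset V × Finset V}
    (h : p ∈ t.contractions) : p.1 ∪ p.2 ⊆ t.verts :=
  subset_verts_of_mem_tensors (mem_tensors_of_mem_contractions h).2.2

theorem union_nonempty_of_mem_contractions {t : ContractionTree V}
    {p : Finset V × Finset V} (h : p ∈ t.contractions) : (p.1 ∪ p.2).Nonempty :=
  nonempty_of_mem_tensors (mem_tensors_of_mem_contractions h).2.2

theorem disjoint_of_mem_contractions {t : ContractionTree V} (ht : t.leaves.Nodup)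
    {p : Finset V × Finset V} (h : p ∈ t.contractions) : Disjoint p.1 p.2 := by
  induction t with
  | leaf v => exact absurd h List.not_mem_nil
  | node l r hl hr =>
    rcases mem_contractions_node.1 h with rfl | h | h
    · exact disjoint_verts ht
    · exact hl (nodup_left ht) h
    · exact hr (nodup_right ht) h

theorem laminar_tensors {t : ContractionTree V} (ht : t.leaves.Nodup) {A B : Finset V}
    (hA : A ∈ t.tensors) (hB : B ∈ t.tensors) : Disjoint A B ∨ A ⊆ B ∨ B ⊆ A := by
  induction t with
  | leaf v => exact .inr (.inl (by rw [List.mem_singleton.1 hA, List.mem_singleton.1 hB]))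
  | node l r hl hr =>
    have hd := disjoint_verts ht
    have hA' := subset_verts_of_mem_tensors hA
    have hB' := subset_verts_of_mem_tensors hB
    rw [verts_node] at hA' hB'
    rcases mem_tensors_node.1 hA with rfl | hA | hA
    · exact .inr (.inr hB')
    · rcases mem_tensors_node.1 hB with rfl | hB | hB
      · exact .inr (.inl hA')
      · exact hl (nodup_left ht) hA hB
      · exact .inl (hd.mono (subset_verts_of_mem_tensors hA) (subset_verts_of_mem_tensors hB))
    · rcases mem_tensors_node.1 hB with rfl | hB | hB
      · exact .inr (.inl hA')
      · exact .inl
          (hd.symm.mono (subset_verts_of_mem_tensors hA) (subset_verts_of_mem_tensors hB))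
      · exact hr (nodup_right ht) hA hB

theorem not_subset_of_union_subset {A B C : Finset V} (hAB : Disjoint A B) (hB : B.Nonempty)
    (h : A ∪ B ⊆ C) : ¬ C ⊆ A := fun hCA =>
  hB.ne_empty (Finset.disjoint_self_iff_empty B |>.1
    (hAB.mono_left ((Finset.subset_union_right.trans h).trans hCA)))

theorem not_subset_left {l r : ContractionTree V} (h : (node l r).leaves.Nodup) {A : Finset V}
    (hA : l.verts ∪ r.verts ⊆ A) : ¬ A ⊆ l.verts :=
  not_subset_of_union_subset (disjoint_verts h) r.verts_nonempty hA

theorem not_subset_right {l r : ContractionTree V} (h : (node l r).leaves.Nodup) {A : Finset V}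
    (hA : l.verts ∪ r.verts ⊆ A) : ¬ A ⊆ r.verts :=
  not_subset_of_union_subset (disjoint_verts h).symm l.verts_nonempty
    (Finset.union_comm l.verts r.verts ▸ hA)

theorem union_ne_of_mem_contractions {l r : ContractionTree V} (h : (node l r).leaves.Nodup)
    {p q : Finset V × Finset V} (hp : p ∈ l.contractions) (hq : q ∈ r.contractions) :
    p.1 ∪ p.2 ≠ q.1 ∪ q.2 := by
  intro he
  obtain ⟨x, hx⟩ := union_nonempty_of_mem_contractions hp
  exact Finset.disjoint_left.1 (disjoint_verts h) (union_subset_of_mem_contractions hp hx)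
    (union_subset_of_mem_contractions hq (he ▸ hx))

theorem contraction_ext {t : ContractionTree V} (ht : t.leaves.Nodup)
    {p q : Finset V × Finset V} (hp : p ∈ t.contractions) (hq : q ∈ t.contractions)
    (h : p.1 ∪ p.2 = q.1 ∪ q.2) : p = q := by
  induction t with
  | leaf v => exact absurd hp List.not_mem_nil
  | node l r hl hr =>
    rcases mem_contractions_node.1 hp with rfl | hp | hp <;>
      rcases mem_contractions_node.1 hq with rfl | hq | hq
    · rfl
    · exact absurd (union_subset_of_mem_contractions hq) (not_subset_left ht h.le)
    · exact absurd (union_subset_of_mem_contractions hq) (not_subset_right ht h.le)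
    · exact absurd (union_subset_of_mem_contractions hp) (not_subset_left ht h.ge)
    · exact hl (nodup_left ht) hp hq
    · exact absurd h (union_ne_of_mem_contractions ht hp hq)
    · exact absurd (union_subset_of_mem_contractions hp) (not_subset_right ht h.ge)
    · exact absurd h.symm (union_ne_of_mem_contractions ht hq hp)
    · exact hr (nodup_right ht) hp hq

theorem nodup_contractions {t : ContractionTree V} (ht : t.leaves.Nodup) :
    t.contractions.Nodup := by
  induction t with
  | leaf v => exact List.nodup_nil
  | node l r hl hr =>
    simp only [contractions, List.nodup_cons, List.mem_append, not_or]
    refine ⟨⟨fun h => ?_, fun h => ?_⟩, List.nodup_append'.2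
      ⟨hl (nodup_left ht), hr (nodup_right ht), fun p hp hq => ?_⟩⟩
    · exact not_subset_left ht le_rfl (union_subset_of_mem_contractions h)
    · exact not_subset_right ht le_rfl (union_subset_of_mem_contractions h)
    · exact union_ne_of_mem_contractions ht hp hq rfl

theorem sum_map_contractions {t : ContractionTree V} (ht : t.leaves.Nodup) {M : Type*}
    [AddCommMonoid M] (g : Finset V × Finset V → M) :
    (t.contractions.map g).sum = ∑ p ∈ t.contractions.toFinset, g p :=
  (List.sum_toFinset g (nodup_contractions ht)).symm

theorem mem_tensors_or_exists_split {t : ContractionTree V} {A : Finset V} (hA : A ⊆ t.verts)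
    (hne : A.Nonempty) :
    A ∈ t.tensors ∨ ∃ p ∈ t.contractions, A ⊆ p.1 ∪ p.2 ∧ ¬ A ⊆ p.1 ∧ ¬ A ⊆ p.2 := by
  induction t with
  | leaf v => exact .inl (List.mem_singleton.2 ((hne.subset_singleton_iff).1 hA))
  | node l r hl hr =>
    simp only [mem_tensors_node, mem_contractions_node]
    by_cases hAl : A ⊆ l.verts
    · rcases hl hAl with h | ⟨p, hp, h⟩
      · exact .inl (.inr (.inl h))
      · exact .inr ⟨p, .inr (.inl hp), h⟩
    by_cases hAr : A ⊆ r.verts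
    · rcases hr hAr with h | ⟨p, hp, h⟩
      · exact .inl (.inr (.inr h))
      · exact .inr ⟨p, .inr (.inr hp), h⟩
    · exact .inr ⟨_, .inl rfl, by simpa using hA, hAl, hAr⟩

section Constrained

variable {W : Type*} [DecidableEq W] {T : ContractionTree (V ⊕ W)} {T₀ : ContractionTree V}

theorem laminar_toLeft_tensors (hT : T.leaves.Nodup) {A B : Finset (V ⊕ W)} (hA : A ∈ T.tensors)
    (hB : B ∈ T.tensors) :
    Disjoint A.toLeft B.toLeft ∨ A.toLeft ⊆ B.toLeft ∨ B.toLeft ⊆ A.toLeft := by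
  rcases laminar_tensors hT hA hB with h | h | h
  · exact .inl (Finset.disjoint_left.2 fun _ hx hx' =>
      Finset.disjoint_left.1 h (Finset.mem_toLeft.1 hx) (Finset.mem_toLeft.1 hx'))
  · exact .inr (.inl (Finset.toLeft_subset_toLeft h))
  · exact .inr (.inr (Finset.toLeft_subset_toLeft h))

theorem ConstrainedOn.exists_tensors_toLeft_eq (h : T.ConstrainedOn T₀)
    {p : Finset V × Finset V} (hp : p ∈ T₀.contractions) :
    (∃ B ∈ T.tensors, B.toLeft = p.1) ∧ ∃ B ∈ T.tensors, B.toLeft = p.2 := by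
  obtain ⟨q, hq, hqp⟩ := h p hp
  obtain ⟨h₁, h₂, -⟩ := mem_tensors_of_mem_contractions hq
  rcases hqp with ⟨e₁, e₂⟩ | ⟨e₁, e₂⟩
  · exact ⟨⟨q.1, h₁, e₁⟩, q.2, h₂, e₂⟩
  · exact ⟨⟨q.2, h₂, e₂⟩, q.1, h₁, e₁⟩

theorem ConstrainedOn.toLeft_mem_tensors (h : T.ConstrainedOn T₀) (hT : T.leaves.Nodup)
    {A : Finset (V ⊕ W)} (hA : A ∈ T.tensors) (hne : A.toLeft.Nonempty)
    (hsub : A.toLeft ⊆ T₀.verts) : A.toLeft ∈ T₀.tensors := by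
  obtain hA₀ | ⟨p, hp, hAp, hA₁, hA₂⟩ := mem_tensors_or_exists_split hsub hne
  · exact hA₀
  -- By laminarity a split of the data vertices of `A` can only split `A` into its two halves.
  obtain ⟨⟨B, hB, hB₁⟩, C, hC, hC₂⟩ := h.exists_tensors_toLeft_eq hp
  have h₁ : p.1 ⊆ A.toLeft := by
    rw [← hB₁] at hAp hA₁ ⊢
    rcases laminar_toLeft_tensors hT hA hB with hd | hs | hs
    · exact absurd (hd.left_le_of_le_sup_left hAp) hA₂
    · exact absurd hs hA₁
    · exact hs
  have h₂ : p.2 ⊆ A.toLeft := by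
    rw [← hC₂] at hAp hA₂ ⊢
    rcases laminar_toLeft_tensors hT hA hC with hd | hs | hs
    · exact absurd (hd.left_le_of_le_sup_right hAp) hA₁
    · exact absurd hs hA₂
    · exact hs
  rw [hAp.antisymm (Finset.union_subset h₁ h₂)]
  exact (mem_tensors_of_mem_contractions hp).2.2

end Constrained

end ContractionTree

/-! ### Oriented networks and heavy contractions -/

namespace TensorNetwork

variable {V E : Type*}

/-- The size of the tensor whose dimensions are the hyperedges in `B`. -/
def sizeProd (G : TensorNetwork V E) (B : Finset E) : ℕ := ∏ e ∈ B, G.size e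

section SizeProd

variable {G : TensorNetwork V E}

theorem sizeProd_mono (hG : ∀ e, 0 < G.size e) {B C : Finset E} (h : B ⊆ C) :
    G.sizeProd B ≤ G.sizeProd C :=
  Finset.prod_le_prod_of_subset_of_one_le' h fun e _ _ => hG e

theorem sizeProd_pos (hG : ∀ e, 0 < G.size e) (B : Finset E) : 0 < G.sizeProd B :=
  Finset.prod_pos fun e _ => hG e

variable [DecidableEq E]

theorem sizeProd_union {B C : Finset E} (h : Disjoint B C) :
    G.sizeProd (B ∪ C) = G.sizeProd B * G.sizeProd C := Finset.prod_union h

theorem sizeProd_le_mul_sdiff (hG : ∀ e, 0 < G.size e) (B C : Finset E) :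
    G.sizeProd B ≤ G.sizeProd C * G.sizeProd (B \ C) := by
  rw [← sizeProd_union Finset.disjoint_sdiff, Finset.union_sdiff_self_eq_union]
  exact sizeProd_mono hG Finset.subset_union_right

theorem contractionCost_comm [DecidableEq V] (A B : Finset V) :
    G.contractionCost A B = G.contractionCost B A := by
  rw [contractionCost, contractionCost, Finset.union_comm]

end SizeProd

/-- Some of the hyperedges of `G`, directed from `src` to `dst` (`none` for an edge with a dangling
end) along a ranking of the vertices. Of the hyperedge only these ends are recorded; they lie in the
set `active`. -/
structure Orientation (G : TensorNetwork V E) where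
  edges : Finset E
  active : Finset V
  rank : V → ℕ
  src : E → V
  dst : E → Option V
  active_subset : active ⊆ G.verts
  src_mem : ∀ e ∈ edges, src e ∈ active
  dst_mem : ∀ e ∈ edges, ∀ v ∈ dst e, v ∈ active
  rank_lt : ∀ e ∈ edges, ∀ v ∈ dst e, rank (src e) < rank v
  src_inc : ∀ e ∈ edges, e ∈ G.inc (src e)
  dst_inc : ∀ e ∈ edges, ∀ v ∈ dst e, e ∈ G.inc v
  dangling : ∀ e ∈ edges, dst e = none → e ∈ G.dangling

namespace Orientation

variable [DecidableEq V] {G : TensorNetwork V E}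

/-- The directed edges that leave `A`. -/
def outEdges (O : G.Orientation) (A : Finset V) : Finset E :=
  O.edges.filter fun e => O.src e ∈ A ∧ ∀ v ∈ O.dst e, v ∉ A

/-- The directed edges that enter `A`. -/
def inEdges (O : G.Orientation) (A : Finset V) : Finset E :=
  O.edges.filter fun e => O.src e ∉ A ∧ ∃ v ∈ O.dst e, v ∈ A

/-- The directed edges with source `v`. -/
def rowEdges (O : G.Orientation) (v : V) : Finset E := O.edges.filter fun e => O.src e = v

/-- The directed edges among the dimensions of the contraction of `A` and `B`. -/
def carried [DecidableEq E] (O : G.Orientation) (A B : Finset V) : Finset E :=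
  O.outEdges A ∪ O.outEdges B ∪ O.inEdges (A ∪ B)

variable {O : G.Orientation} {A B : Finset V}

theorem mem_outEdges {e : E} :
    e ∈ O.outEdges A ↔ e ∈ O.edges ∧ O.src e ∈ A ∧ ∀ v ∈ O.dst e, v ∉ A := Finset.mem_filter

theorem mem_inEdges {e : E} :
    e ∈ O.inEdges A ↔ e ∈ O.edges ∧ O.src e ∉ A ∧ ∃ v ∈ O.dst e, v ∈ A := Finset.mem_filter

theorem mem_rowEdges {e : E} {v : V} : e ∈ O.rowEdges v ↔ e ∈ O.edges ∧ O.src e = v :=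
  Finset.mem_filter

theorem rowEdges_subset_outEdges {v : V} (hv : v ∈ A)
    (hmax : ∀ e ∈ O.edges, ∀ w ∈ O.dst e, w ∈ A → O.rank w ≤ O.rank v) :
    O.rowEdges v ⊆ O.outEdges A := by
  intro e hrow
  obtain ⟨he, rfl⟩ := mem_rowEdges.1 hrow
  exact mem_outEdges.2
    ⟨he, hv, fun w hw hwA => (O.rank_lt e he w hw).not_ge (hmax e he w hw hwA)⟩

theorem rowEdges_sdiff_inEdges_subset_outEdges [DecidableEq E] (hAB : Disjoint A B) {v : V}
    (hv : v ∈ B) (hmax : ∀ w ∈ B ∩ O.active, O.rank w ≤ O.rank v) :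
    O.rowEdges v \ O.inEdges A ⊆ O.outEdges (A ∪ B) := by
  intro e hdiff
  obtain ⟨hrow, hin⟩ := Finset.mem_sdiff.1 hdiff
  obtain ⟨he, rfl⟩ := mem_rowEdges.1 hrow
  refine mem_outEdges.2 ⟨he, Finset.mem_union_right _ hv, fun w hw hwAB => ?_⟩
  rcases Finset.mem_union.1 hwAB with hwA | hwB
  · exact hin (mem_inEdges.2 ⟨he, fun h => Finset.disjoint_left.1 hAB h hv, w, hw, hwA⟩)
  · exact (O.rank_lt e he w hw).not_ge
      (hmax w (Finset.mem_inter.2 ⟨hwB, O.dst_mem e he w hw⟩))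

theorem le_sizeProd_outEdges (hG : ∀ e, 0 < G.size e) {S : Finset V}
    (hS : ∀ e ∈ O.edges, ∀ v ∈ O.dst e, v ∈ S) {μ : ℝ}
    (hrow : ∀ v ∈ S, μ ≤ G.sizeProd (O.rowEdges v)) (hA : (A ∩ S).Nonempty) :
    μ ≤ G.sizeProd (O.outEdges A) := by
  obtain ⟨v, hv, hmax⟩ := Finset.exists_max_image (A ∩ S) O.rank hA
  obtain ⟨hvA, hvS⟩ := Finset.mem_inter.1 hv
  have hsub : O.rowEdges v ⊆ O.outEdges A := rowEdges_subset_outEdges hvA fun e he w hw hwA =>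
    hmax w (Finset.mem_inter.2 ⟨hwA, hS e he w hw⟩)
  exact (hrow v hvS).trans (by exact_mod_cast sizeProd_mono hG hsub)

/-- Let `x` and `y` be the active vertices of largest rank in `A` and in `B`, with `x` the later.
The edges out of `x` leave `A ∪ B`, and so do those out of `y` except the ones that enter `A`. -/
theorem sq_le_mul_sizeProd_outEdges_union (hG : ∀ e, 0 < G.size e) {μ s : ℝ}
    (hμ : 0 ≤ μ) (hrow : ∀ v ∈ O.active, μ ≤ G.sizeProd (O.rowEdges v)) (hAB : Disjoint A B)
    (hA : (A ∩ O.active).Nonempty) (hB : (B ∩ O.active).Nonempty)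
    (hsA : (G.sizeProd (O.inEdges A) : ℝ) ≤ s) (hsB : (G.sizeProd (O.inEdges B) : ℝ) ≤ s) :
    μ ^ 2 ≤ s * G.sizeProd (O.outEdges (A ∪ B)) := by
  classical
  obtain ⟨x, hx, hxmax⟩ := Finset.exists_max_image (A ∩ O.active) O.rank hA
  obtain ⟨y, hy, hymax⟩ := Finset.exists_max_image (B ∩ O.active) O.rank hB
  wlog hyx : O.rank y ≤ O.rank x generalizing A B x y
  · rw [Finset.union_comm]
    exact this hAB.symm hB hA hsB hsA y hy hymax x hx hxmax (le_of_not_ge hyx)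
  obtain ⟨hxA, hxact⟩ := Finset.mem_inter.1 hx
  obtain ⟨hyB, hyact⟩ := Finset.mem_inter.1 hy
  have hxout : O.rowEdges x ⊆ O.outEdges (A ∪ B) := by
    refine rowEdges_subset_outEdges (Finset.mem_union_left _ hxA) fun e he w hw hwAB => ?_
    have hwact := O.dst_mem e he w hw
    rcases Finset.mem_union.1 hwAB with hwA | hwB
    · exact hxmax w (Finset.mem_inter.2 ⟨hwA, hwact⟩)
    · exact (hymax w (Finset.mem_inter.2 ⟨hwB, hwact⟩)).trans hyx
  have hdisj : Disjoint (O.rowEdges x) (O.rowEdges y \ O.inEdges A) := by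
    refine Finset.disjoint_left.2 fun e he he' => Finset.disjoint_left.1 hAB hxA ?_
    have hex := (mem_rowEdges.1 he).2
    have hey := (mem_rowEdges.1 (Finset.mem_sdiff.1 he').1).2
    rwa [← hex, hey]
  have hprod : (G.sizeProd (O.rowEdges x) : ℝ) * G.sizeProd (O.rowEdges y \ O.inEdges A) ≤
      G.sizeProd (O.outEdges (A ∪ B)) := by
    rw [← Nat.cast_mul, ← sizeProd_union hdisj]
    exact_mod_cast sizeProd_mono hG
      (Finset.union_subset hxout (rowEdges_sdiff_inEdges_subset_outEdges hAB hyB hymax))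
  have hyrow : μ ≤ s * G.sizeProd (O.rowEdges y \ O.inEdges A) := by
    calc μ ≤ (G.sizeProd (O.rowEdges y) : ℝ) := hrow y hyact
      _ ≤ G.sizeProd (O.inEdges A) * G.sizeProd (O.rowEdges y \ O.inEdges A) := by
        exact_mod_cast sizeProd_le_mul_sdiff hG _ _
      _ ≤ _ := by gcongr
  calc μ ^ 2 = μ * μ := sq μ
    _ ≤ G.sizeProd (O.rowEdges x) * (s * G.sizeProd (O.rowEdges y \ O.inEdges A)) :=
      mul_le_mul (hrow x hxact) hyrow hμ (Nat.cast_nonneg _)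
    _ = s * (G.sizeProd (O.rowEdges x) * G.sizeProd (O.rowEdges y \ O.inEdges A)) := by ring
    _ ≤ _ := mul_le_mul_of_nonneg_left hprod ((Nat.cast_nonneg _).trans hsA)

theorem outEdges_congr (hAB : A ∩ O.active = B ∩ O.active) : O.outEdges A = O.outEdges B := by
  have hmem : ∀ v ∈ O.active, (v ∈ A ↔ v ∈ B) := fun v hv => by
    simpa [hv] using Finset.ext_iff.1 hAB v
  refine Finset.filter_congr fun e he => ?_
  rw [hmem _ (O.src_mem e he)]
  exact and_congr_right fun _ => forall₂_congr fun v hv => by rw [hmem v (O.dst_mem e he v hv)]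

theorem inEdges_congr (hAB : A ∩ O.active = B ∩ O.active) : O.inEdges A = O.inEdges B := by
  have hmem : ∀ v ∈ O.active, (v ∈ A ↔ v ∈ B) := fun v hv => by
    simpa [hv] using Finset.ext_iff.1 hAB v
  refine Finset.filter_congr fun e he => ?_
  rw [hmem _ (O.src_mem e he)]
  exact and_congr_right fun _ => exists_congr fun v =>
    and_congr_right fun hv => by rw [hmem v (O.dst_mem e he v hv)]

theorem disjoint_outEdges (hAB : Disjoint A B) : Disjoint (O.outEdges A) (O.outEdges B) :=
  Finset.disjoint_left.2 fun _ he he' =>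
    Finset.disjoint_left.1 hAB (mem_outEdges.1 he).2.1 (mem_outEdges.1 he').2.1

theorem card_sources_leaf_le (hG : ∀ e, 0 < G.size e) {σ : ℝ} (hσ : 0 < σ)
    (hrow : ∀ v ∈ O.active, σ ^ 2 ≤ G.sizeProd (O.rowEdges v)) {S : Finset V} (hS : S ⊆ O.active)
    (hdst : ∀ e ∈ O.edges, ∀ v ∈ O.dst e, v ∉ S) (v : V) :
    ({v} ∩ S).card + (if σ ≤ (G.sizeProd (O.inEdges {v}) : ℝ) then 1 else 0) ≤
      (if σ ^ 3 ≤ (G.sizeProd (O.outEdges {v}) : ℝ) then 1 else 0) + 1 := by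
  by_cases hv : v ∈ S
  · have hin : O.inEdges {v} = ∅ := Finset.filter_eq_empty_iff.2 fun e he ⟨_, w, hw, hwv⟩ =>
      hdst e he w hw (Finset.mem_singleton.1 hwv ▸ hv)
    have hout : σ ^ 2 ≤ (G.sizeProd (O.outEdges {v}) : ℝ) :=
      le_sizeProd_outEdges hG O.dst_mem hrow ⟨v, by simp [hS hv]⟩
    have hcard : ({v} ∩ S).card = 1 := by simp [hv]
    rw [hin, sizeProd, Finset.prod_empty, Nat.cast_one, hcard]
    by_cases hσ1 : σ ≤ 1
    · rw [if_pos hσ1, if_pos ((pow_le_pow_of_le_one hσ.le hσ1 (by norm_num)).trans hout)]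
    · rw [if_neg hσ1]
      omega
  · rw [Finset.singleton_inter_of_notMem hv, Finset.card_empty]
    split_ifs <;> omega

variable [DecidableEq E]

theorem outEdges_subset_boundary (O : G.Orientation) (A : Finset V) :
    O.outEdges A ⊆ G.boundary A := by
  intro e he
  obtain ⟨he, hsrc, hdst⟩ := mem_outEdges.1 he
  refine Finset.mem_filter.2 ⟨Finset.mem_biUnion.2 ⟨_, hsrc, O.src_inc e he⟩, ?_⟩
  cases hv : O.dst e with
  | none => exact .inl (O.dangling e he hv)
  | some v =>
    exact .inr ⟨v, Finset.mem_sdiff.2 ⟨O.active_subset (O.dst_mem e he v hv), hdst v hv⟩,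
      O.dst_inc e he v hv⟩

theorem inEdges_subset_boundary (O : G.Orientation) (A : Finset V) :
    O.inEdges A ⊆ G.boundary A := by
  intro e he
  obtain ⟨he, hsrc, v, hv, hvA⟩ := mem_inEdges.1 he
  exact Finset.mem_filter.2 ⟨Finset.mem_biUnion.2 ⟨v, hvA, O.dst_inc e he v hv⟩,
    .inr ⟨_, Finset.mem_sdiff.2 ⟨O.active_subset (O.src_mem e he), hsrc⟩, O.src_inc e he⟩⟩

theorem inEdges_union_subset (O : G.Orientation) (A B : Finset V) :
    O.inEdges (A ∪ B) ⊆ O.inEdges A ∪ O.inEdges B := by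
  intro e he
  simp only [mem_inEdges, Finset.mem_union, not_or] at he ⊢
  obtain ⟨he, ⟨hsA, hsB⟩, v, hv, hvA | hvB⟩ := he
  · exact .inl ⟨he, hsA, v, hv, hvA⟩
  · exact .inr ⟨he, hsB, v, hv, hvB⟩

theorem carried_subset_boundary (O : G.Orientation) (A B : Finset V) :
    O.carried A B ⊆ G.boundary A ∪ G.boundary B :=
  Finset.union_subset
    (Finset.union_subset_union (O.outEdges_subset_boundary A) (O.outEdges_subset_boundary B))
    ((O.inEdges_union_subset A B).trans
      (Finset.union_subset_union (O.inEdges_subset_boundary A) (O.inEdges_subset_boundary B)))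

theorem carried_comm (O : G.Orientation) (A B : Finset V) : O.carried A B = O.carried B A := by
  rw [carried, carried, Finset.union_comm A B, Finset.union_comm (O.outEdges A)]

theorem sizeProd_carried (hAB : Disjoint A B) :
    G.sizeProd (O.carried A B) =
      G.sizeProd (O.outEdges A) * G.sizeProd (O.outEdges B) * G.sizeProd (O.inEdges (A ∪ B)) := by
  have hin : Disjoint (O.outEdges A ∪ O.outEdges B) (O.inEdges (A ∪ B)) := by
    refine Finset.disjoint_left.2 fun e he he' => (mem_inEdges.1 he').2.1 ?_
    exact Finset.mem_union.2 ((Finset.mem_union.1 he).imp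
      (fun h => (mem_outEdges.1 h).2.1) fun h => (mem_outEdges.1 h).2.1)
  rw [carried, sizeProd_union hin, sizeProd_union (disjoint_outEdges hAB)]

theorem mul_sizeProd_outEdges_le_carried (hG : ∀ e, 0 < G.size e) (hAB : Disjoint A B) :
    (G.sizeProd (O.outEdges A) * G.sizeProd (O.outEdges B) : ℝ) ≤ G.sizeProd (O.carried A B) := by
  rw [sizeProd_carried hAB]
  exact_mod_cast Nat.le_mul_of_pos_right _ (sizeProd_pos hG _)

/-- The number of contractions of `T` that carry directed edges of total size at least `c`. -/
noncomputable def heavyCount (O : G.Orientation) (T : ContractionTree V) (c : ℝ) : ℕ :=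
  T.contractions.countP fun p => c ≤ (G.sizeProd (O.carried p.1 p.2) : ℝ)

theorem heavyCount_node (l r : ContractionTree V) (c : ℝ) :
    O.heavyCount (.node l r) c = O.heavyCount l c + O.heavyCount r c +
      (if c ≤ (G.sizeProd (O.carried l.verts r.verts) : ℝ) then 1 else 0) := by
  simp only [heavyCount, ContractionTree.contractions, List.countP_cons, List.countP_append,
    decide_eq_true_eq]

theorem heavyCount_anti (T : ContractionTree V) : Antitone (O.heavyCount T) := fun c c' h =>
  List.countP_mono_left fun p _ hp => by
    simp only [decide_eq_true_eq] at hp ⊢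
    exact h.trans hp

theorem heavyCount_mul_le_treeCost (hG : ∀ e, 0 < G.size e) (T : ContractionTree V) (c : ℝ) :
    O.heavyCount T c * c ≤ G.treeCost T := by
  set cost : Finset V × Finset V → ℕ := fun p => G.contractionCost p.1 p.2
  set heavy := T.contractions.filter fun p => c ≤ (G.sizeProd (O.carried p.1 p.2) : ℝ)
  have hle : ∀ x ∈ heavy.map fun p => (cost p : ℝ), c ≤ x := by
    intro x hx
    obtain ⟨p, hp, rfl⟩ := List.mem_map.1 hx
    refine (of_decide_eq_true (List.mem_filter.1 hp).2).trans ?_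
    exact_mod_cast sizeProd_mono hG (O.carried_subset_boundary p.1 p.2)
  have hsum : (heavy.map cost).sum ≤ (T.contractions.map cost).sum :=
    (List.filter_sublist.map cost).sum_le_sum fun _ _ => Nat.zero_le _
  calc (O.heavyCount T c : ℝ) * c = (heavy.map fun p => (cost p : ℝ)).length • c := by
        rw [List.length_map, nsmul_eq_mul, heavyCount, List.countP_eq_length_filter]
    _ ≤ (heavy.map fun p => (cost p : ℝ)).sum := List.card_nsmul_le_sum _ _ hle
    _ = ((heavy.map cost).sum : ℕ) := by
        rw [Nat.cast_list_sum, List.map_map]; rfl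
    _ ≤ G.treeCost T := by exact_mod_cast hsum

theorem cheap_contraction (hG : ∀ e, 0 < G.size e) {σ : ℝ} (hσ : 0 < σ)
    (hrow : ∀ v ∈ O.active, σ ^ 2 ≤ G.sizeProd (O.rowEdges v)) (hAB : Disjoint A B)
    (hA : (A ∩ O.active).Nonempty) (hB : (B ∩ O.active).Nonempty)
    (hcheap : ¬ σ ^ 5 ≤ (G.sizeProd (O.carried A B) : ℝ)) :
    ¬ σ ^ 3 ≤ (G.sizeProd (O.outEdges A) : ℝ) ∧ ¬ σ ^ 3 ≤ (G.sizeProd (O.outEdges B) : ℝ) ∧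
      ¬ σ ≤ (G.sizeProd (O.inEdges (A ∪ B)) : ℝ) ∧
      (σ ≤ (G.sizeProd (O.inEdges A) : ℝ) ∨ σ ≤ (G.sizeProd (O.inEdges B) : ℝ) ∨
        σ ^ 3 ≤ (G.sizeProd (O.outEdges (A ∪ B)) : ℝ)) := by
  have hAout := le_sizeProd_outEdges hG O.dst_mem hrow hA
  have hBout := le_sizeProd_outEdges hG O.dst_mem hrow hB
  have hmul := mul_sizeProd_outEdges_le_carried (O := O) hG hAB
  refine ⟨fun h => hcheap ?_, fun h => hcheap ?_, fun h => hcheap ?_, ?_⟩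
  · refine le_trans ?_ hmul
    calc σ ^ 5 = σ ^ 3 * σ ^ 2 := by ring
      _ ≤ _ := by gcongr
  · refine le_trans ?_ hmul
    calc σ ^ 5 = σ ^ 2 * σ ^ 3 := by ring
      _ ≤ _ := by gcongr
  · rw [sizeProd_carried hAB]
    push_cast
    calc σ ^ 5 = σ ^ 2 * σ ^ 2 * σ := by ring
      _ ≤ _ := by gcongr
  · by_contra! ⟨hAin, hBin, hout⟩
    refine absurd (sq_le_mul_sizeProd_outEdges_union hG (by positivity) hrow hAB hA hB hAin.le
      hBin.le) (not_le.2 ?_)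
    calc σ * G.sizeProd (O.outEdges (A ∪ B)) < σ * σ ^ 3 := by gcongr
      _ = (σ ^ 2) ^ 2 := by ring

theorem card_sources_le (hG : ∀ e, 0 < G.size e) {σ : ℝ} (hσ : 0 < σ)
    (hrow : ∀ v ∈ O.active, σ ^ 2 ≤ G.sizeProd (O.rowEdges v)) {S : Finset V} (hS : S ⊆ O.active)
    (hdst : ∀ e ∈ O.edges, ∀ v ∈ O.dst e, v ∉ S) {T : ContractionTree V} (hT : T.leaves.Nodup) :
    (T.verts ∩ S).card + (if σ ≤ (G.sizeProd (O.inEdges T.verts) : ℝ) then 1 else 0) ≤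
      4 * O.heavyCount T (σ ^ 5) +
        (if σ ^ 3 ≤ (G.sizeProd (O.outEdges T.verts) : ℝ) then 1 else 0) + 1 := by
  have hinact : ∀ A B : Finset V, ¬ (B ∩ O.active).Nonempty →
      (A ∪ B) ∩ O.active = A ∩ O.active ∧ (B ∩ S).card = 0 := by
    intro A B hB
    rw [Finset.not_nonempty_iff_eq_empty] at hB
    refine ⟨by rw [Finset.union_inter_distrib_right, hB, Finset.union_empty], ?_⟩
    exact Finset.card_eq_zero.2
      (Finset.subset_empty.1 (hB ▸ Finset.inter_subset_inter_left hS))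
  induction T with
  | leaf v =>
    have hleaf := card_sources_leaf_le hG hσ hrow hS hdst v
    rw [ContractionTree.verts_leaf]
    omega
  | node l r ihl ihr =>
    have hd := ContractionTree.disjoint_verts hT
    have ihl := ihl (ContractionTree.nodup_left hT)
    have ihr := ihr (ContractionTree.nodup_right hT)
    rw [heavyCount_node, ContractionTree.verts_node, Finset.union_inter_distrib_right,
      Finset.card_union_of_disjoint (hd.mono Finset.inter_subset_left Finset.inter_subset_left)]
    by_cases hr : (r.verts ∩ O.active).Nonempty
    · by_cases hl : (l.verts ∩ O.active).Nonempty
      · by_cases hc : σ ^ 5 ≤ (G.sizeProd (O.carried l.verts r.verts) : ℝ)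
        · rw [if_pos hc]
          split_ifs at ihl ihr ⊢ <;> omega
        · obtain ⟨hlout, hrout, hin, hor⟩ := cheap_contraction hG hσ hrow hd hl hr hc
          rw [if_neg hlout] at ihl
          rw [if_neg hrout] at ihr
          rw [if_neg hc, if_neg hin]
          rcases hor with h | h | h
          · rw [if_pos h] at ihl; omega
          · rw [if_pos h] at ihr; omega
          · rw [if_pos h]; omega
      · obtain ⟨he, hz⟩ := hinact r.verts l.verts hl
        rw [Finset.union_comm, hz, inEdges_congr he, outEdges_congr he]
        omega
    · obtain ⟨he, hz⟩ := hinact l.verts r.verts hr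
      rw [hz, inEdges_congr he, outEdges_congr he]
      omega

end Orientation

end TensorNetwork

namespace ContractionTree

variable {V : Type*} [DecidableEq V]

theorem exists_first_contraction {T : ContractionTree V} {x : V} {B : Finset V}
    (hx : x ∈ T.verts) (hxB : x ∉ B) (hB : (T.verts ∩ B).Nonempty) :
    ∃ p ∈ T.contractions, (x ∈ p.1 ∧ Disjoint p.1 B ∧ (p.2 ∩ B).Nonempty) ∨
      (x ∈ p.2 ∧ Disjoint p.2 B ∧ (p.1 ∩ B).Nonempty) := by
  induction T with
  | leaf v =>
    obtain ⟨y, hy⟩ := hB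
    simp only [verts_leaf, Finset.mem_inter, Finset.mem_singleton] at hx hy
    exact absurd (hx ▸ hy.1 ▸ hy.2) hxB
  | node l r ihl ihr =>
    simp only [mem_contractions_node]
    rw [verts_node] at hx hB
    rw [Finset.union_inter_distrib_right, Finset.union_nonempty] at hB
    rcases Finset.mem_union.1 hx with hx | hx
    · by_cases hl : (l.verts ∩ B).Nonempty
      · obtain ⟨p, hp, h⟩ := ihl hx hl
        exact ⟨p, .inr (.inl hp), h⟩
      · refine ⟨_, .inl rfl, .inl ⟨hx, ?_, hB.resolve_left hl⟩⟩
        rwa [Finset.disjoint_iff_inter_eq_empty, ← Finset.not_nonempty_iff_eq_empty]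
    · by_cases hr : (r.verts ∩ B).Nonempty
      · obtain ⟨p, hp, h⟩ := ihr hx hr
        exact ⟨p, .inr (.inr hp), h⟩
      · refine ⟨_, .inl rfl, .inr ⟨hx, ?_, hB.resolve_right hr⟩⟩
        rwa [Finset.disjoint_iff_inter_eq_empty, ← Finset.not_nonempty_iff_eq_empty]

end ContractionTree

/-! ### Directing data and embedding -/

open TensorNetwork DataNetwork

section Directing

variable {VD ED VE FE : Type*}

/-- The dimensions to be sketched and the edges of the embedding. -/
def embEdges [DecidableEq FE] (D : DataNetwork VD ED) (S : Embedding ED VE FE) : Finset (ED ⊕ FE) :=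
  D.sketch.disjSum (S.verts.biUnion fun x => (S.inc x).toRight)

/-- The data tensors with a dimension to be sketched, as tensors of the total network. -/
def dataSources [DecidableEq ED] (D : DataNetwork VD ED) (VE : Type*) : Finset (VD ⊕ VE) :=
  (D.verts.filter fun v => (D.sketch ∩ D.inc v).Nonempty).map Function.Embedding.inl

/-- The tensors of the embedding, as tensors of the total network. -/
def embVerts (S : Embedding ED VE FE) (VD : Type*) : Finset (VD ⊕ VE) :=
  S.verts.map Function.Embedding.inr

/-- Data tensors come first, followed by the tensors of the embedding in the order `ord`. -/
def totalRank (VD : Type*) (ord : VE → ℕ) : VD ⊕ VE → ℕ :=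
  Sum.elim (fun _ => 0) (fun x => ord x + 1)

variable {D : DataNetwork VD ED} {S : Embedding ED VE FE} {ord : VE → ℕ}

theorem inl_mem_embEdges [DecidableEq FE] {e : ED} : Sum.inl e ∈ embEdges D S ↔ e ∈ D.sketch :=
  Finset.inl_mem_disjSum

theorem inr_mem_embEdges [DecidableEq FE] {f : FE} :
    Sum.inr f ∈ embEdges D S ↔ ∃ x ∈ S.verts, Sum.inr f ∈ S.inc x := by
  simp [embEdges]

theorem inl_mem_dataSources [DecidableEq ED] {v : VD} :
    Sum.inl v ∈ dataSources D VE ↔ v ∈ D.verts ∧ ∃ e ∈ D.sketch, e ∈ D.inc v := by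
  simp [dataSources, Finset.Nonempty]

theorem inr_mem_embVerts {x : VE} : Sum.inr x ∈ embVerts S VD ↔ x ∈ S.verts := by
  simp [embVerts]

theorem disjoint_dataSources_embVerts [DecidableEq ED] :
    Disjoint (dataSources D VE) (embVerts S VD) := by
  rw [Finset.disjoint_left]
  rintro (v | x) <;> simp [dataSources, embVerts]

theorem dataSources_union_embVerts_subset [DecidableEq VD] [DecidableEq ED] [DecidableEq VE] :
    dataSources D VE ∪ embVerts S VD ⊆ (Embedding.total D S).verts := by
  rintro (v | x) h <;> simp_all [dataSources, embVerts, Embedding.total]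

variable [DecidableEq ED] [DecidableEq FE]

theorem total_size_pos (hD : D.IsValid) (hS : S.IsGraphEmbedding D) (f : ED ⊕ FE) :
    0 < (Embedding.total D S).size f := by
  cases f with
  | inl e => exact hD.size_pos e
  | inr f => exact hS.size_pos f

theorem DataNetwork.IsValid.existsUnique_vert (hD : D.IsValid) {e : ED} (he : e ∈ D.sketch) :
    ∃ v ∈ D.verts, e ∈ D.inc v ∧ ∀ v' ∈ D.verts, e ∈ D.inc v' → v' = v := by
  obtain ⟨v, hv⟩ := Finset.card_eq_one.1 (hD.sketch_degree e he)
  have hmem : ∀ v', (v' ∈ D.verts ∧ e ∈ D.inc v') ↔ v' = v := by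
    simpa [Finset.ext_iff] using hv
  exact ⟨v, ((hmem v).2 rfl).1, ((hmem v).2 rfl).2, fun v' h h' => (hmem v').1 ⟨h, h'⟩⟩

theorem Embedding.existsUnique_vert {f : ED ⊕ FE} (hf : S.degree f = 1) :
    ∃ x ∈ S.verts, f ∈ S.inc x ∧ ∀ x' ∈ S.verts, f ∈ S.inc x' → x' = x := by
  obtain ⟨x, hx⟩ := Finset.card_eq_one.1 hf
  have hmem : ∀ x', (x' ∈ S.verts ∧ f ∈ S.inc x') ↔ x' = x := by
    simpa [Finset.ext_iff] using hx
  exact ⟨x, ((hmem x).2 rfl).1, ((hmem x).2 rfl).2, fun x' h h' => (hmem x').1 ⟨h, h'⟩⟩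

theorem Embedding.IsGraphEmbedding.verts_nonempty (hS : S.IsGraphEmbedding D) (hD : D.IsValid) :
    S.verts.Nonempty := by
  obtain ⟨e, he⟩ := hD.sketch_nonempty
  obtain ⟨x, hx, -⟩ := Embedding.existsUnique_vert (hS.data_degree e he)
  exact ⟨x, hx⟩

variable [DecidableEq VD] [DecidableEq VE]

/-- The edge `f` may be directed from `s` to `d` (`none` for the output edge): from the data to the
embedding, or along the linearization `ord` of the embedding. -/
structure IsArrow (D : DataNetwork VD ED) (S : Embedding ED VE FE) (ord : VE → ℕ) (f : ED ⊕ FE)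
    (s : VD ⊕ VE) (d : Option (VD ⊕ VE)) : Prop where
  src_mem : s ∈ dataSources D VE ∪ embVerts S VD
  src_inc : f ∈ (Embedding.total D S).inc s
  dangling : d = none → f ∈ (Embedding.total D S).dangling
  dst_mem : ∀ y ∈ d, y ∈ embVerts S VD
  dst_inc : ∀ y ∈ d, f ∈ (Embedding.total D S).inc y
  rank_lt : ∀ y ∈ d, totalRank VD ord s < totalRank VD ord y
  src_data : ∀ e, f = Sum.inl e → ∀ v ∈ D.verts, e ∈ D.inc v → s = Sum.inl v
  src_emb : ∀ f', f = Sum.inr f' → ∀ x ∈ S.verts, Sum.inr f' ∈ S.inc x →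
    (f' ∈ S.outs ∨ ∃ y ∈ S.verts, ord x < ord y ∧ Sum.inr f' ∈ S.inc y) → s = Sum.inr x

theorem exists_isArrow_inl (hD : D.IsValid) (hS : S.IsGraphEmbedding D) (ord : VE → ℕ) {e : ED}
    (he : e ∈ D.sketch) : ∃ s d, IsArrow D S ord (Sum.inl e) s d := by
  obtain ⟨v, hv, hev, huniq⟩ := hD.existsUnique_vert he
  obtain ⟨x, hx, hex, -⟩ := Embedding.existsUnique_vert (hS.data_degree e he)
  exact ⟨Sum.inl v, some (Sum.inr x), {
    src_mem := Finset.mem_union_left _ (inl_mem_dataSources.2 ⟨hv, e, he, hev⟩)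
    src_inc := by simpa [Embedding.total] using hev
    dangling := by simp
    dst_mem := by simpa [inr_mem_embVerts] using hx
    dst_inc := by simpa [Embedding.total] using hex
    rank_lt := by simp [totalRank]
    src_data := by rintro e' ⟨⟩ v' hv' hev'; rw [huniq v' hv' hev']
    src_emb := by simp }⟩

theorem exists_isArrow_of_mem_outs (hS : S.IsGraphEmbedding D) (ord : VE → ℕ) {f : FE}
    (hf : f ∈ S.outs) : ∃ s d, IsArrow D S ord (Sum.inr f) s d := by
  obtain ⟨x, hx, hfx, huniq⟩ := Embedding.existsUnique_vert (hS.out_degree f hf)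
  exact ⟨Sum.inr x, none, {
    src_mem := Finset.mem_union_right _ (inr_mem_embVerts.2 hx)
    src_inc := hfx
    dangling := by simp [Embedding.total, hf]
    dst_mem := by simp
    dst_inc := by simp
    rank_lt := by simp
    src_data := by simp
    src_emb := by rintro f' ⟨⟩ x' hx' hfx' -; rw [huniq x' hx' hfx'] }⟩

theorem exists_isArrow_of_notMem_outs (hS : S.IsGraphEmbedding D) (hord : Set.InjOn ord S.verts)
    {f : FE} (hf : f ∉ S.outs) {x : VE} (hx : x ∈ S.verts) (hfx : Sum.inr f ∈ S.inc x) :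
    ∃ s d, IsArrow D S ord (Sum.inr f) s d := by
  obtain ⟨a, b, hab, hends⟩ := Finset.card_eq_two.1 (hS.inner_degree x hx f hf hfx)
  have hmem : ∀ z, (z ∈ S.verts ∧ Sum.inr f ∈ S.inc z) ↔ z = a ∨ z = b := by
    simpa [Finset.ext_iff] using hends
  clear hends
  wlog hlt : ord a < ord b generalizing a b
  · have hne : ord a ≠ ord b := fun h =>
      hab (hord ((hmem a).2 (.inl rfl)).1 ((hmem b).2 (.inr rfl)).1 h)
    exact this b a hab.symm (fun z => (hmem z).trans or_comm) (by omega)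
  obtain ⟨ha, hfa⟩ := (hmem a).2 (.inl rfl)
  obtain ⟨hb, hfb⟩ := (hmem b).2 (.inr rfl)
  have hsrc : ∀ z ∈ S.verts, Sum.inr f ∈ S.inc z →
      (∃ y ∈ S.verts, ord z < ord y ∧ Sum.inr f ∈ S.inc y) → a = z := by
    rintro z hz hfz ⟨y, hy, hzy, hfy⟩
    rcases (hmem z).1 ⟨hz, hfz⟩ with rfl | rfl
    · rfl
    · rcases (hmem y).1 ⟨hy, hfy⟩ with rfl | rfl <;> omega
  exact ⟨Sum.inr a, some (Sum.inr b), {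
    src_mem := Finset.mem_union_right _ (inr_mem_embVerts.2 ha)
    src_inc := hfa
    dangling := by simp
    dst_mem := by simpa [inr_mem_embVerts] using hb
    dst_inc := by simpa [Embedding.total] using hfb
    rank_lt := by simpa [totalRank] using hlt
    src_data := by simp
    src_emb := by
      rintro f' ⟨⟩ z hz hfz hor
      rw [hsrc z hz hfz (hor.resolve_left hf)] }⟩

theorem exists_isArrow (hD : D.IsValid) (hS : S.IsGraphEmbedding D)
    (hord : Set.InjOn ord S.verts) {f : ED ⊕ FE} (hf : f ∈ embEdges D S) :
    ∃ s d, IsArrow D S ord f s d := by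
  rcases f with e | f
  · exact exists_isArrow_inl hD hS ord (inl_mem_embEdges.1 hf)
  · by_cases hout : f ∈ S.outs
    · exact exists_isArrow_of_mem_outs hS ord hout
    · obtain ⟨x, hx, hfx⟩ := inr_mem_embEdges.1 hf
      exact exists_isArrow_of_notMem_outs hS hord hout hx hfx

/-- The dimensions to be sketched and the edges of the embedding, directed so that the directed
edges leaving a tensor of the embedding contain those counted by its row size. -/
structure SketchOrientation (D : DataNetwork VD ED) (S : Embedding ED VE FE) (ord : VE → ℕ)
    extends (Embedding.total D S).Orientation where
  edges_eq : edges = embEdges D S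
  active_eq : active = dataSources D VE ∪ embVerts S VD
  dst_emb : ∀ f ∈ edges, ∀ y ∈ dst f, y ∈ embVerts S VD
  src_data : ∀ e ∈ D.sketch, ∀ v ∈ D.verts, e ∈ D.inc v → src (Sum.inl e) = Sum.inl v
  src_emb : ∀ x ∈ S.verts, ∀ f, Sum.inr f ∈ S.inc x →
    (f ∈ S.outs ∨ ∃ y ∈ S.verts, ord x < ord y ∧ Sum.inr f ∈ S.inc y) → src (Sum.inr f) = Sum.inr x

theorem nonempty_sketchOrientation (hD : D.IsValid) (hS : S.IsGraphEmbedding D)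
    (hord : Set.InjOn ord S.verts) : Nonempty (SketchOrientation D S ord) := by
  obtain ⟨e₀, he₀⟩ := hD.sketch_nonempty
  obtain ⟨v₀, -⟩ := hD.existsUnique_vert he₀
  have harrow : ∀ f, ∃ s d, f ∈ embEdges D S → IsArrow D S ord f s d := fun f => by
    by_cases hf : f ∈ embEdges D S
    · obtain ⟨s, d, h⟩ := exists_isArrow hD hS hord hf
      exact ⟨s, d, fun _ => h⟩
    · exact ⟨Sum.inl v₀, none, fun h => absurd h hf⟩
  choose src dst h using harrow
  exact ⟨{
    edges := embEdges D S
    active := dataSources D VE ∪ embVerts S VD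
    rank := totalRank VD ord
    src := src
    dst := dst
    active_subset := dataSources_union_embVerts_subset
    src_mem := fun f hf => (h f hf).src_mem
    dst_mem := fun f hf y hy => Finset.mem_union_right _ ((h f hf).dst_mem y hy)
    rank_lt := fun f hf => (h f hf).rank_lt
    src_inc := fun f hf => (h f hf).src_inc
    dst_inc := fun f hf => (h f hf).dst_inc
    dangling := fun f hf => (h f hf).dangling
    edges_eq := rfl
    active_eq := rfl
    dst_emb := fun f hf => (h f hf).dst_mem
    src_data := fun e he => (h _ (inl_mem_embEdges.2 he)).src_data e rfl
    src_emb := fun x hx f hfx =>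
      (h _ (inr_mem_embEdges.2 ⟨x, hx, hfx⟩)).src_emb f rfl x hx hfx }⟩

end Directing

section PlainCost

variable {VD ED VE FE : Type*} [DecidableEq VD] [DecidableEq ED] [DecidableEq VE] [DecidableEq FE]
variable {D : DataNetwork VD ED} {S : Embedding ED VE FE} {ord : VE → ℕ}

/-- The part of the cost of a contraction due to the dimensions that are not sketched. -/
def plainCost (D : DataNetwork VD ED) (A B : Finset VD) : ℕ :=
  ∏ i ∈ D.plainBoundary A ∪ D.plainBoundary B, D.size i

theorem plainCost_comm (D : DataNetwork VD ED) (A B : Finset VD) :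
    plainCost D A B = plainCost D B A := by rw [plainCost, plainCost, Finset.union_comm]

theorem map_plainBoundary_subset (A : Finset (VD ⊕ VE)) :
    (D.plainBoundary A.toLeft).map Function.Embedding.inl ⊆ (Embedding.total D S).boundary A := by
  intro f hf
  obtain ⟨e, he, rfl⟩ := Finset.mem_map.1 hf
  simp only [DataNetwork.plainBoundary, boundary, Finset.mem_sdiff, Finset.mem_filter,
    Finset.mem_biUnion, Finset.mem_toLeft] at he ⊢
  obtain ⟨⟨⟨v, hv, hev⟩, hout⟩, hsketch⟩ := he
  refine ⟨⟨Sum.inl v, hv, by simpa [Embedding.total] using hev⟩, hout.imp (fun hd => ?_) ?_⟩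
  · simp [Embedding.total, hd, hsketch]
  · rintro ⟨w, hw, hew⟩
    exact ⟨Sum.inl w, by simpa [Embedding.total] using hw, by simpa [Embedding.total] using hew⟩

theorem plainCost_mul_le_contractionCost (hsize : ∀ f, 0 < (Embedding.total D S).size f)
    {A B : Finset (VD ⊕ VE)} {X : Finset (ED ⊕ FE)} (hX : X ⊆ embEdges D S)
    (hXAB : X ⊆ (Embedding.total D S).boundary A ∪ (Embedding.total D S).boundary B) :
    plainCost D A.toLeft B.toLeft * (Embedding.total D S).sizeProd X ≤
      (Embedding.total D S).contractionCost A B := by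
  set P : Finset (ED ⊕ FE) :=
    (D.plainBoundary A.toLeft ∪ D.plainBoundary B.toLeft).map Function.Embedding.inl with hP
  have hsub : P ⊆ (Embedding.total D S).boundary A ∪ (Embedding.total D S).boundary B := by
    rw [hP, Finset.map_union]
    exact Finset.union_subset_union (map_plainBoundary_subset A) (map_plainBoundary_subset B)
  have hdisj : Disjoint P X := by
    refine Finset.disjoint_left.2 fun f hf hfX => ?_
    obtain ⟨e, he, rfl⟩ := Finset.mem_map.1 hf
    have hsketch := inl_mem_embEdges.1 (hX hfX)
    simp only [DataNetwork.plainBoundary, Finset.mem_union, Finset.mem_sdiff] at he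
    tauto
  calc plainCost D A.toLeft B.toLeft * (Embedding.total D S).sizeProd X
      = (Embedding.total D S).sizeProd (P ∪ X) := by
        rw [sizeProd_union hdisj]
        simp [hP, plainCost, sizeProd, Finset.prod_map, Embedding.total]
    _ ≤ _ := sizeProd_mono hsize (Finset.union_subset hsub hXAB)

end PlainCost

namespace SketchOrientation

variable {VD ED VE FE : Type*} [DecidableEq VD] [DecidableEq ED] [DecidableEq VE] [DecidableEq FE]
variable {D : DataNetwork VD ED} {S : Embedding ED VE FE} {ord : VE → ℕ}

theorem rowSize_le_sizeProd_rowEdges (O : SketchOrientation D S ord)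
    (hsize : ∀ f, 0 < (Embedding.total D S).size f) {x : VE} (hx : x ∈ S.verts) :
    S.rowSize ord x ≤ (Embedding.total D S).sizeProd (O.rowEdges (Sum.inr x)) := by
  set R := (S.inc x).toRight.filter fun f => f ∈ S.outs ∨
    ∃ y ∈ S.verts, ord x < ord y ∧ Sum.inr f ∈ S.inc y with hR
  have hsub : R.map Function.Embedding.inr ⊆ O.rowEdges (Sum.inr x) := by
    intro f hf
    obtain ⟨f, hfR, rfl⟩ := Finset.mem_map.1 hf
    obtain ⟨hfx, hrow⟩ := Finset.mem_filter.1 hfR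
    rw [Finset.mem_toRight] at hfx
    refine Orientation.mem_rowEdges.2 ⟨?_, O.src_emb x hx f hfx hrow⟩
    rw [O.edges_eq]
    exact inr_mem_embEdges.2 ⟨x, hx, hfx⟩
  calc S.rowSize ord x = (Embedding.total D S).sizeProd (R.map Function.Embedding.inr) := by
        simp [Embedding.rowSize, sizeProd, Finset.prod_map, Embedding.total, hR]
    _ ≤ _ := sizeProd_mono hsize hsub

theorem size_le_sizeProd_rowEdges (O : SketchOrientation D S ord)
    (hsize : ∀ f, 0 < (Embedding.total D S).size f) {v : VD} (hv : v ∈ D.verts) {e : ED}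
    (he : e ∈ D.sketch) (hev : e ∈ D.inc v) :
    D.size e ≤ (Embedding.total D S).sizeProd (O.rowEdges (Sum.inl v)) := by
  have hsub : {Sum.inl e} ⊆ O.rowEdges (Sum.inl v) := by
    rw [Finset.singleton_subset_iff, Orientation.mem_rowEdges, O.edges_eq]
    exact ⟨inl_mem_embEdges.2 he, O.src_data e he v hv hev⟩
  simpa [sizeProd, Embedding.total] using sizeProd_mono hsize hsub

theorem le_sizeProd_rowEdges (O : SketchOrientation D S ord)
    (hsize : ∀ f, 0 < (Embedding.total D S).size f) {μ : ℝ}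
    (hdata : ∀ e ∈ D.sketch, μ ≤ D.size e) (hemb : ∀ x ∈ S.verts, μ ≤ S.rowSize ord x) :
    ∀ z ∈ O.active, μ ≤ (Embedding.total D S).sizeProd (O.rowEdges z) := by
  intro z hz
  rw [O.active_eq, Finset.mem_union] at hz
  rcases z with v | x
  · have hv : Sum.inl v ∈ dataSources D VE := hz.resolve_right (by simp [embVerts])
    obtain ⟨hvD, e, he, hev⟩ := inl_mem_dataSources.1 hv
    exact (hdata e he).trans (by exact_mod_cast O.size_le_sizeProd_rowEdges hsize hvD he hev)
  · have hx : x ∈ S.verts := inr_mem_embVerts.1 (hz.resolve_left (by simp [dataSources]))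
    exact (hemb x hx).trans (by exact_mod_cast O.rowSize_le_sizeProd_rowEdges hsize hx)

theorem le_sizeProd_outEdges (O : SketchOrientation D S ord)
    (hsize : ∀ f, 0 < (Embedding.total D S).size f) {μ : ℝ}
    (hdata : ∀ e ∈ D.sketch, μ ≤ D.size e) (hemb : ∀ x ∈ S.verts, μ ≤ S.rowSize ord x)
    {A : Finset (VD ⊕ VE)} (hA : (A ∩ (dataSources D VE ∪ embVerts S VD)).Nonempty) :
    μ ≤ (Embedding.total D S).sizeProd (O.outEdges A) :=
  Orientation.le_sizeProd_outEdges hsize O.dst_mem (O.le_sizeProd_rowEdges hsize hdata hemb)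
    (O.active_eq ▸ hA)

theorem le_sizeProd_outEdges_of_embVerts (O : SketchOrientation D S ord)
    (hsize : ∀ f, 0 < (Embedding.total D S).size f) {r : ℝ}
    (hemb : ∀ x ∈ S.verts, r ≤ S.rowSize ord x)
    {A : Finset (VD ⊕ VE)} (hA : (A ∩ embVerts S VD).Nonempty) :
    r ≤ (Embedding.total D S).sizeProd (O.outEdges A) := by
  refine Orientation.le_sizeProd_outEdges hsize O.dst_emb (fun z hz => ?_) hA
  obtain ⟨x, hx, rfl⟩ := Finset.mem_map.1 hz
  exact (hemb x hx).trans (by exact_mod_cast O.rowSize_le_sizeProd_rowEdges hsize hx)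

theorem mul_le_sizeProd_carried (O : SketchOrientation D S ord)
    (hsize : ∀ f, 0 < (Embedding.total D S).size f) {μ r : ℝ} (hμ : 0 ≤ μ) (hμr : μ ≤ r)
    (hdata : ∀ e ∈ D.sketch, μ ≤ D.size e) (hemb : ∀ x ∈ S.verts, r ≤ S.rowSize ord x)
    {A B : Finset (VD ⊕ VE)} (hAB : Disjoint A B)
    (hA : (A ∩ (dataSources D VE ∪ embVerts S VD)).Nonempty) (hB : (B ∩ embVerts S VD).Nonempty) :
    μ * r ≤ (Embedding.total D S).sizeProd (O.carried A B) :=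
  (mul_le_mul (O.le_sizeProd_outEdges hsize hdata (fun x hx => hμr.trans (hemb x hx)) hA)
    (O.le_sizeProd_outEdges_of_embVerts hsize hemb hB) (hμ.trans hμr) (by positivity)).trans
      (Orientation.mul_sizeProd_outEdges_le_carried hsize hAB)

theorem card_sketch_le (O : SketchOrientation D S ord) (hD : D.IsValid) :
    D.sketch.card ≤ (dataSources D VE).card := by
  refine Finset.card_le_card_of_injOn (fun e => O.src (Sum.inl e)) (fun e he => ?_) ?_
  · obtain ⟨v, hv, hev, -⟩ := hD.existsUnique_vert he
    change O.src (Sum.inl e) ∈ dataSources D VE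
    rw [O.src_data e he v hv hev]
    exact inl_mem_dataSources.2 ⟨hv, e, he, hev⟩
  · intro e he e' he' hsrc
    obtain ⟨v, hv, hev, -⟩ := hD.existsUnique_vert he
    obtain ⟨v', hv', hev', -⟩ := hD.existsUnique_vert he'
    simp only [O.src_data e he v hv hev, O.src_data e' he' v' hv' hev'] at hsrc
    obtain rfl := Sum.inl_injective hsrc
    exact Finset.card_le_one.1 (hD.sketch_unique v hv) e (Finset.mem_inter.2 ⟨he, hev⟩) e'
      (Finset.mem_inter.2 ⟨he', hev'⟩)

theorem sizeProd_outEdges_verts_le (O : SketchOrientation D S ord)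
    (hsize : ∀ f, 0 < (Embedding.total D S).size f) :
    (Embedding.total D S).sizeProd (O.outEdges (Embedding.total D S).verts) ≤ S.sketchSize := by
  have hsub : O.outEdges (Embedding.total D S).verts ⊆ S.outs.map Function.Embedding.inr := by
    intro f hf
    obtain ⟨hf, -, hdst⟩ := Orientation.mem_outEdges.1 hf
    have hnone : O.dst f = none := Option.eq_none_iff_forall_not_mem.2 fun y hy =>
      hdst y hy (O.active_subset (O.dst_mem f hf y hy))
    have hdang := O.dangling f hf hnone
    rw [O.edges_eq] at hf
    rcases f with e | f
    · simp [Embedding.total, inl_mem_embEdges.1 hf] at hdang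
    · simpa [Embedding.total] using hdang
  calc (Embedding.total D S).sizeProd (O.outEdges (Embedding.total D S).verts)
      ≤ (Embedding.total D S).sizeProd (S.outs.map Function.Embedding.inr) :=
        sizeProd_mono hsize hsub
    _ = S.sketchSize := by
        simp [sizeProd, Embedding.sketchSize, Finset.prod_map, Embedding.total]

theorem one_le_heavyCount (O : SketchOrientation D S ord)
    (hsize : ∀ f, 0 < (Embedding.total D S).size f) {μ r : ℝ} (hμ : 0 ≤ μ) (hμr : μ ≤ r)
    (hdata : ∀ e ∈ D.sketch, μ ≤ D.size e) (hemb : ∀ x ∈ S.verts, r ≤ S.rowSize ord x)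
    (hsource : (dataSources D VE).Nonempty) (hS : S.verts.Nonempty)
    {T : ContractionTree (VD ⊕ VE)} (hT : T.IsTreeOn (Embedding.total D S).verts) :
    1 ≤ O.heavyCount T (μ * r) := by
  have hverts := dataSources_union_embVerts_subset (D := D) (S := S)
  obtain ⟨x, hx⟩ := hsource
  have hxT : x ∈ T.verts := hT.2 ▸ hverts (Finset.mem_union_left _ hx)
  have hB : (T.verts ∩ embVerts S VD).Nonempty := by
    obtain ⟨y, hy⟩ := hS
    have hyB : Sum.inr y ∈ embVerts S VD := inr_mem_embVerts.2 hy
    exact ⟨_, Finset.mem_inter.2 ⟨hT.2 ▸ hverts (Finset.mem_union_right _ hyB), hyB⟩⟩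
  obtain ⟨p, hp, hfirst⟩ := ContractionTree.exists_first_contraction hxT
    (Finset.disjoint_left.1 disjoint_dataSources_embVerts hx) hB
  have hd := ContractionTree.disjoint_of_mem_contractions hT.1 hp
  have hxs : ∀ A : Finset (VD ⊕ VE), x ∈ A → (A ∩ (dataSources D VE ∪ embVerts S VD)).Nonempty :=
    fun A hxA => ⟨x, Finset.mem_inter.2 ⟨hxA, Finset.mem_union_left _ hx⟩⟩
  refine List.countP_pos_iff.2 ⟨p, hp, decide_eq_true ?_⟩
  rcases hfirst with ⟨hx1, -, h2⟩ | ⟨hx2, -, h1⟩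
  · exact O.mul_le_sizeProd_carried hsize hμ hμr hdata hemb hd (hxs _ hx1) h2
  · rw [O.carried_comm]
    exact O.mul_le_sizeProd_carried hsize hμ hμr hdata hemb hd.symm (hxs _ hx2) h1

theorem card_sketch_le_heavyCount (O : SketchOrientation D S ord) (hD : D.IsValid)
    (hsize : ∀ f, 0 < (Embedding.total D S).size f) (hS : S.verts.Nonempty) {σ r K : ℝ}
    (hσ : 0 < σ) (hK : 1 ≤ K) (hdata : ∀ e ∈ D.sketch, σ ^ 2 ≤ D.size e)
    (hemb : ∀ x ∈ S.verts, r ≤ S.rowSize ord x) (hσr : σ ^ 2 ≤ r)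
    (hout : (S.sketchSize : ℝ) ≤ K * r) {T : ContractionTree (VD ⊕ VE)}
    (hT : T.IsTreeOn (Embedding.total D S).verts) :
    D.sketch.card - 1 ≤ 5 * O.heavyCount T (σ ^ 5 / K) := by
  have hN := O.card_sketch_le hD
  have hinter : T.verts ∩ dataSources D VE = dataSources D VE := by
    rw [hT.2, Finset.inter_eq_right]
    exact Finset.subset_union_left.trans dataSources_union_embVerts_subset
  have hcount := Orientation.card_sources_le hsize hσ
    (O.le_sizeProd_rowEdges hsize hdata fun x hx => hσr.trans (hemb x hx))
    (O.active_eq ▸ Finset.subset_union_left)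
    (fun f hf y hy => Finset.disjoint_right.1 disjoint_dataSources_embVerts (O.dst_emb f hf y hy))
    hT.1
  rw [hinter] at hcount
  have hanti : O.heavyCount T (σ ^ 5) ≤ O.heavyCount T (σ ^ 5 / K) :=
    Orientation.heavyCount_anti T (div_le_self (by positivity) hK)
  by_cases h3 : σ ^ 3 ≤ ((Embedding.total D S).sizeProd (O.outEdges T.verts) : ℝ)
  · have hσK : σ ^ 3 ≤ K * r := by
      rw [hT.2] at h3
      exact (h3.trans (by exact_mod_cast O.sizeProd_outEdges_verts_le hsize)).trans hout
    have hle : σ ^ 5 / K ≤ σ ^ 2 * r := by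
      rw [div_le_iff₀ (by linarith)]
      calc σ ^ 5 = σ ^ 2 * σ ^ 3 := by ring
        _ ≤ σ ^ 2 * (K * r) := by gcongr
        _ = σ ^ 2 * r * K := by ring
    have hsource : (dataSources D VE).Nonempty :=
      Finset.card_pos.1 ((Finset.card_pos.2 hD.sketch_nonempty).trans_le hN)
    have hone : 1 ≤ O.heavyCount T (σ ^ 5 / K) :=
      (O.one_le_heavyCount hsize (by positivity) hσr hdata hemb hsource hS hT).trans
        (Orientation.heavyCount_anti T hle)
    split_ifs at hcount <;> omega
  · split_ifs at hcount <;> omega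

theorem card_sketch_mul_le_treeCost (O : SketchOrientation D S ord) (hD : D.IsValid)
    (hsize : ∀ f, 0 < (Embedding.total D S).size f) (hS : S.verts.Nonempty) {σ r K : ℝ}
    (hσ : 0 < σ) (hK : 1 ≤ K) (hdata : ∀ e ∈ D.sketch, σ ^ 2 ≤ D.size e)
    (hemb : ∀ x ∈ S.verts, r ≤ S.rowSize ord x) (hσr : σ ^ 2 ≤ r)
    (hout : (S.sketchSize : ℝ) ≤ K * r) {T : ContractionTree (VD ⊕ VE)}
    (hT : T.IsTreeOn (Embedding.total D S).verts) :
    ((D.sketch.card - 1 : ℕ) : ℝ) * (σ ^ 5 / K) ≤ 5 * (Embedding.total D S).treeCost T :=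
  calc ((D.sketch.card - 1 : ℕ) : ℝ) * (σ ^ 5 / K)
      ≤ (5 * O.heavyCount T (σ ^ 5 / K) : ℕ) * (σ ^ 5 / K) := by
        gcongr
        exact O.card_sketch_le_heavyCount hD hsize hS hσ hK hdata hemb hσr hout hT
    _ = 5 * (O.heavyCount T (σ ^ 5 / K) * (σ ^ 5 / K)) := by push_cast; ring
    _ ≤ _ := by
        gcongr
        exact Orientation.heavyCount_mul_le_treeCost hsize T _

end SketchOrientation

/-! ### Lower bounds on constrained trees -/

/-- The contractions `q` of data and embedding and `p` of the data agree on the data tensors, as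
unordered pairs. -/
def Matches {V W : Type*} [DecidableEq V] (q : Finset (V ⊕ W) × Finset (V ⊕ W))
    (p : Finset V × Finset V) : Prop :=
  (q.1.toLeft = p.1 ∧ q.2.toLeft = p.2) ∨ (q.1.toLeft = p.2 ∧ q.2.toLeft = p.1)

theorem Matches.union_eq {V W : Type*} [DecidableEq V]
    {q : Finset (V ⊕ W) × Finset (V ⊕ W)} {p : Finset V × Finset V} (h : Matches q p) :
    q.1.toLeft ∪ q.2.toLeft = p.1 ∪ p.2 := by
  rcases h with ⟨h1, h2⟩ | ⟨h1, h2⟩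
  · rw [h1, h2]
  · rw [h1, h2, Finset.union_comm]

theorem sum_comp_le_of_matches {V W : Type*} [DecidableEq V] [DecidableEq W]
    {T : ContractionTree (V ⊕ W)} {T₀ : ContractionTree V} (hT₀ : T₀.leaves.Nodup)
    {φ : Finset V × Finset V → Finset (V ⊕ W) × Finset (V ⊕ W)}
    (hφ : ∀ p ∈ T₀.contractions, φ p ∈ T.contractions ∧ Matches (φ p) p)
    (c : Finset (V ⊕ W) × Finset (V ⊕ W) → ℕ) :
    ∑ p ∈ T₀.contractions.toFinset, c (φ p) ≤ ∑ q ∈ T.contractions.toFinset, c q := by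
  rw [← Finset.sum_image (f := c) (g := φ)]
  · refine Finset.sum_le_sum_of_subset fun q hq => ?_
    obtain ⟨p, hp, rfl⟩ := Finset.mem_image.1 hq
    exact List.mem_toFinset.2 (hφ p (List.mem_toFinset.1 hp)).1
  · intro p hp p' hp' he
    have hp := List.mem_toFinset.1 hp
    have hp' := List.mem_toFinset.1 hp'
    refine ContractionTree.contraction_ext hT₀ hp hp' ?_
    rw [← (hφ p hp).2.union_eq, he, (hφ p' hp').2.union_eq]

theorem sum_sum_filter_eq_singleton {ι γ : Type*} [DecidableEq ι] {s : Finset ι} {C : Finset γ}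
    {g : γ → Finset ι} (hg : ∀ q ∈ C, g q ⊆ s) (c : γ → ℕ) :
    ∑ e ∈ s, ∑ q ∈ C with g q = {e}, c q = ∑ q ∈ C with (g q).card = 1, c q := by
  simp only [Finset.sum_filter]
  rw [Finset.sum_comm]
  refine Finset.sum_congr rfl fun q hq => ?_
  split_ifs with hcard
  · obtain ⟨a, ha⟩ := Finset.card_eq_one.1 hcard
    have has : a ∈ s := Finset.singleton_subset_iff.1 (ha ▸ hg q hq)
    simp [ha, has]
  · exact Finset.sum_eq_zero fun e _ => if_neg fun he : g q = {e} => hcard (by simp [he])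

theorem sum_sum_filter_eq_singleton_le {ι γ : Type*} [DecidableEq ι] {s : Finset ι} {C : Finset γ}
    {g : γ → Finset ι} (hg : ∀ q ∈ C, g q ⊆ s) (c : γ → ℕ) :
    ∑ e ∈ s, ∑ q ∈ C with g q = {e}, c q ≤ ∑ q ∈ C, c q :=
  (sum_sum_filter_eq_singleton hg c).trans_le
    (Finset.sum_le_sum_of_subset (Finset.filter_subset _ _))

namespace DataNetwork

variable {VD ED : Type*} [DecidableEq ED] {D : DataNetwork VD ED}

theorem mem_sketchOf {A : Finset VD} {e : ED} :
    e ∈ D.sketchOf A ↔ (∃ v ∈ A, e ∈ D.inc v) ∧ e ∈ D.sketch := by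
  simp [sketchOf]

theorem sketchOf_union [DecidableEq VD] (A B : Finset VD) :
    D.sketchOf (A ∪ B) = D.sketchOf A ∪ D.sketchOf B := by
  rw [sketchOf, Finset.union_biUnion, Finset.union_inter_distrib_right, sketchOf, sketchOf]

theorem sketchOf_subset_sketch (A : Finset VD) : D.sketchOf A ⊆ D.sketch :=
  Finset.inter_subset_right

theorem sketchOf_mono {A B : Finset VD} (h : A ⊆ B) : D.sketchOf A ⊆ D.sketchOf B :=
  Finset.inter_subset_inter_right (Finset.biUnion_subset_biUnion_of_subset_left _ h)

theorem IsValid.disjoint_sketchOf (hD : D.IsValid) {A B : Finset VD} (hA : A ⊆ D.verts)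
    (hB : B ⊆ D.verts) (hAB : Disjoint A B) : Disjoint (D.sketchOf A) (D.sketchOf B) := by
  rw [Finset.disjoint_left]
  intro e he he'
  obtain ⟨⟨v, hv, hev⟩, hs⟩ := mem_sketchOf.1 he
  obtain ⟨⟨v', hv', hev'⟩, -⟩ := mem_sketchOf.1 he'
  obtain ⟨w, -, -, hw⟩ := hD.existsUnique_vert hs
  obtain rfl := hw v (hA hv) hev
  obtain rfl := hw v' (hB hv') hev'
  exact Finset.disjoint_left.1 hAB hv hv'

theorem IsValid.eq_of_mem_inc (hD : D.IsValid) {v : VD} (hv : v ∈ D.verts) {e e' : ED}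
    (he : e ∈ D.sketch) (hev : e ∈ D.inc v) (he' : e' ∈ D.sketch) (hev' : e' ∈ D.inc v) : e = e' :=
  Finset.card_le_one.1 (hD.sketch_unique v hv) e (Finset.mem_inter.2 ⟨he, hev⟩) e'
    (Finset.mem_inter.2 ⟨he', hev'⟩)

theorem IsValid.countP_bothSketched_le [DecidableEq VD] (hD : D.IsValid) {t : ContractionTree VD}
    (ht : t.leaves.Nodup) (hv : t.verts ⊆ D.verts) :
    t.contractions.countP (fun p => BothSketched D p.1 p.2) ≤ (D.sketchOf t.verts).card - 1 := by
  induction t with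
  | leaf v => simp [ContractionTree.contractions]
  | node l r ihl ihr =>
    rw [ContractionTree.verts_node] at hv ⊢
    have hl := Finset.union_subset_left hv
    have hr := Finset.union_subset_right hv
    have ihl := ihl (ContractionTree.nodup_left ht) hl
    have ihr := ihr (ContractionTree.nodup_right ht) hr
    rw [sketchOf_union, Finset.card_union_of_disjoint
      (hD.disjoint_sketchOf hl hr (ContractionTree.disjoint_verts ht)),
      ContractionTree.contractions, List.countP_cons, List.countP_append]
    by_cases hb : BothSketched D l.verts r.verts
    · have h1 := Finset.card_pos.2 hb.1
      have h2 := Finset.card_pos.2 hb.2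
      simp only [hb, decide_true, if_true]
      omega
    · have hb' : (D.sketchOf l.verts).card = 0 ∨ (D.sketchOf r.verts).card = 0 := by
        rwa [BothSketched, not_and_or, Finset.not_nonempty_iff_eq_empty,
          Finset.not_nonempty_iff_eq_empty, ← Finset.card_eq_zero, ← Finset.card_eq_zero] at hb
      simp only [hb, decide_false, Bool.false_eq_true, if_false]
      omega

end DataNetwork

section ConstrainedTrees

variable {VD ED VE FE : Type*} [DecidableEq VD] [DecidableEq ED]
variable {D : DataNetwork VD ED} {S : Embedding ED VE FE} {ord : VE → ℕ}

theorem placeCost_eq {T₀ : ContractionTree VD} (hT₀ : T₀.leaves.Nodup) (m : ℕ) (e : ED)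
    (W : Finset VD) :
    placeCost D T₀ m e W =
      ∑ p ∈ T₀.contractions.toFinset with D.sketchOf (p.1 ∪ p.2) = {e},
        plainCost D p.1 p.2 * (if p.1 ∪ p.2 ⊆ W then D.size e else m) +
      (∏ i ∈ D.plainBoundary W, D.size i) * D.size e * m := by
  rw [placeCost, ← List.sum_toFinset _ ((ContractionTree.nodup_contractions hT₀).filter _),
    List.toFinset_filter]
  congr 2
  simp

theorem Matches.plainCost_eq {q : Finset (VD ⊕ VE) × Finset (VD ⊕ VE)} {p : Finset VD × Finset VD}
    (h : Matches q p) : plainCost D q.1.toLeft q.2.toLeft = plainCost D p.1 p.2 := by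
  rcases h with ⟨h1, h2⟩ | ⟨h1, h2⟩
  · rw [h1, h2]
  · rw [h1, h2, plainCost_comm]

theorem Matches.bothSketched {q : Finset (VD ⊕ VE) × Finset (VD ⊕ VE)}
    {p : Finset VD × Finset VD} (h : Matches q p) (hp : BothSketched D p.1 p.2) :
    BothSketched D q.1.toLeft q.2.toLeft := by
  rcases h with ⟨h1, h2⟩ | ⟨h1, h2⟩
  · rwa [h1, h2]
  · rw [h1, h2]
    exact hp.symm

variable [DecidableEq VE]

theorem inter_nonempty_of_sketchOf {A : Finset (VD ⊕ VE)} (hA : A.toLeft ⊆ D.verts)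
    (h : (D.sketchOf A.toLeft).Nonempty) :
    (A ∩ (dataSources D VE ∪ embVerts S VD)).Nonempty := by
  obtain ⟨e, he⟩ := h
  obtain ⟨⟨v, hv, hev⟩, hs⟩ := mem_sketchOf.1 he
  exact ⟨Sum.inl v, Finset.mem_inter.2 ⟨Finset.mem_toLeft.1 hv,
    Finset.mem_union_left _ (inl_mem_dataSources.2 ⟨hA hv, e, hs, hev⟩)⟩⟩

theorem toLeft_subset_of_mem_tensors {T : ContractionTree (VD ⊕ VE)}
    (hT : T.IsTreeOn (Embedding.total D S).verts) {A : Finset (VD ⊕ VE)} (hA : A ∈ T.tensors) :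
    A.toLeft ⊆ D.verts := by
  intro v hv
  have hvT := ContractionTree.subset_verts_of_mem_tensors hA (Finset.mem_toLeft.1 hv)
  rw [hT.2] at hvT
  simpa [Embedding.total] using hvT

variable [DecidableEq FE]

theorem Matches.plainCost_le (hsize : ∀ f, 0 < (Embedding.total D S).size f)
    {p : Finset VD × Finset VD} {q : Finset (VD ⊕ VE) × Finset (VD ⊕ VE)} (hqp : Matches q p) :
    plainCost D p.1 p.2 ≤ (Embedding.total D S).contractionCost q.1 q.2 := by
  rw [← hqp.plainCost_eq]
  simpa [sizeProd] using plainCost_mul_le_contractionCost hsize (A := q.1) (B := q.2)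
    (Finset.empty_subset _) (Finset.empty_subset _)

theorem SketchOrientation.plainCost_mul_le (O : SketchOrientation D S ord)
    (hsize : ∀ f, 0 < (Embedding.total D S).size f) {μ : ℝ}
    {A B : Finset (VD ⊕ VE)} {X : Finset (ED ⊕ FE)} (hX : X ⊆ O.outEdges A ∪ O.outEdges B)
    (hμ : μ ≤ (Embedding.total D S).sizeProd X) :
    plainCost D A.toLeft B.toLeft * μ ≤ (Embedding.total D S).contractionCost A B := by
  have hemb : X ⊆ embEdges D S := O.edges_eq ▸
    hX.trans (Finset.union_subset (Finset.filter_subset _ _) (Finset.filter_subset _ _))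
  have hbd := hX.trans
    (Finset.union_subset_union (O.outEdges_subset_boundary A) (O.outEdges_subset_boundary B))
  calc (plainCost D A.toLeft B.toLeft : ℝ) * μ
      ≤ plainCost D A.toLeft B.toLeft * (Embedding.total D S).sizeProd X := by gcongr
    _ ≤ _ := by exact_mod_cast plainCost_mul_le_contractionCost hsize hemb hbd

theorem Matches.plainCost_mul_le (O : SketchOrientation D S ord)
    (hsize : ∀ f, 0 < (Embedding.total D S).size f) {μ : ℝ}
    (hdata : ∀ e ∈ D.sketch, μ ≤ D.size e) (hemb : ∀ x ∈ S.verts, μ ≤ S.rowSize ord x)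
    {T : ContractionTree (VD ⊕ VE)} (hT : T.IsTreeOn (Embedding.total D S).verts)
    {p : Finset VD × Finset VD} {q : Finset (VD ⊕ VE) × Finset (VD ⊕ VE)}
    (hq : q ∈ T.contractions) (hqp : Matches q p) (hp : (D.sketchOf (p.1 ∪ p.2)).Nonempty) :
    plainCost D p.1 p.2 * μ ≤ (Embedding.total D S).contractionCost q.1 q.2 := by
  obtain ⟨h1, h2, -⟩ := ContractionTree.mem_tensors_of_mem_contractions hq
  rw [← hqp.union_eq, sketchOf_union, Finset.union_nonempty] at hp
  rw [← hqp.plainCost_eq]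
  rcases hp with hp | hp
  · have hA := inter_nonempty_of_sketchOf (S := S) (toLeft_subset_of_mem_tensors hT h1) hp
    exact O.plainCost_mul_le hsize Finset.subset_union_left
      (O.le_sizeProd_outEdges hsize hdata hemb hA)
  · have hA := inter_nonempty_of_sketchOf (S := S) (toLeft_subset_of_mem_tensors hT h2) hp
    exact O.plainCost_mul_le hsize Finset.subset_union_right
      (O.le_sizeProd_outEdges hsize hdata hemb hA)

theorem Matches.plainCost_mul_sq_le (O : SketchOrientation D S ord)
    (hsize : ∀ f, 0 < (Embedding.total D S).size f) {μ : ℝ} (hμ : 0 ≤ μ)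
    (hdata : ∀ e ∈ D.sketch, μ ≤ D.size e) (hemb : ∀ x ∈ S.verts, μ ≤ S.rowSize ord x)
    {T : ContractionTree (VD ⊕ VE)} (hT : T.IsTreeOn (Embedding.total D S).verts)
    {p : Finset VD × Finset VD} {q : Finset (VD ⊕ VE) × Finset (VD ⊕ VE)}
    (hq : q ∈ T.contractions) (hqp : Matches q p) (hp : BothSketched D p.1 p.2) :
    plainCost D p.1 p.2 * μ ^ 2 ≤ (Embedding.total D S).contractionCost q.1 q.2 := by
  obtain ⟨h1, h2, -⟩ := ContractionTree.mem_tensors_of_mem_contractions hq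
  have hout : ∀ A ∈ T.tensors, (D.sketchOf A.toLeft).Nonempty →
      μ ≤ (Embedding.total D S).sizeProd (O.outEdges A) := fun A hA hs =>
    O.le_sizeProd_outEdges hsize hdata hemb
      (inter_nonempty_of_sketchOf (toLeft_subset_of_mem_tensors hT hA) hs)
  obtain ⟨hs1, hs2⟩ := hqp.bothSketched hp
  rw [← hqp.plainCost_eq]
  refine O.plainCost_mul_le hsize le_rfl ?_
  have hdisj := ContractionTree.disjoint_of_mem_contractions hT.1 hq
  rw [sizeProd_union (Orientation.disjoint_outEdges hdisj), sq, Nat.cast_mul]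
  exact mul_le_mul (hout _ h1 hs1) (hout _ h2 hs2) hμ (by positivity)

/-- The share of the dimensions to be sketched in the cost of the contraction `p` of the data, when
each of the contracted tensors that is adjacent to such dimensions carries one of size `μ`. -/
def sketchWeight (D : DataNetwork VD ED) (μ : ℝ) (p : Finset VD × Finset VD) : ℝ :=
  if D.sketchOf (p.1 ∪ p.2) = ∅ then 1 else if BothSketched D p.1 p.2 then μ ^ 2 else μ

theorem SketchOrientation.sum_plainCost_mul_sketchWeight_le (O : SketchOrientation D S ord)
    (hsize : ∀ f, 0 < (Embedding.total D S).size f) {μ : ℝ} (hμ : 0 ≤ μ)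
    (hdata : ∀ e ∈ D.sketch, μ ≤ D.size e) (hemb : ∀ x ∈ S.verts, μ ≤ S.rowSize ord x)
    {T₀ : ContractionTree VD} (hT₀ : T₀.leaves.Nodup)
    {T : ContractionTree (VD ⊕ VE)} (hT : T.IsTreeOn (Embedding.total D S).verts)
    (hc : T.ConstrainedOn T₀) :
    ∑ p ∈ T₀.contractions.toFinset, plainCost D p.1 p.2 * sketchWeight D μ p ≤
      (Embedding.total D S).treeCost T := by
  choose! φ hφ using hc
  calc ∑ p ∈ T₀.contractions.toFinset, plainCost D p.1 p.2 * sketchWeight D μ p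
      ≤ ∑ p ∈ T₀.contractions.toFinset,
        ((Embedding.total D S).contractionCost (φ p).1 (φ p).2 : ℝ) := by
        refine Finset.sum_le_sum fun p hp => ?_
        have hp := List.mem_toFinset.1 hp
        obtain ⟨hφT, hφp⟩ : φ p ∈ T.contractions ∧ Matches (φ p) p := hφ p hp
        rw [sketchWeight]
        split_ifs with hempty hboth
        · rw [mul_one]
          exact_mod_cast hφp.plainCost_le hsize
        · exact hφp.plainCost_mul_sq_le O hsize hμ hdata hemb hT hφT hboth
        · exact hφp.plainCost_mul_le O hsize hdata hemb hT hφT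
            (Finset.nonempty_iff_ne_empty.2 hempty)
    _ ≤ _ := by
        rw [treeCost, ContractionTree.sum_map_contractions hT.1]
        exact_mod_cast sum_comp_le_of_matches hT₀ hφ
          fun q => (Embedding.total D S).contractionCost q.1 q.2

end ConstrainedTrees

section FirstMerge

variable {VD ED VE FE : Type*} [DecidableEq VD] [DecidableEq ED] [DecidableEq VE]
variable {D : DataNetwork VD ED} {S : Embedding ED VE FE} {ord : VE → ℕ}

/-- Apart from data tensors without dimensions to be sketched, `P` consists of the data tensor `v`:
the dimension of `v` to be sketched has not yet met the embedding or another such dimension. -/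
def IsUnmerged (D : DataNetwork VD ED) (S : Embedding ED VE FE) (v : VD) (P : Finset (VD ⊕ VE)) :
    Prop :=
  P ∩ (dataSources D VE ∪ embVerts S VD) = {Sum.inl v}

namespace IsUnmerged

variable {v : VD} {P : Finset (VD ⊕ VE)}

theorem eq_of_mem (h : IsUnmerged D S v P) {z : VD ⊕ VE} (hz : z ∈ P)
    (hz' : z ∈ dataSources D VE ∪ embVerts S VD) : z = Sum.inl v :=
  Finset.mem_singleton.1 (h ▸ Finset.mem_inter.2 ⟨hz, hz'⟩)

theorem inl_mem (h : IsUnmerged D S v P) : Sum.inl v ∈ P :=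
  (Finset.mem_inter.1 (h ▸ Finset.mem_singleton_self (Sum.inl v))).1

theorem sketchOf_toLeft_eq (h : IsUnmerged D S v P) (hD : D.IsValid) (hP : P.toLeft ⊆ D.verts)
    {e : ED} (he : e ∈ D.sketch) (hev : e ∈ D.inc v) : D.sketchOf P.toLeft = {e} := by
  have hvP := Finset.mem_toLeft.2 h.inl_mem
  ext e'
  rw [Finset.mem_singleton, mem_sketchOf]
  constructor
  · rintro ⟨⟨w, hw, hew⟩, he'⟩
    obtain rfl : w = v := Sum.inl_injective (h.eq_of_mem (Finset.mem_toLeft.1 hw)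
      (Finset.mem_union_left _ (inl_mem_dataSources.2 ⟨hP hw, e', he', hew⟩)))
    exact hD.eq_of_mem_inc (hP hw) he' hew he hev
  · rintro rfl
    exact ⟨⟨v, hvP, hev⟩, he⟩

end IsUnmerged

theorem exists_isUnmerged (hS : S.verts.Nonempty) {T : ContractionTree (VD ⊕ VE)}
    (hT : T.IsTreeOn (Embedding.total D S).verts) {v : VD} (hv : v ∈ D.verts)
    {e : ED} (he : e ∈ D.sketch) (hev : e ∈ D.inc v) :
    ∃ P Q, ((P, Q) ∈ T.contractions ∨ (Q, P) ∈ T.contractions) ∧ IsUnmerged D S v P ∧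
      (Q ∩ (dataSources D VE ∪ embVerts S VD)).Nonempty := by
  set B := dataSources D VE ∪ embVerts S VD with hB
  have hvB : Sum.inl v ∈ B := Finset.mem_union_left _ (inl_mem_dataSources.2 ⟨hv, e, he, hev⟩)
  have hBT : B ⊆ T.verts := hT.2 ▸ dataSources_union_embVerts_subset
  have hne : (T.verts ∩ B.erase (Sum.inl v)).Nonempty := by
    obtain ⟨y, hy⟩ := hS
    have hyB : Sum.inr y ∈ B := Finset.mem_union_right _ (inr_mem_embVerts.2 hy)
    exact ⟨Sum.inr y, by simp [hBT hyB, hyB]⟩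
  have hunm : ∀ P : Finset (VD ⊕ VE), Sum.inl v ∈ P → Disjoint P (B.erase (Sum.inl v)) →
      IsUnmerged D S v P := fun P hvP hP => by
    rw [IsUnmerged, ← hB, ← Finset.insert_erase hvB, Finset.inter_insert_of_mem hvP,
      Finset.disjoint_iff_inter_eq_empty.1 hP]
    rfl
  have hmono : ∀ Q : Finset (VD ⊕ VE), (Q ∩ B.erase (Sum.inl v)).Nonempty → (Q ∩ B).Nonempty :=
    fun Q => Finset.Nonempty.mono (Finset.inter_subset_inter_left (Finset.erase_subset _ _))
  obtain ⟨p, hp, ⟨h1, h2, h3⟩ | ⟨h1, h2, h3⟩⟩ :=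
    ContractionTree.exists_first_contraction (hBT hvB) (Finset.notMem_erase _ _) hne
  · exact ⟨p.1, p.2, .inl hp, hunm _ h1 h2, hmono _ h3⟩
  · exact ⟨p.2, p.1, .inr hp, hunm _ h1 h2, hmono _ h3⟩

variable [DecidableEq FE]

namespace IsUnmerged

variable {v : VD} {P : Finset (VD ⊕ VE)}

theorem singleton_subset_outEdges (h : IsUnmerged D S v P) (O : SketchOrientation D S ord)
    (hv : v ∈ D.verts) {e : ED} (he : e ∈ D.sketch) (hev : e ∈ D.inc v) {A : Finset (VD ⊕ VE)}
    (hAP : A ⊆ P) (hvA : Sum.inl v ∈ A) : {Sum.inl e} ⊆ O.outEdges A := by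
  have heO : Sum.inl e ∈ O.edges := O.edges_eq ▸ inl_mem_embEdges.2 he
  rw [Finset.singleton_subset_iff, Orientation.mem_outEdges]
  refine ⟨heO, (O.src_data e he v hv hev).symm ▸ hvA, fun y hy hyA => ?_⟩
  have hyS := O.dst_emb _ heO y hy
  have hyv := h.eq_of_mem (hAP hyA) (Finset.mem_union_right _ hyS)
  simp [hyv, embVerts] at hyS

theorem prod_mul_le_contractionCost (h : IsUnmerged D S v P) (O : SketchOrientation D S ord)
    (hD : D.IsValid) (hsize : ∀ f, 0 < (Embedding.total D S).size f) {μ : ℝ} (hμ : 0 ≤ μ)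
    (hdata : ∀ e ∈ D.sketch, μ ≤ D.size e) (hemb : ∀ x ∈ S.verts, μ ≤ S.rowSize ord x)
    (hv : v ∈ D.verts) {e : ED} (he : e ∈ D.sketch) (hev : e ∈ D.inc v) {Q : Finset (VD ⊕ VE)}
    (hPQ : Disjoint P Q) (hQ : (Q ∩ (dataSources D VE ∪ embVerts S VD)).Nonempty) :
    (∏ i ∈ D.plainBoundary P.toLeft, D.size i : ℕ) * (D.size e * μ) ≤
      (Embedding.total D S).contractionCost P Q := by
  have hplain : (∏ i ∈ D.plainBoundary P.toLeft, D.size i) ≤ plainCost D P.toLeft Q.toLeft :=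
    Finset.prod_le_prod_of_subset_of_one_le' Finset.subset_union_left fun i _ _ => hD.size_pos i
  have hPout : D.size e ≤ (Embedding.total D S).sizeProd (O.outEdges P) := by
    simpa [sizeProd, Embedding.total] using
      sizeProd_mono hsize (h.singleton_subset_outEdges O hv he hev le_rfl h.inl_mem)
  have hQout := O.le_sizeProd_outEdges hsize hdata hemb hQ
  refine le_trans ?_ (O.plainCost_mul_le hsize (A := P) (B := Q) le_rfl le_rfl)
  rw [sizeProd_union (Orientation.disjoint_outEdges hPQ), Nat.cast_mul]
  gcongr

theorem plainCost_mul_size_le (h : IsUnmerged D S v P) (O : SketchOrientation D S ord)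
    (hD : D.IsValid) (hsize : ∀ f, 0 < (Embedding.total D S).size f)
    {T₀ : ContractionTree VD} (hT₀ : T₀.leaves.Nodup)
    {T : ContractionTree (VD ⊕ VE)} (hT : T.IsTreeOn (Embedding.total D S).verts)
    (hP : P ∈ T.tensors) (hv : v ∈ D.verts) {e : ED} (he : e ∈ D.sketch) (hev : e ∈ D.inc v)
    {p : Finset VD × Finset VD} (hp : p ∈ T₀.contractions) (hpP : p.1 ∪ p.2 ⊆ P.toLeft)
    (hpe : D.sketchOf (p.1 ∪ p.2) = {e}) {q : Finset (VD ⊕ VE) × Finset (VD ⊕ VE)}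
    (hq : q ∈ T.contractions) (hqp : Matches q p) :
    plainCost D p.1 p.2 * D.size e ≤ (Embedding.total D S).contractionCost q.1 q.2 := by
  obtain ⟨hp1, hp2, -⟩ := ContractionTree.mem_tensors_of_mem_contractions hp
  obtain ⟨hq1, hq2, -⟩ := ContractionTree.mem_tensors_of_mem_contractions hq
  have hpd := ContractionTree.disjoint_of_mem_contractions hT₀ hp
  have hnot : ¬ P.toLeft ⊆ p.1 ∧ ¬ P.toLeft ⊆ p.2 :=
    ⟨ContractionTree.not_subset_of_union_subset hpd
        (ContractionTree.nonempty_of_mem_tensors hp2) hpP,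
      ContractionTree.not_subset_of_union_subset hpd.symm
        (ContractionTree.nonempty_of_mem_tensors hp1) (Finset.union_comm p.1 p.2 ▸ hpP)⟩
  have hnot' : ¬ P.toLeft ⊆ q.1.toLeft ∧ ¬ P.toLeft ⊆ q.2.toLeft := by
    rcases hqp with ⟨h1, h2⟩ | ⟨h1, h2⟩
    · rwa [h1, h2]
    · rw [h1, h2]
      exact hnot.symm
  have hout : ∀ B ∈ T.tensors, Sum.inl v ∈ B → ¬ P.toLeft ⊆ B.toLeft →
      {Sum.inl e} ⊆ O.outEdges B := by
    intro B hB hvB hPB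
    rcases ContractionTree.laminar_tensors hT.1 hB hP with hl | hl | hl
    · exact absurd h.inl_mem (Finset.disjoint_left.1 hl hvB)
    · exact h.singleton_subset_outEdges O hv he hev hl hvB
    · exact absurd (Finset.toLeft_subset_toLeft hl) hPB
  have hvq : v ∈ q.1.toLeft ∪ q.2.toLeft := by
    obtain ⟨⟨w, hw, hew⟩, -⟩ := mem_sketchOf.1 (hpe ▸ Finset.mem_singleton_self e)
    obtain ⟨u, -, -, hu⟩ := hD.existsUnique_vert he
    have hwD := toLeft_subset_of_mem_tensors hT hP (hpP hw)
    rwa [hqp.union_eq, hu v hv hev, ← hu w hwD hew]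
  have hX : {Sum.inl e} ⊆ O.outEdges q.1 ∪ O.outEdges q.2 := by
    rcases Finset.mem_union.1 hvq with hv1 | hv2
    · exact (hout _ hq1 (Finset.mem_toLeft.1 hv1) hnot'.1).trans Finset.subset_union_left
    · exact (hout _ hq2 (Finset.mem_toLeft.1 hv2) hnot'.2).trans Finset.subset_union_right
  have hcost := O.plainCost_mul_le (μ := D.size e) hsize hX (by simp [sizeProd, Embedding.total])
  rw [hqp.plainCost_eq] at hcost
  exact_mod_cast hcost

end IsUnmerged

theorem IsUnmerged.mul_placeCost_le {v : VD} {P Q : Finset (VD ⊕ VE)} (h : IsUnmerged D S v P)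
    (O : SketchOrientation D S ord) (hD : D.IsValid)
    (hsize : ∀ f, 0 < (Embedding.total D S).size f) {κ : ℝ} (hκ0 : 0 ≤ κ) (hκ : κ ≤ 1) {m : ℕ}
    (hdata : ∀ e ∈ D.sketch, m < D.size e) (hemb : ∀ x ∈ S.verts, κ * m ≤ S.rowSize ord x)
    {T₀ : ContractionTree VD} (hT₀ : T₀.leaves.Nodup)
    {T : ContractionTree (VD ⊕ VE)} (hT : T.IsTreeOn (Embedding.total D S).verts)
    (hP : P ∈ T.tensors) (hPQ : Disjoint P Q)
    (hQ : (Q ∩ (dataSources D VE ∪ embVerts S VD)).Nonempty)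
    (hv : v ∈ D.verts) {e : ED} (he : e ∈ D.sketch) (hev : e ∈ D.inc v)
    {φ : Finset VD × Finset VD → Finset (VD ⊕ VE) × Finset (VD ⊕ VE)}
    (hφ : ∀ p ∈ T₀.contractions, φ p ∈ T.contractions ∧ Matches (φ p) p) :
    κ * placeCost D T₀ m e P.toLeft ≤
      (∑ p ∈ T₀.contractions.toFinset with D.sketchOf (p.1 ∪ p.2) = {e},
        (Embedding.total D S).contractionCost (φ p).1 (φ p).2 +
      (Embedding.total D S).contractionCost P Q : ℕ) := by
  have hdata' : ∀ e ∈ D.sketch, κ * m ≤ D.size e := fun e he =>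
    (mul_le_of_le_one_left (by positivity) hκ).trans (by exact_mod_cast (hdata e he).le)
  have hbelow : ∀ p ∈ T₀.contractions, D.sketchOf (p.1 ∪ p.2) = {e} →
      κ * (plainCost D p.1 p.2 * (if p.1 ∪ p.2 ⊆ P.toLeft then D.size e else m) : ℕ) ≤
        (Embedding.total D S).contractionCost (φ p).1 (φ p).2 := by
    intro p hp hpe
    obtain ⟨hφT, hφp⟩ := hφ p hp
    split_ifs with hsub
    · have hcost := h.plainCost_mul_size_le O hD hsize hT₀ hT hP hv he hev hp hsub hpe hφT hφp
      exact (mul_le_of_le_one_left (by positivity) hκ).trans (by exact_mod_cast hcost)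
    · have hcost := hφp.plainCost_mul_le O hsize hdata' hemb hT hφT (by simp [hpe])
      refine le_trans (le_of_eq ?_) hcost
      push_cast
      ring
  have hmerge := h.prod_mul_le_contractionCost O hD hsize (by positivity) hdata' hemb hv he hev
    hPQ hQ
  rw [placeCost_eq hT₀, Nat.cast_add, Nat.cast_add, mul_add, Nat.cast_sum, Nat.cast_sum,
    Finset.mul_sum]
  refine add_le_add (Finset.sum_le_sum fun p hp => ?_) (le_trans (le_of_eq ?_) hmerge)
  · obtain ⟨hp, hpe⟩ := Finset.mem_filter.1 hp
    exact hbelow p (List.mem_toFinset.1 hp) hpe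
  · push_cast
    ring

theorem sum_contractionCost_le_of_isUnmerged (hD : D.IsValid) {T : ContractionTree (VD ⊕ VE)}
    (hT : T.IsTreeOn (Embedding.total D S).verts) {v : ED → VD} {P Q : ED → Finset (VD ⊕ VE)}
    (hv : ∀ e ∈ D.sketch, e ∈ D.inc (v e))
    (hPQ : ∀ e ∈ D.sketch, (P e, Q e) ∈ T.contractions ∨ (Q e, P e) ∈ T.contractions)
    (hP : ∀ e ∈ D.sketch, IsUnmerged D S (v e) (P e)) :
    ∑ e ∈ D.sketch, (Embedding.total D S).contractionCost (P e) (Q e) ≤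
      2 * (Embedding.total D S).treeCost T := by
  set cost : Finset (VD ⊕ VE) × Finset (VD ⊕ VE) → ℕ :=
    fun q => (Embedding.total D S).contractionCost q.1 q.2
  have htree : (Embedding.total D S).treeCost T = ∑ q ∈ T.contractions.toFinset, cost q :=
    ContractionTree.sum_map_contractions hT.1 cost
  have hone : ∀ e ∈ D.sketch, cost (P e, Q e) ≤
      ∑ q ∈ T.contractions.toFinset with D.sketchOf q.1.toLeft = {e}, cost q +
        ∑ q ∈ T.contractions.toFinset with D.sketchOf q.2.toLeft = {e}, cost q := by
    intro e he
    have hPe : P e ∈ T.tensors → D.sketchOf (P e).toLeft = {e} := fun hPT =>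
      (hP e he).sketchOf_toLeft_eq hD (toLeft_subset_of_mem_tensors hT hPT) he (hv e he)
    rcases hPQ e he with h | h
    · have hs := hPe (ContractionTree.mem_tensors_of_mem_contractions h).1
      exact (Finset.single_le_sum (f := cost) (fun _ _ => Nat.zero_le _)
        (Finset.mem_filter.2 ⟨List.mem_toFinset.2 h, hs⟩)).trans (Nat.le_add_right _ _)
    · have hs := hPe (ContractionTree.mem_tensors_of_mem_contractions h).2.1
      have hcomm : cost (P e, Q e) = cost (Q e, P e) := contractionCost_comm ..
      exact hcomm ▸ (Finset.single_le_sum (f := cost) (fun _ _ => Nat.zero_le _)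
        (Finset.mem_filter.2 ⟨List.mem_toFinset.2 h, hs⟩)).trans (Nat.le_add_left _ _)
  calc ∑ e ∈ D.sketch, cost (P e, Q e)
      ≤ ∑ e ∈ D.sketch, (∑ q ∈ T.contractions.toFinset with D.sketchOf q.1.toLeft = {e}, cost q +
        ∑ q ∈ T.contractions.toFinset with D.sketchOf q.2.toLeft = {e}, cost q) :=
        Finset.sum_le_sum hone
    _ ≤ ∑ q ∈ T.contractions.toFinset, cost q + ∑ q ∈ T.contractions.toFinset, cost q := by
        rw [Finset.sum_add_distrib]
        gcongr ?_ + ?_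
        · exact sum_sum_filter_eq_singleton_le (fun _ _ => sketchOf_subset_sketch _) cost
        · exact sum_sum_filter_eq_singleton_le (fun _ _ => sketchOf_subset_sketch _) cost
    _ = 2 * (Embedding.total D S).treeCost T := by
        rw [← htree, two_mul]

theorem sum_sketch_sum_contractionCost_le {T₀ : ContractionTree VD} (hT₀ : T₀.leaves.Nodup)
    {T : ContractionTree (VD ⊕ VE)} (hT : T.leaves.Nodup)
    {φ : Finset VD × Finset VD → Finset (VD ⊕ VE) × Finset (VD ⊕ VE)}
    (hφ : ∀ p ∈ T₀.contractions, φ p ∈ T.contractions ∧ Matches (φ p) p) :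
    ∑ e ∈ D.sketch, ∑ p ∈ T₀.contractions.toFinset with D.sketchOf (p.1 ∪ p.2) = {e},
        (Embedding.total D S).contractionCost (φ p).1 (φ p).2 ≤
      (Embedding.total D S).treeCost T :=
  calc _ ≤ ∑ p ∈ T₀.contractions.toFinset,
        (Embedding.total D S).contractionCost (φ p).1 (φ p).2 :=
        sum_sum_filter_eq_singleton_le (fun _ _ => sketchOf_subset_sketch _) _
    _ ≤ ∑ q ∈ T.contractions.toFinset, (Embedding.total D S).contractionCost q.1 q.2 :=
        sum_comp_le_of_matches hT₀ hφ fun q => (Embedding.total D S).contractionCost q.1 q.2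
    _ = _ := (ContractionTree.sum_map_contractions hT _).symm

theorem SketchOrientation.sum_placeCost_le (O : SketchOrientation D S ord) (hD : D.IsValid)
    (hsize : ∀ f, 0 < (Embedding.total D S).size f) (hS : S.verts.Nonempty)
    {κ : ℝ} (hκ0 : 0 ≤ κ) (hκ : κ ≤ 1) {m : ℕ}
    (hdata : ∀ e ∈ D.sketch, m < D.size e) (hemb : ∀ x ∈ S.verts, κ * m ≤ S.rowSize ord x)
    {T₀ : ContractionTree VD} (hT₀ : T₀.IsTreeOn D.verts)
    {T : ContractionTree (VD ⊕ VE)} (hT : T.IsTreeOn (Embedding.total D S).verts)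
    (hc : T.ConstrainedOn T₀) {place : ED → Finset VD}
    (hplace : ∀ e ∈ D.sketch, ∀ W ∈ T₀.tensors, D.sketchOf W = {e} →
      placeCost D T₀ m e (place e) ≤ placeCost D T₀ m e W) :
    κ * (∑ e ∈ D.sketch, placeCost D T₀ m e (place e) : ℕ) ≤
      3 * (Embedding.total D S).treeCost T := by
  have hc' := hc
  choose! φ hφ using hc'
  obtain ⟨e₀, he₀⟩ := hD.sketch_nonempty
  have : Nonempty VD := (hD.existsUnique_vert he₀).nonempty
  choose! v hv hev _ using fun e (he : e ∈ D.sketch) => hD.existsUnique_vert he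
  choose! P Q hPQ hP hQ using fun e (he : e ∈ D.sketch) =>
    exists_isUnmerged (S := S) hS hT (hv e he) he (hev e he)
  set cost : Finset (VD ⊕ VE) × Finset (VD ⊕ VE) → ℕ :=
    fun q => (Embedding.total D S).contractionCost q.1 q.2
  have hone : ∀ e ∈ D.sketch, κ * placeCost D T₀ m e (place e) ≤
      (∑ p ∈ T₀.contractions.toFinset with D.sketchOf (p.1 ∪ p.2) = {e}, cost (φ p) +
        cost (P e, Q e) : ℕ) := by
    intro e he
    obtain ⟨hPT, hdisj⟩ : P e ∈ T.tensors ∧ Disjoint (P e) (Q e) := by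
      rcases hPQ e he with h | h
      · exact ⟨(ContractionTree.mem_tensors_of_mem_contractions h).1,
          ContractionTree.disjoint_of_mem_contractions hT.1 h⟩
      · exact ⟨(ContractionTree.mem_tensors_of_mem_contractions h).2.1,
          (ContractionTree.disjoint_of_mem_contractions hT.1 h).symm⟩
    have hPD := toLeft_subset_of_mem_tensors hT hPT
    have hmin := hplace e he (P e).toLeft
      (hc.toLeft_mem_tensors hT.1 hPT ⟨_, Finset.mem_toLeft.2 (hP e he).inl_mem⟩ (hT₀.2 ▸ hPD))
      ((hP e he).sketchOf_toLeft_eq hD hPD he (hev e he))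
    calc κ * (placeCost D T₀ m e (place e) : ℝ) ≤ κ * placeCost D T₀ m e (P e).toLeft := by gcongr
      _ ≤ _ := (hP e he).mul_placeCost_le O hD hsize hκ0 hκ hdata hemb hT₀.1 hT hPT hdisj
        (hQ e he) (hv e he) he (hev e he) hφ
  have hmerge := sum_contractionCost_le_of_isUnmerged hD hT hev hPQ hP
  calc κ * (∑ e ∈ D.sketch, placeCost D T₀ m e (place e) : ℕ)
      ≤ ∑ e ∈ D.sketch, ((∑ p ∈ T₀.contractions.toFinset with D.sketchOf (p.1 ∪ p.2) = {e},
          cost (φ p) + cost (P e, Q e) : ℕ) : ℝ) := by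
        rw [Nat.cast_sum, Finset.mul_sum]
        exact Finset.sum_le_sum hone
    _ ≤ ((Embedding.total D S).treeCost T + 2 * (Embedding.total D S).treeCost T : ℕ) := by
        rw [← Nat.cast_sum, Finset.sum_add_distrib]
        exact_mod_cast add_le_add (sum_sketch_sum_contractionCost_le hT₀.1 hT.1 hφ) hmerge
    _ = 3 * (Embedding.total D S).treeCost T := by
        push_cast
        ring

end FirstMerge

/-! ### Networks with an embedding: boundaries -/

namespace TensorNetwork

variable {V E : Type*} {G : TensorNetwork V E}

theorem treeCost_leaf [DecidableEq V] [DecidableEq E] (v : V) : G.treeCost (.leaf v) = 0 := rfl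

theorem treeCost_node [DecidableEq V] [DecidableEq E] (l r : ContractionTree V) :
    G.treeCost (.node l r) = G.contractionCost l.verts r.verts + (G.treeCost l + G.treeCost r) := by
  simp [treeCost, ContractionTree.contractions]

theorem sizeProd_union_le [DecidableEq E] {B C : Finset E} (hC : 0 < G.sizeProd C) :
    G.sizeProd (B ∪ C) ≤ G.sizeProd B * G.sizeProd C := by
  rw [sizeProd, sizeProd, sizeProd, ← Finset.prod_union_inter]
  refine Nat.le_mul_of_pos_right _ (Finset.prod_pos fun f hf => Nat.pos_of_ne_zero ?_)
  exact Finset.prod_ne_zero_iff.1 hC.ne' f (Finset.mem_inter.1 hf).2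

variable [DecidableEq V] [DecidableEq E]

theorem boundary_singleton_subset (x : V) : G.boundary {x} ⊆ G.inc x := by
  rw [boundary, Finset.singleton_biUnion]
  exact Finset.filter_subset _ _

theorem boundary_union_subset (A B : Finset V) :
    G.boundary (A ∪ B) ⊆ G.boundary A ∪ G.boundary B := by
  intro f hf
  obtain ⟨hf, hout⟩ := Finset.mem_filter.1 hf
  have hmono : ∀ {C : Finset V}, C ⊆ A ∪ B → (∃ v ∈ G.verts \ (A ∪ B), f ∈ G.inc v) →
      ∃ v ∈ G.verts \ C, f ∈ G.inc v := fun hC ⟨v, hv, hfv⟩ =>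
    ⟨v, Finset.sdiff_subset_sdiff le_rfl hC hv, hfv⟩
  rw [Finset.union_biUnion, Finset.mem_union] at hf
  rcases hf with hf | hf
  · exact Finset.mem_union_left _
      (Finset.mem_filter.2 ⟨hf, hout.imp_right (hmono Finset.subset_union_left)⟩)
  · exact Finset.mem_union_right _
      (Finset.mem_filter.2 ⟨hf, hout.imp_right (hmono Finset.subset_union_right)⟩)

theorem notMem_boundary {A : Finset V} {f : E} (hf : f ∉ G.dangling)
    (hA : ∀ v ∈ G.verts, f ∈ G.inc v → v ∈ A) : f ∉ G.boundary A := by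
  intro h
  rcases (Finset.mem_filter.1 h).2 with h | ⟨v, hv, hfv⟩
  · exact hf h
  · exact (Finset.mem_sdiff.1 hv).2 (hA v (Finset.mem_sdiff.1 hv).1 hfv)

end TensorNetwork

section SketchBoundary

variable {VD ED VE FE : Type*} [DecidableEq VD] [DecidableEq ED] [DecidableEq VE] [DecidableEq FE]
variable {D : DataNetwork VD ED} {S : Embedding ED VE FE}

/-- The dimensions of the contraction output of `A` that belong to the embedding or are to be
sketched. -/
def sketchBoundary (D : DataNetwork VD ED) (S : Embedding ED VE FE) (A : Finset (VD ⊕ VE)) :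
    Finset (ED ⊕ FE) :=
  ((Embedding.total D S).boundary A).filter fun f => ∀ e ∈ f.getLeft?, e ∈ D.sketch

theorem sketchBoundary_union_subset (A B : Finset (VD ⊕ VE)) :
    sketchBoundary D S (A ∪ B) ⊆ sketchBoundary D S A ∪ sketchBoundary D S B := by
  rw [sketchBoundary, sketchBoundary, sketchBoundary, ← Finset.filter_union]
  exact Finset.filter_subset_filter _ (boundary_union_subset A B)

theorem sketchBoundary_inr_subset (x : VE) : sketchBoundary D S {Sum.inr x} ⊆ S.inc x :=
  (Finset.filter_subset _ _).trans (boundary_singleton_subset (Sum.inr x))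

theorem exists_mem_inc_of_mem_sketchBoundary {A : Finset (VD ⊕ VE)} {f : ED ⊕ FE}
    (hf : f ∈ sketchBoundary D S A) :
    (∃ e ∈ D.sketchOf A.toLeft, f = Sum.inl e) ∨ ∃ x, Sum.inr x ∈ A ∧ f ∈ S.inc x := by
  obtain ⟨hf, hs⟩ := Finset.mem_filter.1 hf
  obtain ⟨z, hz, hfz⟩ := Finset.mem_biUnion.1 (Finset.mem_filter.1 hf).1
  rcases z with v | x
  · obtain ⟨e, hev, rfl⟩ := Finset.mem_map.1 hfz
    exact .inl ⟨e, mem_sketchOf.2 ⟨⟨v, Finset.mem_toLeft.2 hz, hev⟩, hs e rfl⟩, rfl⟩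
  · exact .inr ⟨x, hz, hfz⟩

theorem sketchBoundary_subset_of_forall_inr_notMem {A : Finset (VD ⊕ VE)}
    (hA : ∀ x, Sum.inr x ∉ A) :
    sketchBoundary D S A ⊆ (D.sketchOf A.toLeft).map Function.Embedding.inl := by
  intro f hf
  obtain ⟨e, he, rfl⟩ | ⟨x, hx, -⟩ := exists_mem_inc_of_mem_sketchBoundary hf
  · exact Finset.mem_map_of_mem _ he
  · exact absurd hx (hA x)

theorem mem_plainBoundary_of_inl_mem_boundary
    (hmem : ∀ x e, Sum.inl e ∈ S.inc x → e ∈ D.sketch) {A : Finset (VD ⊕ VE)} {e : ED}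
    (he : Sum.inl e ∈ (Embedding.total D S).boundary A) (hs : e ∉ D.sketch) :
    e ∈ D.plainBoundary A.toLeft := by
  have hdata : ∀ z, Sum.inl e ∈ (Embedding.total D S).inc z → ∃ v, z = Sum.inl v ∧ e ∈ D.inc v := by
    rintro (v | x) hz
    · exact ⟨v, rfl, by simpa [Embedding.total] using hz⟩
    · exact absurd (hmem x e hz) hs
  obtain ⟨he, hout⟩ := Finset.mem_filter.1 he
  obtain ⟨z, hz, hez⟩ := Finset.mem_biUnion.1 he
  obtain ⟨v, rfl, hev⟩ := hdata z hez
  refine Finset.mem_sdiff.2 ⟨Finset.mem_filter.2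
    ⟨Finset.mem_biUnion.2 ⟨v, Finset.mem_toLeft.2 hz, hev⟩, hout.imp (fun hd => ?_) ?_⟩, hs⟩
  · exact (Finset.mem_sdiff.1 (Finset.inl_mem_disjSum.1 hd)).1
  · rintro ⟨w, hw, hew⟩
    obtain ⟨w, rfl, hew'⟩ := hdata w hew
    rw [Finset.mem_sdiff] at hw
    exact ⟨w, Finset.mem_sdiff.2 ⟨Finset.inl_mem_disjSum.1 hw.1,
      fun h => hw.2 (Finset.mem_toLeft.1 h)⟩, hew'⟩

theorem boundary_total_subset (hmem : ∀ x e, Sum.inl e ∈ S.inc x → e ∈ D.sketch)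
    (A : Finset (VD ⊕ VE)) :
    (Embedding.total D S).boundary A ⊆
      (D.plainBoundary A.toLeft).map Function.Embedding.inl ∪ sketchBoundary D S A := by
  intro f hf
  by_cases hs : ∀ e ∈ f.getLeft?, e ∈ D.sketch
  · exact Finset.mem_union_right _ (Finset.mem_filter.2 ⟨hf, hs⟩)
  · push Not at hs
    obtain ⟨e, he, hs⟩ := hs
    obtain rfl := Sum.getLeft?_eq_some_iff.1 he
    exact Finset.mem_union_left _
      (Finset.mem_map_of_mem _ (mem_plainBoundary_of_inl_mem_boundary hmem hf hs))

theorem contractionCost_total_le (hD : ∀ e, 0 < D.size e)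
    (hmem : ∀ x e, Sum.inl e ∈ S.inc x → e ∈ D.sketch) {A B : Finset (VD ⊕ VE)}
    {Y : Finset (ED ⊕ FE)} (hY : 0 < (Embedding.total D S).sizeProd Y)
    (hA : sketchBoundary D S A ⊆ Y) (hB : sketchBoundary D S B ⊆ Y) :
    (Embedding.total D S).contractionCost A B ≤
      plainCost D A.toLeft B.toLeft * (Embedding.total D S).sizeProd Y := by
  set P := D.plainBoundary A.toLeft ∪ D.plainBoundary B.toLeft
  have hsub : (Embedding.total D S).boundary A ∪ (Embedding.total D S).boundary B ⊆
      P.map Function.Embedding.inl ∪ Y := by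
    rw [Finset.map_union]
    exact Finset.union_subset
      ((boundary_total_subset hmem A).trans
        (Finset.union_subset_union Finset.subset_union_left hA))
      ((boundary_total_subset hmem B).trans
        (Finset.union_subset_union Finset.subset_union_right hB))
  have hP : (Embedding.total D S).sizeProd (P.map Function.Embedding.inl) =
      plainCost D A.toLeft B.toLeft := Finset.prod_map _ _ _
  have hpos : ∀ f ∈ P.map Function.Embedding.inl ∪ Y, 1 ≤ (Embedding.total D S).size f := by
    intro f hf
    rcases Finset.mem_union.1 hf with hf | hf
    · obtain ⟨e, -, rfl⟩ := Finset.mem_map.1 hf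
      exact hD e
    · exact Nat.pos_of_ne_zero (Finset.prod_ne_zero_iff.1 hY.ne' f hf)
  calc (Embedding.total D S).contractionCost A B
      ≤ (Embedding.total D S).sizeProd (P.map Function.Embedding.inl ∪ Y) :=
        Finset.prod_le_prod_of_subset_of_one_le' hsub fun f hf _ => hpos f hf
    _ ≤ _ := hP ▸ sizeProd_union_le hY

theorem contractionCost_image_inl_le (hD : ∀ e, 0 < D.size e)
    (hmem : ∀ x e, Sum.inl e ∈ S.inc x → e ∈ D.sketch) (A B : Finset VD) :
    (Embedding.total D S).contractionCost (A.image Sum.inl) (B.image Sum.inl) ≤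
      plainCost D A B * ∏ e ∈ D.sketchOf (A ∪ B), D.size e := by
  have hleft : ∀ C : Finset VD, (C.image (Sum.inl : VD → VD ⊕ VE)).toLeft = C := fun C => by
    ext v
    simp
  have hsub : ∀ C ⊆ A ∪ B, sketchBoundary D S (C.image Sum.inl) ⊆
      (D.sketchOf (A ∪ B)).map Function.Embedding.inl := fun C hC => by
    have h := sketchBoundary_subset_of_forall_inr_notMem (D := D) (S := S)
      (A := C.image Sum.inl) (by simp)
    rw [hleft] at h
    exact h.trans (Finset.map_subset_map.2 (sketchOf_mono hC))
  have hprod : (Embedding.total D S).sizeProd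
      ((D.sketchOf (A ∪ B)).map Function.Embedding.inl) = ∏ e ∈ D.sketchOf (A ∪ B), D.size e :=
    Finset.prod_map _ _ _
  have h := contractionCost_total_le (S := S) hD hmem
    (hprod ▸ Finset.prod_pos fun e _ => hD e) (hsub A Finset.subset_union_left)
    (hsub B Finset.subset_union_right)
  rwa [hleft, hleft, hprod] at h

end SketchBoundary

/-! ### The algorithm's tree and embedding -/

namespace ContractionTree

variable {V W : Type*} [DecidableEq V] [DecidableEq W]

theorem verts_map (f : V → W) (t : ContractionTree V) : (t.map f).verts = t.verts.image f := by
  induction t with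
  | leaf v => simp [map]
  | node l r hl hr => simp [map, hl, hr, Finset.image_union]

theorem contractions_map (f : V → W) (t : ContractionTree V) :
    (t.map f).contractions = t.contractions.map fun p => (p.1.image f, p.2.image f) := by
  induction t with
  | leaf v => simp [map, contractions]
  | node l r hl hr => simp [map, contractions, hl, hr, verts_map]

end ContractionTree

/-- The data tensor after which a tensor of the algorithm's embedding is named. -/
def AlgVertex.name {VD : Type*} : AlgVertex VD → Finset VD
  | .kron W => W
  | .fst W => W
  | .snd W => W

/-- The dimensions all of whose ends lie in the sketched version of the data tensor `B`: those of
`B` to be sketched, and the edges of the small networks named after tensors inside `B`. -/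
def IsInternal {VD ED : Type*} [DecidableEq ED] (D : DataNetwork VD ED) (B : Finset VD) :
    ED ⊕ AlgEdge VD → Prop
  | .inl e => e ∈ D.sketchOf B
  | .inr (.whole W) => W.Nonempty ∧ W ⊆ B
  | .inr (.splitFst W) => W.Nonempty ∧ W ⊆ B
  | .inr (.splitSnd W) => W.Nonempty ∧ W ⊆ B
  | .inr (.mid W) => W.Nonempty ∧ W ⊆ B
  | .inr .out => False

namespace IsInternal

variable {VD ED : Type*} [DecidableEq ED] {D : DataNetwork VD ED} {B B' : Finset VD}
  {f : ED ⊕ AlgEdge VD}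

theorem mono (h : B ⊆ B') (hf : IsInternal D B f) : IsInternal D B' f := by
  rcases f with e | _ | _ | _ | _ | _
  · exact sketchOf_mono h hf
  all_goals first | exact ⟨hf.1, hf.2.trans h⟩ | exact hf

theorem not_of_disjoint (hD : D.IsValid) (hB : B ⊆ D.verts) (hB' : B' ⊆ D.verts)
    (hd : Disjoint B B') (hf : IsInternal D B f) : ¬ IsInternal D B' f := by
  intro hf'
  rcases f with e | _ | _ | _ | _ | _
  · exact Finset.disjoint_left.1 (hD.disjoint_sketchOf hB hB' hd) hf hf'
  all_goals first
    | exact hf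
    | exact hf.1.elim fun v hv => Finset.disjoint_left.1 hd (hf.2 hv) (hf'.2 hv)

end IsInternal

section AlgTree

variable {VD ED : Type*} [DecidableEq VD] [DecidableEq ED]
variable {D : DataNetwork VD ED} {ch : AlgChoices VD ED} {t U V : ContractionTree VD}
  {o : Finset (AlgEdge VD)} {x : AlgVertex VD}

theorem algTree_of_mem_image_place (ht : t.verts ∈ D.sketch.image ch.place) :
    algTree D ch t = .node (t.map Sum.inl) (.leaf (Sum.inr (.kron t.verts))) := by
  cases t with
  | leaf v =>
    rw [ContractionTree.verts_leaf] at ht ⊢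
    rw [algTree, if_pos ht, ContractionTree.map]
  | node l r =>
    rw [ContractionTree.verts_node] at ht ⊢
    rw [algTree, if_pos ht]

theorem algInc_of_mem_image_place (ht : t.verts ∈ D.sketch.image ch.place) :
    algInc D ch t o x = if x = .kron t.verts then (D.sketchOf t.verts).disjSum o else ∅ := by
  cases t with
  | leaf v =>
    rw [algInc]
    exact if_congr (and_iff_right ht) rfl rfl
  | node l r =>
    rw [ContractionTree.verts_node] at ht ⊢
    rw [algInc, if_pos ht]

/-- The tree `t` ends in a contraction of two tensors with sketch dimensions, performed with a small
network of two tensors that meets `U` first. -/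
structure IsMerge (D : DataNetwork VD ED) (ch : AlgChoices VD ED) (t U V : ContractionTree VD) :
    Prop where
  notMem_place : t.verts ∉ D.sketch.image ch.place
  both : BothSketched D U.verts V.verts
  order : (t = .node U V ∧ GoesFirst D U.verts V.verts) ∨
    (t = .node V U ∧ ¬ GoesFirst D V.verts U.verts)

namespace IsMerge

theorem verts_eq (h : IsMerge D ch t U V) : t.verts = U.verts ∪ V.verts := by
  rcases h.order with ⟨rfl, -⟩ | ⟨rfl, -⟩
  · exact ContractionTree.verts_node U V
  · rw [ContractionTree.verts_node, Finset.union_comm]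

theorem algTree_eq (h : IsMerge D ch t U V) :
    algTree D ch t =
      .node (.node (.node (algTree D ch U) (.leaf (Sum.inr (.fst t.verts)))) (algTree D ch V))
        (.leaf (Sum.inr (.snd t.verts))) := by
  have hp := h.notMem_place
  have hb : BothSketched D V.verts U.verts := h.both.symm
  rcases h.order with ⟨rfl, hg⟩ | ⟨rfl, hg⟩ <;> rw [ContractionTree.verts_node] at hp ⊢
  · rw [algTree, if_neg hp, if_pos h.both, if_pos hg]
  · rw [algTree, if_neg hp, if_pos hb, if_neg hg]

theorem algInc_eq (h : IsMerge D ch t U V) :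
    algInc D ch t o x =
      if x = .fst t.verts then
        {Sum.inr (.whole t.verts), Sum.inr (.splitFst t.verts), Sum.inr (.mid t.verts)}
      else if x = .snd t.verts then
        (∅ : Finset ED).disjSum ({AlgEdge.mid t.verts, AlgEdge.splitSnd t.verts} ∪ o)
      else algInc D ch U {.whole t.verts} x ∪
        algInc D ch V {.splitFst t.verts, .splitSnd t.verts} x := by
  have hp := h.notMem_place
  have hb : BothSketched D V.verts U.verts := h.both.symm
  rcases h.order with ⟨rfl, hg⟩ | ⟨rfl, hg⟩ <;> rw [ContractionTree.verts_node] at hp ⊢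
  · rw [algInc, if_neg hp, if_pos h.both]
    simp only [hg, if_true]
  · rw [algInc, if_neg hp, if_pos hb]
    simp only [hg, if_false]

theorem nodup_left (h : IsMerge D ch t U V) (ht : t.leaves.Nodup) : U.leaves.Nodup := by
  rcases h.order with ⟨rfl, -⟩ | ⟨rfl, -⟩
  · exact ContractionTree.nodup_left ht
  · exact ContractionTree.nodup_right ht

theorem nodup_right (h : IsMerge D ch t U V) (ht : t.leaves.Nodup) : V.leaves.Nodup := by
  rcases h.order with ⟨rfl, -⟩ | ⟨rfl, -⟩
  · exact ContractionTree.nodup_right ht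
  · exact ContractionTree.nodup_left ht

theorem disjoint_verts (h : IsMerge D ch t U V) (ht : t.leaves.Nodup) :
    Disjoint U.verts V.verts := by
  rcases h.order with ⟨rfl, -⟩ | ⟨rfl, -⟩
  · exact ContractionTree.disjoint_verts ht
  · exact (ContractionTree.disjoint_verts ht).symm

theorem mem_contractions (h : IsMerge D ch t U V) :
    (U.verts, V.verts) ∈ t.contractions ∨ (V.verts, U.verts) ∈ t.contractions := by
  rcases h.order with ⟨rfl, -⟩ | ⟨rfl, -⟩
  · exact .inl (ContractionTree.mem_contractions_node.2 (.inl rfl))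
  · exact .inr (ContractionTree.mem_contractions_node.2 (.inl rfl))

theorem mem_contractions_of_mem (h : IsMerge D ch t U V) {p : Finset VD × Finset VD}
    (hp : p ∈ U.contractions ∨ p ∈ V.contractions) : p ∈ t.contractions := by
  rcases h.order with ⟨rfl, -⟩ | ⟨rfl, -⟩
  · exact ContractionTree.mem_contractions_node.2 (.inr hp)
  · exact ContractionTree.mem_contractions_node.2 (.inr hp.symm)

end IsMerge

theorem algTree_induction (D : DataNetwork VD ED) (ch : AlgChoices VD ED)
    {P : ContractionTree VD → Prop}
    (placed : ∀ t, t.verts ∈ D.sketch.image ch.place → P t)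
    (leaf : ∀ v, {v} ∉ D.sketch.image ch.place → P (.leaf v))
    (merge : ∀ t U V, IsMerge D ch t U V → P U → P V → P t)
    (node : ∀ l r, l.verts ∪ r.verts ∉ D.sketch.image ch.place →
      ¬ BothSketched D l.verts r.verts → P l → P r → P (.node l r))
    (t : ContractionTree VD) : P t := by
  induction t with
  | leaf v =>
    by_cases hv : {v} ∈ D.sketch.image ch.place
    · exact placed _ hv
    · exact leaf v hv
  | node l r hl hr =>
    by_cases hp : (ContractionTree.node l r).verts ∈ D.sketch.image ch.place
    · exact placed _ hp
    by_cases hb : BothSketched D l.verts r.verts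
    · by_cases hg : GoesFirst D l.verts r.verts
      · exact merge _ l r ⟨hp, hb, .inl ⟨rfl, hg⟩⟩ hl hr
      · exact merge _ r l ⟨hp, hb.symm, .inr ⟨rfl, hg⟩⟩ hr hl
    · exact node l r (by rwa [ContractionTree.verts_node] at hp) hb hl hr

theorem toLeft_algTree (D : DataNetwork VD ED) (ch : AlgChoices VD ED) (t : ContractionTree VD) :
    (algTree D ch t).verts.toLeft = t.verts := by
  induction t using algTree_induction D ch with
  | placed t ht =>
    ext v
    simp [algTree_of_mem_image_place ht, ContractionTree.verts_map]
  | leaf v hv =>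
    ext w
    simp [algTree, hv]
  | merge t U V h hU hV =>
    rw [h.algTree_eq, h.verts_eq, ← hU, ← hV]
    ext v
    simp
  | node l r hp hb hl hr =>
    rw [algTree, if_neg hp, if_neg hb, ContractionTree.verts_node, ContractionTree.verts_node,
      ← hl, ← hr]
    ext v
    simp

theorem name_subset_of_mem_algTree (hx : Sum.inr x ∈ (algTree D ch t).verts) :
    x.name ⊆ t.verts ∧ x.name.Nonempty := by
  induction t using algTree_induction D ch with
  | placed t ht =>
    have hx : x = .kron t.verts := by
      simpa [algTree_of_mem_image_place ht, ContractionTree.verts_map] using hx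
    exact hx ▸ ⟨subset_rfl, t.verts_nonempty⟩
  | leaf v hv => simp [algTree, hv] at hx
  | merge t U V h hU hV =>
    rw [h.algTree_eq] at hx
    simp only [ContractionTree.verts_node, ContractionTree.verts_leaf, Finset.mem_union,
      Finset.mem_singleton, Sum.inr.injEq] at hx
    rcases hx with ((hx | rfl) | hx) | rfl
    · exact ⟨(hU hx).1.trans (h.verts_eq ▸ Finset.subset_union_left), (hU hx).2⟩
    · exact ⟨subset_rfl, t.verts_nonempty⟩
    · exact ⟨(hV hx).1.trans (h.verts_eq ▸ Finset.subset_union_right), (hV hx).2⟩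
    · exact ⟨subset_rfl, t.verts_nonempty⟩
  | node l r hp hb hl hr =>
    rw [algTree, if_neg hp, if_neg hb, ContractionTree.verts_node, Finset.mem_union] at hx
    rw [ContractionTree.verts_node]
    rcases hx with hx | hx
    · exact ⟨(hl hx).1.trans Finset.subset_union_left, (hl hx).2⟩
    · exact ⟨(hr hx).1.trans Finset.subset_union_right, (hr hx).2⟩

theorem inr_notMem_algTree (hch : ∀ e ∈ D.sketch, D.sketchOf (ch.place e) = {e})
    (ht : D.sketchOf t.verts = ∅) : Sum.inr x ∉ (algTree D ch t).verts := by
  induction t using algTree_induction D ch with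
  | placed t hp =>
    obtain ⟨e, he, hp⟩ := Finset.mem_image.1 hp
    rw [← hp, hch e he] at ht
    exact absurd ht (Finset.singleton_ne_empty e)
  | leaf v hv => simp [algTree, hv]
  | merge t U V h _ _ =>
    rw [h.verts_eq, sketchOf_union, Finset.union_eq_empty] at ht
    exact absurd ht.1 h.both.1.ne_empty
  | node l r hp hb hl hr =>
    rw [ContractionTree.verts_node, sketchOf_union, Finset.union_eq_empty] at ht
    rw [algTree, if_neg hp, if_neg hb, ContractionTree.verts_node, Finset.mem_union]
    exact not_or.2 ⟨hl ht.1, hr ht.2⟩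

theorem mem_algInc {f : ED ⊕ AlgEdge VD} (hf : f ∈ algInc D ch t o x) :
    Sum.inr x ∈ (algTree D ch t).verts ∧ (IsInternal D t.verts f ∨ ∃ g ∈ o, Sum.inr g = f) := by
  induction t using algTree_induction D ch generalizing o with
  | placed t ht =>
    rw [algInc_of_mem_image_place ht] at hf
    split_ifs at hf with hx
    · refine ⟨by simp [algTree_of_mem_image_place ht, hx], ?_⟩
      obtain ⟨e, he, rfl⟩ | ⟨g, hg, rfl⟩ := Finset.mem_disjSum.1 hf
      · exact .inl he
      · exact .inr ⟨g, hg, rfl⟩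
    · exact absurd hf (Finset.notMem_empty f)
  | leaf v hv => simp [algInc, hv] at hf
  | merge t U V h hU hV =>
    have hown : t.verts.Nonempty ∧ t.verts ⊆ t.verts := ⟨t.verts_nonempty, subset_rfl⟩
    have hA := h.algTree_eq
    rw [h.algInc_eq] at hf
    split_ifs at hf with hfst hsnd
    · simp only [Finset.mem_insert, Finset.mem_singleton] at hf
      exact ⟨by simp [hA, hfst], by rcases hf with rfl | rfl | rfl <;> exact .inl hown⟩
    · simp only [Finset.empty_disjSum, Finset.mem_map, Finset.mem_union, Finset.mem_insert,
        Finset.mem_singleton] at hf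
      obtain ⟨g, (rfl | rfl) | hg, rfl⟩ := hf
      exacts [⟨by simp [hA, hsnd], .inl hown⟩, ⟨by simp [hA, hsnd], .inl hown⟩,
        ⟨by simp [hA, hsnd], .inr ⟨g, hg, rfl⟩⟩]
    · simp only [Finset.mem_union] at hf
      rcases hf with hf | hf
      · refine ⟨by simp [hA, (hU hf).1], .inl ?_⟩
        obtain hf | ⟨g, hg, rfl⟩ := (hU hf).2
        · exact hf.mono (h.verts_eq ▸ Finset.subset_union_left)
        · exact Finset.mem_singleton.1 hg ▸ hown
      · refine ⟨by simp [hA, (hV hf).1], .inl ?_⟩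
        obtain hf | ⟨g, hg, rfl⟩ := (hV hf).2
        · exact hf.mono (h.verts_eq ▸ Finset.subset_union_right)
        · simp only [Finset.mem_insert, Finset.mem_singleton] at hg
          rcases hg with rfl | rfl <;> exact hown
  | node l r hp hb hl hr =>
    rw [algInc, if_neg hp, if_neg hb, Finset.mem_union] at hf
    rw [algTree, if_neg hp, if_neg hb, ContractionTree.verts_node, Finset.mem_union,
      ContractionTree.verts_node]
    rcases hf with hf | hf
    · exact ⟨.inl (hl hf).1, (hl hf).2.imp_left (IsInternal.mono Finset.subset_union_left)⟩
    · exact ⟨.inr (hr hf).1, (hr hf).2.imp_left (IsInternal.mono Finset.subset_union_right)⟩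

theorem mem_sketch_of_inl_mem_algInc {e : ED} (he : Sum.inl e ∈ algInc D ch t o x) :
    e ∈ D.sketch := by
  obtain he | ⟨g, -, hg⟩ := (mem_algInc he).2
  · exact (mem_sketchOf.1 he).2
  · exact absurd hg Sum.inr_ne_inl

end AlgTree

/-- The adjacencies `inc` of a network restrict to those built by the algorithm for the subtree `t`,
whose sketch dimension leaves through the edges in `o`. -/
structure IsPart {VD ED : Type*} [DecidableEq VD] [DecidableEq ED] (D : DataNetwork VD ED)
    (ch : AlgChoices VD ED) (inc : AlgVertex VD → Finset (ED ⊕ AlgEdge VD))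
    (t : ContractionTree VD) (o : Finset (AlgEdge VD)) : Prop where
  inc_eq : ∀ x, x.name ⊆ t.verts → inc x = algInc D ch t o x
  name_subset : ∀ x, ∀ f ∈ inc x, IsInternal D t.verts f → x.name ⊆ t.verts
  not_isInternal_out : ∀ g ∈ o, ¬ IsInternal D t.verts (Sum.inr g)

section Part

variable {VD ED : Type*} [DecidableEq VD] [DecidableEq ED]
variable {D : DataNetwork VD ED} {ch : AlgChoices VD ED} {t s s' U V l r : ContractionTree VD}
  {o os os' : Finset (AlgEdge VD)} {x : AlgVertex VD} {f : ED ⊕ AlgEdge VD}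

theorem name_subset_of_mem_algInc (hf : f ∈ algInc D ch t o x) : x.name ⊆ t.verts :=
  (name_subset_of_mem_algTree (mem_algInc hf).1).1

theorem isPart_algInc (D : DataNetwork VD ED) (ch : AlgChoices VD ED) (t : ContractionTree VD) :
    IsPart D ch (algInc D ch t {.out}) t {.out} where
  inc_eq _ _ := rfl
  name_subset _ _ hf _ := name_subset_of_mem_algInc hf
  not_isInternal_out g hg := by
    rw [Finset.mem_singleton.1 hg]
    exact id

theorem IsMerge.algInc_eq_union (hM : IsMerge D ch t U V) (hx : x.name ≠ t.verts) :
    algInc D ch t o x = algInc D ch U {.whole t.verts} x ∪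
      algInc D ch V {.splitFst t.verts, .splitSnd t.verts} x := by
  rw [hM.algInc_eq, if_neg, if_neg]
  · rintro rfl
    exact hx rfl
  · rintro rfl
    exact hx rfl

theorem IsMerge.not_subset_left (hM : IsMerge D ch t U V) (hd : Disjoint U.verts V.verts) :
    ¬ t.verts ⊆ U.verts := by
  rw [hM.verts_eq]
  exact ContractionTree.not_subset_of_union_subset hd V.verts_nonempty subset_rfl

theorem IsMerge.not_subset_right (hM : IsMerge D ch t U V)
    (hd : Disjoint U.verts V.verts) : ¬ t.verts ⊆ V.verts := by
  rw [hM.verts_eq, Finset.union_comm]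
  exact ContractionTree.not_subset_of_union_subset hd.symm U.verts_nonempty subset_rfl

namespace IsPart

variable {inc : AlgVertex VD → Finset (ED ⊕ AlgEdge VD)}

theorem child (h : IsPart D ch inc t o) (hD : D.IsValid) (ht : t.verts ⊆ D.verts)
    (hst : t.verts = s.verts ∪ s'.verts) (hd : Disjoint s.verts s'.verts)
    (hinc : ∀ x, x.name ≠ t.verts → algInc D ch t o x = algInc D ch s os x ∪ algInc D ch s' os' x)
    (htop : ∀ x, ∀ f ∈ algInc D ch t o x, x.name = t.verts → ¬ IsInternal D s.verts f)
    (hos : ∀ g ∈ os ∪ os', ¬ IsInternal D s.verts (Sum.inr g)) : IsPart D ch inc s os where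
  inc_eq x hx := by
    have hst' : s.verts ⊆ t.verts := hst ▸ Finset.subset_union_left
    have hne : x.name ≠ t.verts := fun he =>
      ContractionTree.not_subset_of_union_subset hd s'.verts_nonempty subset_rfl
        (hst ▸ he ▸ hx)
    rw [h.inc_eq x (hx.trans hst'), hinc x hne, Finset.union_eq_left]
    intro f hf
    obtain ⟨v, hv⟩ := (name_subset_of_mem_algTree (mem_algInc hf).1).2
    exact absurd (name_subset_of_mem_algInc hf hv) (Finset.disjoint_left.1 hd (hx hv))
  name_subset x f hf hs := by
    have hxt := h.name_subset x f hf (hs.mono (hst ▸ Finset.subset_union_left))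
    rw [h.inc_eq x hxt] at hf
    have hne : x.name ≠ t.verts := fun he => htop x f hf he hs
    rw [hinc x hne, Finset.mem_union] at hf
    rcases hf with hf | hf
    · exact name_subset_of_mem_algInc hf
    · rw [hst] at ht
      obtain hf | ⟨g, hg, rfl⟩ := (mem_algInc hf).2
      · exact absurd hf (hs.not_of_disjoint hD (Finset.union_subset_left ht)
          (Finset.union_subset_right ht) hd)
      · exact absurd hs (hos g (Finset.mem_union_right _ hg))
  not_isInternal_out g hg := hos g (Finset.mem_union_left _ hg)

theorem child_of_forall_algInc_eq (h : IsPart D ch inc t o) (hD : D.IsValid)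
    (ht : t.verts ⊆ D.verts) (hst : t.verts = s.verts ∪ s'.verts) (hd : Disjoint s.verts s'.verts)
    (hinc : ∀ x, algInc D ch t o x = algInc D ch s o x ∪ algInc D ch s' o x) :
    IsPart D ch inc s o := by
  refine h.child hD ht hst hd (fun x _ => hinc x) (fun x f hf hx => ?_) fun g hg hs => ?_
  · rw [hinc, Finset.mem_union] at hf
    rcases hf with hf | hf
    · exact absurd (hst ▸ hx ▸ name_subset_of_mem_algInc hf)
        (ContractionTree.not_subset_of_union_subset hd s'.verts_nonempty subset_rfl)
    · exact absurd (Finset.union_comm s.verts s'.verts ▸ hst ▸ hx ▸ name_subset_of_mem_algInc hf)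
        (ContractionTree.not_subset_of_union_subset hd.symm s.verts_nonempty subset_rfl)
  · exact h.not_isInternal_out g (by simpa using hg) (hs.mono (hst ▸ Finset.subset_union_left))

theorem not_isInternal_of_merge (h : IsPart D ch inc t o) (hM : IsMerge D ch t U V)
    (hst : s.verts ⊆ t.verts) (hts : ¬ t.verts ⊆ s.verts) (hU : ¬ t.verts ⊆ U.verts)
    (hV : ¬ t.verts ⊆ V.verts) (hf : f ∈ algInc D ch t o x) (hx : x.name = t.verts) :
    ¬ IsInternal D s.verts f := by
  rw [hM.algInc_eq] at hf
  intro hs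
  split_ifs at hf with h1 h2
  · simp only [Finset.mem_insert, Finset.mem_singleton] at hf
    rcases hf with rfl | rfl | rfl <;> exact hts hs.2
  · obtain ⟨e, he, -⟩ | ⟨g, hg, rfl⟩ := Finset.mem_disjSum.1 hf
    · exact Finset.notMem_empty e he
    · simp only [Finset.mem_union, Finset.mem_insert, Finset.mem_singleton] at hg
      rcases hg with (rfl | rfl) | hg
      · exact hts hs.2
      · exact hts hs.2
      · exact h.not_isInternal_out g hg (hs.mono hst)
  · rcases Finset.mem_union.1 hf with hf | hf
    · exact hU (hx ▸ name_subset_of_mem_algInc hf)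
    · exact hV (hx ▸ name_subset_of_mem_algInc hf)

theorem merge_left (h : IsPart D ch inc t o) (hD : D.IsValid) (ht : t.verts ⊆ D.verts)
    (hM : IsMerge D ch t U V) (hd : Disjoint U.verts V.verts) :
    IsPart D ch inc U {.whole t.verts} := by
  have hU := hM.not_subset_left hd
  refine h.child hD ht hM.verts_eq hd (fun x hx => hM.algInc_eq_union hx)
    (fun x f hf hx => h.not_isInternal_of_merge hM (hM.verts_eq ▸ Finset.subset_union_left) hU hU
      (hM.not_subset_right hd) hf hx) fun g hg hs => ?_
  simp only [Finset.mem_union, Finset.mem_insert, Finset.mem_singleton] at hg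
  rcases hg with rfl | rfl | rfl <;> exact hU hs.2

theorem merge_right (h : IsPart D ch inc t o) (hD : D.IsValid) (ht : t.verts ⊆ D.verts)
    (hM : IsMerge D ch t U V) (hd : Disjoint U.verts V.verts) :
    IsPart D ch inc V {.splitFst t.verts, .splitSnd t.verts} := by
  have hV := hM.not_subset_right hd
  refine h.child hD ht (hM.verts_eq.trans (Finset.union_comm _ _)) hd.symm
    (fun x hx => (hM.algInc_eq_union hx).trans (Finset.union_comm _ _))
    (fun x f hf hx => h.not_isInternal_of_merge hM (hM.verts_eq ▸ Finset.subset_union_right) hV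
      (hM.not_subset_left hd) hV hf hx) fun g hg hs => ?_
  simp only [Finset.mem_union, Finset.mem_insert, Finset.mem_singleton] at hg
  rcases hg with (rfl | rfl) | rfl <;> exact hV hs.2

end IsPart

end Part

section AlgNetwork

variable {VD ED : Type*} [DecidableEq VD] [DecidableEq ED]

/-- The tensor network formed by the data and the algorithm's embedding. -/
abbrev algNetwork (D : DataNetwork VD ED) (ch : AlgChoices VD ED) (T₀ : ContractionTree VD)
    (m : ℕ) : TensorNetwork (VD ⊕ AlgVertex VD) (ED ⊕ AlgEdge VD) :=
  Embedding.total D (algEmbedding D ch T₀ m)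

variable {D : DataNetwork VD ED} {ch : AlgChoices VD ED} {T₀ t U V : ContractionTree VD} {m : ℕ}
  {o : Finset (AlgEdge VD)} {f : ED ⊕ AlgEdge VD}

theorem sizeProd_algNetwork_map_inr (X : Finset (AlgEdge VD)) :
    (algNetwork D ch T₀ m).sizeProd (X.map Function.Embedding.inr) = ∏ g ∈ X, algSize ch m g :=
  Finset.prod_map _ _ _

theorem contractionCost_algNetwork_le (hD : ∀ e, 0 < D.size e)
    {A B : Finset (VD ⊕ AlgVertex VD)} {X : Finset (AlgEdge VD)}
    (hX : 0 < ∏ g ∈ X, algSize ch m g)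
    (hA : sketchBoundary D (algEmbedding D ch T₀ m) A ⊆ X.map Function.Embedding.inr)
    (hB : sketchBoundary D (algEmbedding D ch T₀ m) B ⊆ X.map Function.Embedding.inr) :
    (algNetwork D ch T₀ m).contractionCost A B ≤
      plainCost D A.toLeft B.toLeft * ∏ g ∈ X, algSize ch m g := by
  rw [← sizeProd_algNetwork_map_inr (D := D) (T₀ := T₀)] at hX ⊢
  exact contractionCost_total_le hD (fun _ _ => mem_sketch_of_inl_mem_algInc) hX hA hB

theorem inl_notMem_sketchBoundary (hD : D.IsValid) {B : Finset VD} (hB : B ⊆ D.verts) {e : ED}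
    (he : e ∈ D.sketchOf B) {A : Finset (VD ⊕ AlgVertex VD)} (hdata : B ⊆ A.toLeft)
    (hA : ∀ y, Sum.inl e ∈ (algEmbedding D ch T₀ m).inc y → Sum.inr y ∈ A) :
    Sum.inl e ∉ sketchBoundary D (algEmbedding D ch T₀ m) A := by
  obtain ⟨⟨w, hw, hew⟩, hs⟩ := mem_sketchOf.1 he
  refine fun heA => notMem_boundary ?_ ?_ (Finset.mem_filter.1 heA).1
  · exact fun hout => (Finset.mem_sdiff.1 (Finset.inl_mem_disjSum.1 hout)).2 hs
  · rintro (v | y) hv hev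
    · obtain ⟨e', hev', he'⟩ := Finset.mem_map.1 hev
      obtain rfl := Sum.inl_injective he'
      obtain ⟨z, -, -, hz⟩ := hD.existsUnique_vert hs
      have hvw : v = w :=
        (hz v (Finset.inl_mem_disjSum.1 hv) hev').trans (hz w (hB hw) hew).symm
      exact Finset.mem_toLeft.1 (hdata (hvw ▸ hw))
    · exact hA y hev

theorem inr_notMem_sketchBoundary {g : AlgEdge VD} (hg : g ≠ .out)
    {A : Finset (VD ⊕ AlgVertex VD)}
    (hA : ∀ y, Sum.inr g ∈ (algEmbedding D ch T₀ m).inc y → Sum.inr y ∈ A) :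
    Sum.inr g ∉ sketchBoundary D (algEmbedding D ch T₀ m) A := by
  refine fun hgA => notMem_boundary ?_ ?_ (Finset.mem_filter.1 hgA).1
  · exact fun hout => hg (Finset.mem_singleton.1 (Finset.inr_mem_disjSum.1 hout))
  · rintro (v | y) _ hv
    · obtain ⟨e, -, he⟩ := Finset.mem_map.1 hv
      exact absurd he Sum.inl_ne_inr
    · exact hA y hv

namespace IsPart

theorem inr_mem_algTree (h : IsPart D ch (algEmbedding D ch T₀ m).inc t o)
    (hf : IsInternal D t.verts f) {y : AlgVertex VD} (hy : f ∈ (algEmbedding D ch T₀ m).inc y) :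
    Sum.inr y ∈ (algTree D ch t).verts := by
  rw [h.inc_eq y (h.name_subset y f hy hf)] at hy
  exact (mem_algInc hy).1

theorem sketchBoundary_algTree_subset (h : IsPart D ch (algEmbedding D ch T₀ m).inc t o)
    (hD : D.IsValid) (ht : t.verts ⊆ D.verts) :
    sketchBoundary D (algEmbedding D ch T₀ m) (algTree D ch t).verts ⊆
      o.map Function.Embedding.inr := by
  intro f hf
  have hnot : ¬ IsInternal D t.verts f := by
    intro hi
    rcases f with e | g
    · exact inl_notMem_sketchBoundary hD ht hi (toLeft_algTree D ch t).superset
        (fun y hy => h.inr_mem_algTree hi hy) hf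
    · exact inr_notMem_sketchBoundary (fun hg => (hg ▸ hi : IsInternal D t.verts (Sum.inr .out)))
        (fun y hy => h.inr_mem_algTree hi hy) hf
  obtain ⟨e, he, rfl⟩ | ⟨x, hx, hfx⟩ := exists_mem_inc_of_mem_sketchBoundary hf
  · rw [toLeft_algTree] at he
    exact absurd he hnot
  · rw [h.inc_eq x (name_subset_of_mem_algTree hx).1] at hfx
    obtain ⟨g, hg, rfl⟩ := (mem_algInc hfx).2.resolve_left hnot
    exact Finset.mem_map_of_mem _ hg

theorem inc_fst (h : IsPart D ch (algEmbedding D ch T₀ m).inc t o) (hM : IsMerge D ch t U V) :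
    (algEmbedding D ch T₀ m).inc (.fst t.verts) =
      ({.whole t.verts, .splitFst t.verts, .mid t.verts} : Finset (AlgEdge VD)).map
        Function.Embedding.inr := by
  rw [h.inc_eq (.fst t.verts) subset_rfl, hM.algInc_eq, if_pos rfl]
  simp

theorem inc_snd (h : IsPart D ch (algEmbedding D ch T₀ m).inc t o) (hM : IsMerge D ch t U V) :
    (algEmbedding D ch T₀ m).inc (.snd t.verts) =
      ({AlgEdge.mid t.verts, AlgEdge.splitSnd t.verts} ∪ o).map Function.Embedding.inr := by
  rw [h.inc_eq (.snd t.verts) subset_rfl, hM.algInc_eq, if_neg (by simp), if_pos rfl,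
    Finset.empty_disjSum]

end IsPart

end AlgNetwork

section SplitRest

variable {m p : ℕ}

theorem splitRest_pos (hm : 0 < m) (hp : 0 < p) : 0 < splitRest m p :=
  Nat.div_pos (by omega) hp

theorem mul_splitRest_le (hpm : p ≤ m) : p * splitRest m p ≤ 2 * m :=
  (Nat.mul_div_le _ _).trans (by omega)

end SplitRest

section Merge

variable {VD ED : Type*} [DecidableEq VD] [DecidableEq ED]
variable {D : DataNetwork VD ED} {ch : AlgChoices VD ED} {T₀ t U V : ContractionTree VD} {m : ℕ}
  {o : Finset (AlgEdge VD)}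

theorem plainCost_empty (D : DataNetwork VD ED) (A : Finset VD) :
    plainCost D A ∅ = ∏ e ∈ D.plainBoundary A, D.size e := by
  simp [plainCost, DataNetwork.plainBoundary, boundary]

theorem toLeft_singleton_inr {α β : Type*} (x : β) :
    ({Sum.inr x} : Finset (α ⊕ β)).toLeft = ∅ := by
  ext
  simp

namespace IsPart

theorem sketchBoundary_fst_subset (h : IsPart D ch (algEmbedding D ch T₀ m).inc t o)
    (hM : IsMerge D ch t U V) :
    sketchBoundary D (algEmbedding D ch T₀ m) {Sum.inr (.fst t.verts)} ⊆
      ({.whole t.verts, .splitFst t.verts, .mid t.verts} : Finset (AlgEdge VD)).map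
        Function.Embedding.inr :=
  (sketchBoundary_inr_subset _).trans (h.inc_fst hM).subset

theorem sketchBoundary_snd_subset (h : IsPart D ch (algEmbedding D ch T₀ m).inc t o)
    (hM : IsMerge D ch t U V) :
    sketchBoundary D (algEmbedding D ch T₀ m) {Sum.inr (.snd t.verts)} ⊆
      ({AlgEdge.mid t.verts, AlgEdge.splitSnd t.verts} ∪ o).map Function.Embedding.inr :=
  (sketchBoundary_inr_subset _).trans (h.inc_snd hM).subset

theorem notMem_inc_snd (h : IsPart D ch (algEmbedding D ch T₀ m).inc t o)
    (hM : IsMerge D ch t U V) {g : AlgEdge VD} (hg : IsInternal D t.verts (Sum.inr g))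
    (hmid : g ≠ .mid t.verts) (hsplit : g ≠ .splitSnd t.verts) :
    Sum.inr g ∉ (algEmbedding D ch T₀ m).inc (.snd t.verts) := by
  rw [h.inc_snd hM]
  simp only [Finset.mem_map, Finset.mem_union, Finset.mem_insert, Finset.mem_singleton,
    Function.Embedding.inr_apply, Sum.inr.injEq, exists_eq_right]
  rintro ((hg' | hg') | hg')
  exacts [hmid hg', hsplit hg', h.not_isInternal_out g hg' hg]

theorem mem_of_whole_mem_inc (h : IsPart D ch (algEmbedding D ch T₀ m).inc t o)
    (hD : D.IsValid) (ht : t.verts ⊆ D.verts) (hM : IsMerge D ch t U V)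
    (hd : Disjoint U.verts V.verts) {y : AlgVertex VD}
    (hy : Sum.inr (.whole t.verts) ∈ (algEmbedding D ch T₀ m).inc y) :
    Sum.inr y ∈ (algTree D ch U).verts ∪ {Sum.inr (.fst t.verts)} := by
  have hwhole : IsInternal D t.verts (Sum.inr (.whole t.verts)) := ⟨t.verts_nonempty, subset_rfl⟩
  have hyt := h.inr_mem_algTree hwhole hy
  simp only [hM.algTree_eq, ContractionTree.verts_node, ContractionTree.verts_leaf,
    Finset.mem_union (t := {Sum.inr (AlgVertex.snd t.verts)}),
    Finset.mem_union (t := (algTree D ch V).verts), Finset.mem_singleton, Sum.inr.injEq] at hyt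
  obtain (hyt | hyV) | rfl := hyt
  · exact hyt
  · rw [(h.merge_right hD ht hM hd).inc_eq y (name_subset_of_mem_algTree hyV).1] at hy
    obtain hV | ⟨g, hg, hgw⟩ := (mem_algInc hy).2
    · exact absurd hV.2 (hM.not_subset_right hd)
    · simp [Sum.inr_injective hgw] at hg
  · exact absurd hy (h.notMem_inc_snd hM hwhole (by simp) (by simp))

theorem sketchBoundary_left_fst_subset (h : IsPart D ch (algEmbedding D ch T₀ m).inc t o)
    (hD : D.IsValid) (ht : t.verts ⊆ D.verts) (hM : IsMerge D ch t U V)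
    (hd : Disjoint U.verts V.verts) :
    sketchBoundary D (algEmbedding D ch T₀ m)
        ((algTree D ch U).verts ∪ {Sum.inr (.fst t.verts)}) ⊆
      ({.splitFst t.verts, .mid t.verts} : Finset (AlgEdge VD)).map Function.Embedding.inr := by
  intro f hf
  have hU : U.verts ⊆ D.verts := (hM.verts_eq ▸ Finset.subset_union_left).trans ht
  have hwhole : f ≠ Sum.inr (.whole t.verts) := by
    rintro rfl
    exact inr_notMem_sketchBoundary (by simp) (fun y => h.mem_of_whole_mem_inc hD ht hM hd) hf
  have hf' := Finset.union_subset_union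
    ((h.merge_left hD ht hM hd).sketchBoundary_algTree_subset hD hU)
    (h.sketchBoundary_fst_subset hM) (sketchBoundary_union_subset _ _ hf)
  rw [← Finset.map_union] at hf'
  obtain ⟨g, hg, rfl⟩ := Finset.mem_map.1 hf'
  have hgw : g ≠ .whole t.verts := fun hg => hwhole (congrArg Sum.inr hg)
  refine Finset.mem_map_of_mem _ ?_
  simpa [hgw] using hg

theorem sketchBoundary_left_fst_right_subset (h : IsPart D ch (algEmbedding D ch T₀ m).inc t o)
    (hD : D.IsValid) (ht : t.verts ⊆ D.verts) (hM : IsMerge D ch t U V)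
    (hd : Disjoint U.verts V.verts) :
    sketchBoundary D (algEmbedding D ch T₀ m)
        ((algTree D ch U).verts ∪ {Sum.inr (.fst t.verts)} ∪ (algTree D ch V).verts) ⊆
      ({.mid t.verts, .splitSnd t.verts} : Finset (AlgEdge VD)).map Function.Embedding.inr := by
  intro f hf
  have hV : V.verts ⊆ D.verts := (hM.verts_eq ▸ Finset.subset_union_right).trans ht
  have hfst : IsInternal D t.verts (Sum.inr (.splitFst t.verts)) := ⟨t.verts_nonempty, subset_rfl⟩
  have hsplit : f ≠ Sum.inr (.splitFst t.verts) := by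
    rintro rfl
    refine inr_notMem_sketchBoundary (by simp) (fun y hy => ?_) hf
    have hyt := h.inr_mem_algTree hfst hy
    rw [hM.algTree_eq, ContractionTree.verts_node, Finset.mem_union, ContractionTree.verts_node,
      ContractionTree.verts_node, ContractionTree.verts_leaf] at hyt
    refine hyt.resolve_right fun hsnd => ?_
    obtain rfl : y = .snd t.verts := by simpa using hsnd
    exact h.notMem_inc_snd hM hfst (by simp) (by simp) hy
  have hf' := Finset.union_subset_union (h.sketchBoundary_left_fst_subset hD ht hM hd)
    ((h.merge_right hD ht hM hd).sketchBoundary_algTree_subset hD hV)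
    (sketchBoundary_union_subset _ _ hf)
  rw [← Finset.map_union] at hf'
  obtain ⟨g, hg, rfl⟩ := Finset.mem_map.1 hf'
  have hgs : g ≠ .splitFst t.verts := fun hg => hsplit (congrArg Sum.inr hg)
  refine Finset.mem_map_of_mem _ ?_
  simpa [hgs, or_comm] using hg

theorem contractionCost_left_fst_le (h : IsPart D ch (algEmbedding D ch T₀ m).inc t o)
    (hD : D.IsValid) (ht : t.verts ⊆ D.verts) (hM : IsMerge D ch t U V)
    (hd : Disjoint U.verts V.verts) (hm : 0 < m) (hp : 0 < ch.split t.verts) :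
    (algNetwork D ch T₀ m).contractionCost (algTree D ch U).verts {Sum.inr (.fst t.verts)} ≤
      (∏ e ∈ D.plainBoundary U.verts, D.size e) * m * ch.split t.verts * m := by
  have hU : U.verts ⊆ D.verts := (hM.verts_eq ▸ Finset.subset_union_left).trans ht
  have hprod : ∏ g ∈ {.whole t.verts, .splitFst t.verts, .mid t.verts}, algSize ch m g =
      m * (ch.split t.verts * m) := by
    simp [algSize]
  refine (contractionCost_algNetwork_le hD.size_pos (by rw [hprod]; positivity)
    (((h.merge_left hD ht hM hd).sketchBoundary_algTree_subset hD hU).trans ?_)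
    (h.sketchBoundary_fst_subset hM)).trans_eq ?_
  · exact Finset.map_subset_map.2 (by simp)
  · rw [hprod, toLeft_algTree, toLeft_singleton_inr, plainCost_empty]
    ring

theorem contractionCost_left_fst_right_le (h : IsPart D ch (algEmbedding D ch T₀ m).inc t o)
    (hD : D.IsValid) (ht : t.verts ⊆ D.verts) (hM : IsMerge D ch t U V)
    (hd : Disjoint U.verts V.verts) (hm : 0 < m) (hp : 0 < ch.split t.verts) :
    (algNetwork D ch T₀ m).contractionCost
        ((algTree D ch U).verts ∪ {Sum.inr (.fst t.verts)}) (algTree D ch V).verts ≤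
      (∏ e ∈ D.plainBoundary U.verts ∪ D.plainBoundary V.verts, D.size e) * m *
        ch.split t.verts * splitRest m (ch.split t.verts) := by
  have hV : V.verts ⊆ D.verts := (hM.verts_eq ▸ Finset.subset_union_right).trans ht
  have hq := splitRest_pos hm hp
  have hprod : ∏ g ∈ {.splitFst t.verts, .mid t.verts, .splitSnd t.verts}, algSize ch m g =
      ch.split t.verts * (m * splitRest m (ch.split t.verts)) := by
    simp [algSize]
  refine (contractionCost_algNetwork_le hD.size_pos (by rw [hprod]; positivity)
    ((h.sketchBoundary_left_fst_subset hD ht hM hd).trans (Finset.map_subset_map.2 ?_))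
    (((h.merge_right hD ht hM hd).sketchBoundary_algTree_subset hD hV).trans
      (Finset.map_subset_map.2 ?_))).trans_eq ?_
  · exact Finset.insert_subset_insert _ (by simp)
  · exact Finset.insert_subset_insert _ (by simp)
  · rw [hprod, Finset.toLeft_union, toLeft_algTree, toLeft_algTree, toLeft_singleton_inr,
      Finset.union_empty, plainCost]
    ring

theorem contractionCost_snd_le (h : IsPart D ch (algEmbedding D ch T₀ m).inc t o)
    (hD : D.IsValid) (ht : t.verts ⊆ D.verts) (hM : IsMerge D ch t U V)
    (hd : Disjoint U.verts V.verts) (hm : 0 < m) (hp : 0 < ch.split t.verts)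
    (ho : ∏ g ∈ o, algSize ch m g ∈ Set.Icc 1 (2 * m)) :
    (algNetwork D ch T₀ m).contractionCost
        ((algTree D ch U).verts ∪ {Sum.inr (.fst t.verts)} ∪ (algTree D ch V).verts)
        {Sum.inr (.snd t.verts)} ≤
      2 * ((∏ e ∈ D.plainBoundary t.verts, D.size e) * m *
        splitRest m (ch.split t.verts) * m) := by
  have hq := splitRest_pos hm hp
  have hdisj : Disjoint {AlgEdge.mid t.verts, AlgEdge.splitSnd t.verts} o := by
    have hown : t.verts.Nonempty ∧ t.verts ⊆ t.verts := ⟨t.verts_nonempty, subset_rfl⟩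
    simp only [Finset.disjoint_insert_left, Finset.disjoint_singleton_left]
    exact ⟨fun hg => h.not_isInternal_out _ hg hown, fun hg => h.not_isInternal_out _ hg hown⟩
  have hprod : ∏ g ∈ {.mid t.verts, .splitSnd t.verts} ∪ o, algSize ch m g =
      m * splitRest m (ch.split t.verts) * ∏ g ∈ o, algSize ch m g := by
    rw [Finset.prod_union hdisj]
    simp [algSize]
  have hopos : 0 < ∏ g ∈ o, algSize ch m g := ho.1
  refine (contractionCost_algNetwork_le hD.size_pos (by rw [hprod]; positivity)
    ((h.sketchBoundary_left_fst_right_subset hD ht hM hd).trans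
      (Finset.map_subset_map.2 Finset.subset_union_left))
    (h.sketchBoundary_snd_subset hM)).trans ?_
  rw [hprod, Finset.toLeft_union, Finset.toLeft_union, toLeft_algTree, toLeft_algTree,
    toLeft_singleton_inr, toLeft_singleton_inr, Finset.union_empty, plainCost_empty,
    ← hM.verts_eq]
  calc (∏ e ∈ D.plainBoundary t.verts, D.size e) *
        (m * splitRest m (ch.split t.verts) * ∏ g ∈ o, algSize ch m g)
      ≤ (∏ e ∈ D.plainBoundary t.verts, D.size e) *
        (m * splitRest m (ch.split t.verts) * (2 * m)) := by gcongr; exact ho.2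
    _ = _ := by ring

theorem treeCost_merge_le (h : IsPart D ch (algEmbedding D ch T₀ m).inc t o)
    (hD : D.IsValid) (ht : t.verts ⊆ D.verts) (hM : IsMerge D ch t U V)
    (hd : Disjoint U.verts V.verts) (hm : 0 < m) (hp : 0 < ch.split t.verts)
    (ho : ∏ g ∈ o, algSize ch m g ∈ Set.Icc 1 (2 * m)) :
    (algNetwork D ch T₀ m).treeCost (algTree D ch t) ≤
      2 * splitCost D m U.verts V.verts (ch.split t.verts) +
        ((algNetwork D ch T₀ m).treeCost (algTree D ch U) +
          (algNetwork D ch T₀ m).treeCost (algTree D ch V)) := by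
  have hfst := h.contractionCost_left_fst_le hD ht hM hd hm hp
  have hright := h.contractionCost_left_fst_right_le hD ht hM hd hm hp
  have hsnd := h.contractionCost_snd_le hD ht hM hd hm hp ho
  rw [hM.algTree_eq, treeCost_node, treeCost_node, treeCost_node, treeCost_leaf, treeCost_leaf,
    splitCost, ← hM.verts_eq]
  simp only [ContractionTree.verts_node, ContractionTree.verts_leaf]
  omega

end IsPart

end Merge

section StepCost

variable {VD ED : Type*} [DecidableEq VD] [DecidableEq ED]

/-- What the algorithm spends, up to a constant, on a contraction of the data tree, the sketching
matrices left aside. -/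
def stepCost (D : DataNetwork VD ED) (ch : AlgChoices VD ED) (m : ℕ)
    (p : Finset VD × Finset VD) : ℕ :=
  if D.sketchOf (p.1 ∪ p.2) = ∅ then plainCost D p.1 p.2
  else if BothSketched D p.1 p.2 then
    if GoesFirst D p.1 p.2 then splitCost D m p.1 p.2 (ch.split (p.1 ∪ p.2))
    else splitCost D m p.2 p.1 (ch.split (p.1 ∪ p.2))
  else plainCost D p.1 p.2 * (if ∃ e ∈ D.sketchOf (p.1 ∪ p.2), p.1 ∪ p.2 ⊆ ch.place e then
    ∏ e ∈ D.sketchOf (p.1 ∪ p.2), D.size e else m)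

variable {D : DataNetwork VD ED} {ch : AlgChoices VD ED} {T₀ t U V l r : ContractionTree VD}
  {m : ℕ} {o : Finset (AlgEdge VD)} {e : ED} {A B : Finset VD}

theorem not_bothSketched_of_subset_singleton (hD : D.IsValid) (hA : A ⊆ D.verts)
    (hB : B ⊆ D.verts) (hAB : Disjoint A B) (he : D.sketchOf (A ∪ B) ⊆ {e}) :
    ¬ BothSketched D A B := by
  rintro ⟨⟨a, ha⟩, ⟨b, hb⟩⟩
  rw [sketchOf_union] at he
  obtain rfl := Finset.mem_singleton.1 (he (Finset.mem_union_left _ ha))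
  obtain rfl := Finset.mem_singleton.1 (he (Finset.mem_union_right _ hb))
  exact Finset.disjoint_left.1 (hD.disjoint_sketchOf hA hB hAB) ha hb

theorem stepCost_of_subset_place (hD : D.IsValid) (he : D.sketchOf (ch.place e) = {e})
    (hAD : A ⊆ D.verts) (hBD : B ⊆ D.verts) (hAB : Disjoint A B) (h : A ∪ B ⊆ ch.place e) :
    stepCost D ch m (A, B) = plainCost D A B * ∏ e' ∈ D.sketchOf (A ∪ B), D.size e' := by
  have hsub : D.sketchOf (A ∪ B) ⊆ {e} := he ▸ sketchOf_mono h
  rw [stepCost]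
  by_cases hempty : D.sketchOf (A ∪ B) = ∅
  · rw [if_pos hempty, hempty, Finset.prod_empty, mul_one]
  · obtain ⟨a, ha⟩ := Finset.nonempty_iff_ne_empty.2 hempty
    have hae : a = e := Finset.mem_singleton.1 (hsub ha)
    rw [if_neg hempty, if_neg (not_bothSketched_of_subset_singleton hD hAD hBD hAB hsub),
      if_pos ⟨a, ha, hae ▸ h⟩]

theorem plainCost_mul_le_stepCost (hD : D.IsValid) (hm : ∀ e ∈ D.sketch, m ≤ D.size e)
    (hempty : D.sketchOf (A ∪ B) ≠ ∅) (hboth : ¬ BothSketched D A B) :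
    plainCost D A B * m ≤ stepCost D ch m (A, B) := by
  rw [stepCost, if_neg hempty, if_neg hboth]
  refine Nat.mul_le_mul_left _ ?_
  split_ifs with hplace
  · obtain ⟨e, he, -⟩ := hplace
    exact (hm e (mem_sketchOf.1 he).2).trans
      (Finset.single_le_prod' (f := D.size) (fun i _ => hD.size_pos i) he)
  · exact le_rfl

theorem IsMerge.sum_stepCost (hM : IsMerge D ch t U V) :
    (t.contractions.map (stepCost D ch m)).sum =
      splitCost D m U.verts V.verts (ch.split t.verts) +
        ((U.contractions.map (stepCost D ch m)).sum +
          (V.contractions.map (stepCost D ch m)).sum) := by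
  have hempty : D.sketchOf (U.verts ∪ V.verts) ≠ ∅ :=
    (hM.both.1.mono (sketchOf_mono Finset.subset_union_left)).ne_empty
  have hboth : BothSketched D V.verts U.verts := hM.both.symm
  rcases hM.order with ⟨rfl, hg⟩ | ⟨rfl, hg⟩ <;>
    simp only [ContractionTree.contractions, ContractionTree.verts_node, List.map_cons,
      List.sum_cons, List.map_append, List.sum_append, stepCost]
  · rw [if_neg hempty, if_pos hM.both, if_pos hg]
  · rw [Finset.union_comm V.verts, if_neg hempty, if_pos hboth, if_neg hg,
      add_comm (List.sum _) (List.sum _)]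

theorem IsMerge.split_mem (hM : IsMerge D ch t U V)
    (hsplit : ∀ p ∈ t.contractions, BothSketched D p.1 p.2 →
      ch.split (p.1 ∪ p.2) ∈ Finset.Icc 1 m) : ch.split t.verts ∈ Finset.Icc 1 m := by
  rcases hM.mem_contractions with hmem | hmem
  · exact hM.verts_eq ▸ hsplit _ hmem hM.both
  · exact hM.verts_eq.trans (Finset.union_comm _ _) ▸ hsplit _ hmem hM.both.symm

theorem sum_sketchOf_union (hD : D.IsValid) (hAB : A ∪ B ⊆ D.verts) (hd : Disjoint A B)
    (f : ED → ℕ) :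
    ∑ e ∈ D.sketchOf (A ∪ B), f e = ∑ e ∈ D.sketchOf A, f e + ∑ e ∈ D.sketchOf B, f e := by
  rw [sketchOf_union, Finset.sum_union (hD.disjoint_sketchOf (Finset.union_subset_left hAB)
    (Finset.union_subset_right hAB) hd)]

theorem treeCost_map_inl_le (hD : D.IsValid) (he : D.sketchOf (ch.place e) = {e})
    (ht : t.leaves.Nodup) (htD : t.verts ⊆ D.verts) (hte : t.verts = ch.place e) :
    (algNetwork D ch T₀ m).treeCost (t.map Sum.inl) ≤
      (t.contractions.map (stepCost D ch m)).sum := by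
  rw [treeCost, ContractionTree.contractions_map, List.map_map]
  refine List.sum_le_sum fun p hp => ?_
  have hpt := ContractionTree.union_subset_of_mem_contractions hp
  exact (contractionCost_image_inl_le hD.size_pos
    (fun _ _ => mem_sketch_of_inl_mem_algInc) p.1 p.2).trans_eq
    (stepCost_of_subset_place hD he ((Finset.union_subset_left hpt).trans htD)
      ((Finset.union_subset_right hpt).trans htD)
      (ContractionTree.disjoint_of_mem_contractions ht hp) (hpt.trans hte.subset)).symm

namespace IsPart

theorem contractionCost_kron_le (h : IsPart D ch (algEmbedding D ch T₀ m).inc t o)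
    (hD : D.IsValid) (ht : t.verts ∈ D.sketch.image ch.place) (he : D.sketchOf t.verts = {e})
    (ho : ∏ g ∈ o, algSize ch m g ∈ Set.Icc 1 (2 * m)) :
    (algNetwork D ch T₀ m).contractionCost (t.map Sum.inl).verts {Sum.inr (.kron t.verts)} ≤
      2 * ((∏ i ∈ D.plainBoundary t.verts, D.size i) * D.size e * m) := by
  have hinc : (algEmbedding D ch T₀ m).inc (.kron t.verts) = ({e} : Finset ED).disjSum o := by
    rw [h.inc_eq (.kron t.verts) subset_rfl, algInc_of_mem_image_place ht, if_pos rfl, he]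
  have hleft : (t.map Sum.inl : ContractionTree (VD ⊕ AlgVertex VD)).verts.toLeft = t.verts := by
    ext v
    simp [ContractionTree.verts_map]
  have hprod : (algNetwork D ch T₀ m).sizeProd (({e} : Finset ED).disjSum o) =
      D.size e * ∏ g ∈ o, algSize ch m g := by
    rw [sizeProd, Finset.prod_disjSum, Finset.prod_singleton]
    rfl
  have hpos := Nat.mul_pos (hD.size_pos e) ho.1
  refine (contractionCost_total_le (Y := ({e} : Finset ED).disjSum o) hD.size_pos
    (fun _ _ => mem_sketch_of_inl_mem_algInc) (by rwa [hprod]) ?_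
    ((sketchBoundary_inr_subset _).trans hinc.subset)).trans ?_
  · refine (sketchBoundary_subset_of_forall_inr_notMem fun x => ?_).trans ?_
    · simp [ContractionTree.verts_map]
    · rw [hleft, he]
      simp
  · rw [hprod, hleft, toLeft_singleton_inr, plainCost_empty]
    calc (∏ i ∈ D.plainBoundary t.verts, D.size i) * (D.size e * ∏ g ∈ o, algSize ch m g)
        ≤ (∏ i ∈ D.plainBoundary t.verts, D.size i) * (D.size e * (2 * m)) := by
          gcongr
          exact ho.2
      _ = _ := by ring

theorem contractionCost_node_le (hl : IsPart D ch (algEmbedding D ch T₀ m).inc l o)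
    (hr : IsPart D ch (algEmbedding D ch T₀ m).inc r o) (hD : D.IsValid)
    (hlD : l.verts ⊆ D.verts) (hrD : r.verts ⊆ D.verts) (hm : ∀ e ∈ D.sketch, m ≤ D.size e)
    (hch : ∀ e ∈ D.sketch, D.sketchOf (ch.place e) = {e})
    (hboth : ¬ BothSketched D l.verts r.verts)
    (ho : ∏ g ∈ o, algSize ch m g ∈ Set.Icc 1 (2 * m)) :
    (algNetwork D ch T₀ m).contractionCost (algTree D ch l).verts (algTree D ch r).verts ≤
      2 * stepCost D ch m (l.verts, r.verts) := by
  by_cases hempty : D.sketchOf (l.verts ∪ r.verts) = ∅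
  · have hbdry : ∀ s : ContractionTree VD, D.sketchOf s.verts = ∅ →
        sketchBoundary D (algEmbedding D ch T₀ m) (algTree D ch s).verts ⊆
          (∅ : Finset (AlgEdge VD)).map Function.Embedding.inr := fun s hs => by
      have hsub := sketchBoundary_subset_of_forall_inr_notMem (D := D)
        (S := algEmbedding D ch T₀ m) fun x => inr_notMem_algTree (x := x) hch hs
      rwa [toLeft_algTree, hs] at hsub
    have hempty' := hempty
    rw [sketchOf_union, Finset.union_eq_empty] at hempty'
    have hcost := contractionCost_algNetwork_le hD.size_pos (by simp)
      (hbdry l hempty'.1) (hbdry r hempty'.2)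
    rw [Finset.prod_empty, mul_one, toLeft_algTree, toLeft_algTree] at hcost
    rw [stepCost, if_pos hempty]
    exact hcost.trans (Nat.le_mul_of_pos_left _ two_pos)
  · have hcost := contractionCost_algNetwork_le hD.size_pos ho.1
      (hl.sketchBoundary_algTree_subset hD hlD) (hr.sketchBoundary_algTree_subset hD hrD)
    rw [toLeft_algTree, toLeft_algTree] at hcost
    calc _ ≤ plainCost D l.verts r.verts * ∏ g ∈ o, algSize ch m g := hcost
      _ ≤ plainCost D l.verts r.verts * (2 * m) := Nat.mul_le_mul_left _ ho.2
      _ = 2 * (plainCost D l.verts r.verts * m) := by ring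
      _ ≤ _ := Nat.mul_le_mul_left _ (plainCost_mul_le_stepCost hD hm hempty hboth)

theorem treeCost_placed_le (h : IsPart D ch (algEmbedding D ch T₀ m).inc t o)
    (hD : D.IsValid) (htD : t.verts ⊆ D.verts) (ht : t.leaves.Nodup) (he : e ∈ D.sketch)
    (hch : D.sketchOf (ch.place e) = {e}) (hte : t.verts = ch.place e)
    (ho : ∏ g ∈ o, algSize ch m g ∈ Set.Icc 1 (2 * m)) :
    (algNetwork D ch T₀ m).treeCost (algTree D ch t) ≤
      2 * ((t.contractions.map (stepCost D ch m)).sum +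
        (∏ i ∈ D.plainBoundary (ch.place e), D.size i) * D.size e * m) := by
  have hp : t.verts ∈ D.sketch.image ch.place := Finset.mem_image.2 ⟨e, he, hte.symm⟩
  have hkron := h.contractionCost_kron_le hD hp (hte ▸ hch) ho
  have hbelow := treeCost_map_inl_le (T₀ := T₀) (m := m) hD hch ht htD hte
  rw [algTree_of_mem_image_place hp, treeCost_node, treeCost_leaf, ContractionTree.verts_leaf,
    ← hte]
  omega

end IsPart

theorem IsPart.left_right_of_not_bothSketched
    (h : IsPart D ch (algEmbedding D ch T₀ m).inc (.node l r) o) (hD : D.IsValid)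
    (hp : l.verts ∪ r.verts ∉ D.sketch.image ch.place) (hb : ¬ BothSketched D l.verts r.verts)
    (ht : (ContractionTree.node l r).verts ⊆ D.verts) (hd : Disjoint l.verts r.verts) :
    IsPart D ch (algEmbedding D ch T₀ m).inc l o ∧
      IsPart D ch (algEmbedding D ch T₀ m).inc r o := by
  have hinc : ∀ x, algInc D ch (.node l r) o x = algInc D ch l o x ∪ algInc D ch r o x :=
    fun x => by rw [algInc, if_neg hp, if_neg hb]
  exact ⟨h.child_of_forall_algInc_eq hD ht (ContractionTree.verts_node l r) hd hinc,
    h.child_of_forall_algInc_eq hD ht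
      ((ContractionTree.verts_node l r).trans (Finset.union_comm _ _)) hd.symm
      fun x => (hinc x).trans (Finset.union_comm _ _)⟩

theorem IsPart.treeCost_algTree_le (h : IsPart D ch (algEmbedding D ch T₀ m).inc t o)
    (hD : D.IsValid) (hm : 0 < m) (hms : ∀ e ∈ D.sketch, m ≤ D.size e)
    (hch : ∀ e ∈ D.sketch, D.sketchOf (ch.place e) = {e}) (ht : t.leaves.Nodup)
    (htD : t.verts ⊆ D.verts)
    (hsplit : ∀ p ∈ t.contractions, BothSketched D p.1 p.2 →
      ch.split (p.1 ∪ p.2) ∈ Finset.Icc 1 m)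
    (ho : ∏ g ∈ o, algSize ch m g ∈ Set.Icc 1 (2 * m)) :
    (algNetwork D ch T₀ m).treeCost (algTree D ch t) ≤
      2 * ((t.contractions.map (stepCost D ch m)).sum +
        ∑ e ∈ D.sketchOf t.verts,
          (∏ i ∈ D.plainBoundary (ch.place e), D.size i) * D.size e * m) := by
  induction t using algTree_induction D ch generalizing o with
  | placed t hp =>
    obtain ⟨e, he, hte⟩ := Finset.mem_image.1 hp
    rw [← hte, hch e he, Finset.sum_singleton]
    exact h.treeCost_placed_le hD htD ht he (hch e he) hte.symm ho
  | leaf v hv =>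
    rw [algTree, if_neg hv, treeCost_leaf]
    exact Nat.zero_le _
  | merge t U V hM hU hV =>
    have hd := hM.disjoint_verts ht
    have hUV := hM.verts_eq ▸ htD
    obtain ⟨hp₁, hpm⟩ := Finset.mem_Icc.1 (hM.split_mem hsplit)
    have hcost := h.treeCost_merge_le hD htD hM hd hm hp₁ ho
    have hcostU := hU (h.merge_left hD htD hM hd) (hM.nodup_left ht)
      (Finset.union_subset_left hUV) (fun p hp => hsplit p (hM.mem_contractions_of_mem (.inl hp)))
      (by rw [Finset.prod_singleton]; exact ⟨hm, Nat.le_mul_of_pos_left m two_pos⟩)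
    have hcostV := hV (h.merge_right hD htD hM hd) (hM.nodup_right ht)
      (Finset.union_subset_right hUV) (fun p hp => hsplit p (hM.mem_contractions_of_mem (.inr hp)))
      (by
        rw [Finset.prod_pair (by simp)]
        exact ⟨Nat.mul_pos hp₁ (splitRest_pos hm hp₁), mul_splitRest_le hpm⟩)
    rw [hM.sum_stepCost, hM.verts_eq, sum_sketchOf_union hD hUV hd, ← hM.verts_eq]
    omega
  | node l r hp hb hl hr =>
    have hd := ContractionTree.disjoint_verts ht
    have hlr := ContractionTree.verts_node l r ▸ htD
    obtain ⟨hL, hR⟩ := h.left_right_of_not_bothSketched hD hp hb htD hd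
    have hlD := Finset.union_subset_left hlr
    have hrD := Finset.union_subset_right hlr
    have hcost := hL.contractionCost_node_le hR hD hlD hrD hms hch hb ho
    have hcostl := hl hL (ContractionTree.nodup_left ht) hlD
      (fun p hp => hsplit p (ContractionTree.mem_contractions_node.2 (.inr (.inl hp)))) ho
    have hcostr := hr hR (ContractionTree.nodup_right ht) hrD
      (fun p hp => hsplit p (ContractionTree.mem_contractions_node.2 (.inr (.inr hp)))) ho
    rw [algTree, if_neg hp, if_neg hb, treeCost_node, ContractionTree.verts_node,
      sum_sketchOf_union hD hlr hd]
    simp only [ContractionTree.contractions, List.map_cons, List.sum_cons, List.map_append,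
      List.sum_append]
    omega

end StepCost

/-! ### Choosing the split size -/

section Reals

/-- The split size `√(m b / c)` balances the two terms; outside `[1, m]` an endpoint will do. -/
theorem exists_mem_Icc_mul_add_le {b c m : ℝ} (hb : 1 ≤ b) (hc : 1 ≤ c) (hm : 1 ≤ m) :
    ∃ θ ∈ Set.Icc 1 m, c * θ + 4 * (b * (m / θ)) ≤ 5 * max (b * c) (√m * √(b * c)) := by
  have hc0 : 0 < c := by linarith
  have hbc : b ≤ b * c := le_mul_of_one_le_right (by linarith) hc
  have hcb : c ≤ b * c := le_mul_of_one_le_left hc0.le hb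
  have hmax := le_max_left (b * c) (√m * √(b * c))
  by_cases hlow : m * b ≤ c
  · exact ⟨1, ⟨le_rfl, hm⟩, by linarith [div_one m, mul_comm b m]⟩
  by_cases hhigh : m * c ≤ b
  · refine ⟨m, ⟨hm, le_rfl⟩, ?_⟩
    rw [div_self (by linarith), mul_one]
    linarith [mul_comm c m]
  rw [not_le] at hlow hhigh
  have hθ0 : 0 < √(m * b / c) := Real.sqrt_pos.2 (by positivity)
  have hθ2 : √(m * b / c) ^ 2 = m * b / c := Real.sq_sqrt (by positivity)
  have hbalance : c * √(m * b / c) = √m * √(b * c) := by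
    rw [← Real.sqrt_mul (by linarith), ← sq_eq_sq₀ (by positivity) (by positivity), mul_pow, hθ2,
      Real.sq_sqrt (by positivity)]
    field_simp
  refine ⟨√(m * b / c), ⟨?_, ?_⟩, ?_⟩
  · exact Real.one_le_sqrt.2 ((one_le_div hc0).2 hlow.le)
  · refine Real.sqrt_le_iff.2 ⟨by linarith, (div_le_iff₀ hc0).2 ?_⟩
    rw [sq, mul_assoc]
    gcongr
  · have hsame : b * (m / √(m * b / c)) = c * √(m * b / c) := by
      rw [← mul_div_assoc, div_eq_iff hθ0.ne', mul_assoc, ← sq, hθ2]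
      field_simp
    rw [hsame, hbalance]
    linarith [le_max_right (b * c) (√m * √(b * c))]

theorem mul_mul_le_mul_sq_add_pow {a ρ s : ℝ} (ha : 0 ≤ a) (hρ : 0 ≤ ρ) (hs : 0 ≤ s)
    (haρ : a ≤ ρ ^ 2) : a * ρ * s ≤ a * ρ ^ 2 + s ^ 4 := by
  rcases le_total s ρ with hsρ | hρs
  · calc a * ρ * s ≤ a * ρ * ρ := by gcongr
      _ = a * ρ ^ 2 := by ring
      _ ≤ a * ρ ^ 2 + s ^ 4 := le_add_of_nonneg_right (by positivity)
  · calc a * ρ * s ≤ ρ ^ 2 * ρ * s := by gcongr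
      _ ≤ s ^ 2 * s * s := by gcongr
      _ = s ^ 4 := by ring
      _ ≤ a * ρ ^ 2 + s ^ 4 := le_add_of_nonneg_left (by positivity)

theorem exists_mul_add_le_of_le {a b c m s : ℝ} (ha : 1 ≤ a) (hab : a ≤ b) (hc : 1 ≤ c)
    (hs : 1 ≤ s) (hsm : s ^ 8 = m) :
    ∃ θ ∈ Set.Icc 1 m, a * c * θ + 2 * (a * b * c) + 4 * (a * b * (m / θ)) ≤
      7 * s ^ 3 * (a * b * c + s ^ 4) := by
  have hm : 1 ≤ m := hsm ▸ one_le_pow₀ hs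
  have hs3 : 1 ≤ s ^ 3 := one_le_pow₀ hs
  have hb : 1 ≤ b := ha.trans hab
  obtain ⟨θ, hθ, hle⟩ := exists_mem_Icc_mul_add_le hb hc hm
  have habc : a * b * c ≤ s ^ 3 * (a * b * c + s ^ 4) :=
    calc a * b * c ≤ a * b * c + s ^ 4 := le_add_of_nonneg_right (by positivity)
      _ ≤ _ := le_mul_of_one_le_left (by positivity) hs3
  have hsqrt : a * (√m * √(b * c)) ≤ s ^ 3 * (a * b * c + s ^ 4) := by
    have hs4 : √m = s ^ 4 := by
      rw [← hsm, show s ^ 8 = (s ^ 4) ^ 2 by ring, Real.sqrt_sq (by positivity)]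
    have hρ2 : √(b * c) ^ 2 = b * c := Real.sq_sqrt (by positivity)
    calc a * (√m * √(b * c)) = s ^ 3 * (a * √(b * c) * s) := by rw [hs4]; ring
      _ ≤ s ^ 3 * (a * √(b * c) ^ 2 + s ^ 4) := by
        gcongr
        refine mul_mul_le_mul_sq_add_pow (by linarith) (by positivity) (by linarith) ?_
        rw [hρ2]
        exact hab.trans (le_mul_of_one_le_right (by linarith) hc)
      _ = _ := by rw [hρ2, mul_assoc a b c]
  have hmax : a * max (b * c) (√m * √(b * c)) ≤ s ^ 3 * (a * b * c + s ^ 4) := by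
    rw [mul_max_of_nonneg _ _ (by linarith), ← mul_assoc a b c]
    exact max_le habc hsqrt
  refine ⟨θ, hθ, ?_⟩
  calc a * c * θ + 2 * (a * b * c) + 4 * (a * b * (m / θ))
      = a * (c * θ + 4 * (b * (m / θ))) + 2 * (a * b * c) := by ring
    _ ≤ a * (5 * max (b * c) (√m * √(b * c))) + 2 * (a * b * c) := by gcongr
    _ ≤ 7 * s ^ 3 * (a * b * c + s ^ 4) := by linarith

end Reals

theorem splitRest_floor_le {m : ℕ} {θ : ℝ} (hθ : θ ∈ Set.Icc 1 (m : ℝ)) :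
    (splitRest m ⌊θ⌋₊ : ℝ) ≤ 4 * (m / θ) := by
  have hθ0 : 0 < θ := zero_lt_one.trans_le hθ.1
  have hfloor : θ ≤ 2 * ⌊θ⌋₊ := by
    have h1 : (1 : ℝ) ≤ ⌊θ⌋₊ := by exact_mod_cast (Nat.one_le_floor_iff θ).2 hθ.1
    linarith [Nat.lt_floor_add_one θ]
  have hprod : (⌊θ⌋₊ : ℝ) * splitRest m ⌊θ⌋₊ ≤ 2 * m := by
    exact_mod_cast mul_splitRest_le (Nat.floor_le_of_le hθ.2)
  rw [← mul_div_assoc, le_div_iff₀ hθ0]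
  calc (splitRest m ⌊θ⌋₊ : ℝ) * θ ≤ splitRest m ⌊θ⌋₊ * (2 * ⌊θ⌋₊) := by gcongr
    _ = 2 * (⌊θ⌋₊ * splitRest m ⌊θ⌋₊) := by ring
    _ ≤ 4 * m := by linarith

section Split

variable {VD ED : Type*} [DecidableEq VD] [DecidableEq ED] {D : DataNetwork VD ED}

theorem plainBoundary_union_subset (U V : Finset VD) :
    D.plainBoundary (U ∪ V) ⊆ D.plainBoundary U ∪ D.plainBoundary V := by
  intro e he
  simp only [DataNetwork.plainBoundary, boundary, Finset.mem_sdiff, Finset.mem_filter,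
    Finset.mem_biUnion, Finset.mem_union, not_or] at he ⊢
  obtain ⟨⟨⟨v, hv, hev⟩, hout⟩, hs⟩ := he
  rcases hv with hv | hv
  · exact .inl ⟨⟨⟨v, hv, hev⟩, hout.imp id fun ⟨w, hw, h⟩ => ⟨w, ⟨hw.1, hw.2.1⟩, h⟩⟩, hs⟩
  · exact .inr ⟨⟨⟨v, hv, hev⟩, hout.imp id fun ⟨w, hw, h⟩ => ⟨w, ⟨hw.1, hw.2.2⟩, h⟩⟩, hs⟩

theorem DataNetwork.IsGraph.notMem_boundary_union (hG : D.IsGraph) {U V : Finset VD}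
    (hU : U ⊆ D.verts) (hV : V ⊆ D.verts) (hUV : Disjoint U V) {e : ED}
    (heU : e ∈ D.boundary U) (heV : e ∈ D.boundary V) : e ∉ D.boundary (U ∪ V) := by
  simp only [boundary, Finset.mem_filter, Finset.mem_biUnion] at heU heV
  obtain ⟨⟨u, hu, heu⟩, -⟩ := heU
  obtain ⟨⟨v, hv, hev⟩, -⟩ := heV
  have huv : u ≠ v := fun h => Finset.disjoint_left.1 hUV hu (h ▸ hv)
  have hu' : u ∈ D.verts.filter (e ∈ D.inc ·) := Finset.mem_filter.2 ⟨hU hu, heu⟩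
  have hv' : v ∈ D.verts.filter (e ∈ D.inc ·) := Finset.mem_filter.2 ⟨hV hv, hev⟩
  have hdangling : e ∉ D.dangling := fun hd =>
    ((hG e).1 hd).not_gt (Finset.one_lt_card.2 ⟨u, hu', v, hv', huv⟩)
  intro he
  obtain ⟨w, hw, hew⟩ := (Finset.mem_filter.1 he).2.resolve_left hdangling
  simp only [Finset.mem_sdiff, Finset.mem_union, not_or] at hw
  exact ((hG e).2 hdangling).not_gt <| Finset.two_lt_card.2
    ⟨u, hu', v, hv', w, Finset.mem_filter.2 ⟨hw.1, hew⟩, huv,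
      fun h => hw.2.1 (h ▸ hu), fun h => hw.2.2 (h ▸ hv)⟩

theorem DataNetwork.IsGraph.plainBoundary_union_subset_union_sdiff (hG : D.IsGraph)
    {U V : Finset VD} (hU : U ⊆ D.verts) (hV : V ⊆ D.verts) (hUV : Disjoint U V) :
    D.plainBoundary (U ∪ V) ⊆ (D.plainBoundary U \ D.plainBoundary V) ∪
      (D.plainBoundary V \ D.plainBoundary U) := by
  intro e he
  have hor := Finset.mem_union.1 (plainBoundary_union_subset U V he)
  have hnand : ¬ (e ∈ D.plainBoundary U ∧ e ∈ D.plainBoundary V) := fun h =>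
    hG.notMem_boundary_union hU hV hUV (Finset.mem_sdiff.1 h.1).1 (Finset.mem_sdiff.1 h.2).1
      (Finset.mem_sdiff.1 he).1
  simp only [Finset.mem_union, Finset.mem_sdiff]
  tauto

theorem splitCost_floor_le {m : ℕ} {θ : ℝ} (hθ : θ ∈ Set.Icc 1 (m : ℝ)) (U V : Finset VD) :
    (splitCost D m U V ⌊θ⌋₊ : ℝ) ≤
      ((∏ i ∈ D.plainBoundary U, D.size i : ℕ) * θ + 2 * plainCost D U V +
        4 * ((∏ i ∈ D.plainBoundary (U ∪ V), D.size i : ℕ) * (m / θ))) * (m : ℝ) ^ 2 := by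
  have hfloor : (⌊θ⌋₊ : ℝ) ≤ θ := Nat.floor_le (zero_le_one.trans hθ.1)
  have hprod : (⌊θ⌋₊ : ℝ) * splitRest m ⌊θ⌋₊ ≤ 2 * m := by
    exact_mod_cast mul_splitRest_le (Nat.floor_le_of_le hθ.2)
  have hrest := splitRest_floor_le hθ
  rw [splitCost, plainCost]
  generalize ∏ i ∈ D.plainBoundary U, D.size i = A
  generalize ∏ i ∈ D.plainBoundary U ∪ D.plainBoundary V, D.size i = X
  generalize ∏ i ∈ D.plainBoundary (U ∪ V), D.size i = Y
  push_cast
  calc (A : ℝ) * m * ⌊θ⌋₊ * m + X * m * ⌊θ⌋₊ * splitRest m ⌊θ⌋₊ + Y * m * splitRest m ⌊θ⌋₊ * m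
      = A * ⌊θ⌋₊ * (m : ℝ) ^ 2 + X * m * (⌊θ⌋₊ * splitRest m ⌊θ⌋₊) +
        Y * splitRest m ⌊θ⌋₊ * (m : ℝ) ^ 2 := by ring
    _ ≤ A * θ * (m : ℝ) ^ 2 + X * m * (2 * m) + Y * (4 * (m / θ)) * (m : ℝ) ^ 2 := by gcongr
    _ = _ := by ring

theorem floor_mem_Icc {m : ℕ} {θ : ℝ} (hθ : θ ∈ Set.Icc 1 (m : ℝ)) : ⌊θ⌋₊ ∈ Finset.Icc 1 m :=
  Finset.mem_Icc.2 ⟨(Nat.one_le_floor_iff θ).2 hθ.1, Nat.floor_le_of_le hθ.2⟩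

theorem exists_splitCost_le_sqrt (hD : D.IsValid) {m : ℕ} (hm : 0 < m) (U V : Finset VD) :
    ∃ k ∈ Finset.Icc 1 m, (splitCost D m U V k : ℝ) ≤
      7 * √(m : ℝ) * (plainCost D U V * (m : ℝ) ^ 2) := by
  have hm1 : (1 : ℝ) ≤ m := by exact_mod_cast hm
  have hs1 : 1 ≤ √(m : ℝ) := Real.one_le_sqrt.2 hm1
  have hθ : √(m : ℝ) ∈ Set.Icc 1 (m : ℝ) :=
    ⟨hs1, Real.sqrt_le_iff.2 ⟨by positivity, le_self_pow₀ hm1 two_ne_zero⟩⟩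
  have hU : ((∏ i ∈ D.plainBoundary U, D.size i : ℕ) : ℝ) ≤ plainCost D U V := by
    exact_mod_cast Finset.prod_le_prod_of_subset_of_one_le' Finset.subset_union_left
      fun i _ _ => hD.size_pos i
  have hUV : ((∏ i ∈ D.plainBoundary (U ∪ V), D.size i : ℕ) : ℝ) ≤ plainCost D U V := by
    exact_mod_cast Finset.prod_le_prod_of_subset_of_one_le' (plainBoundary_union_subset U V)
      fun i _ _ => hD.size_pos i
  refine ⟨_, floor_mem_Icc hθ, (splitCost_floor_le hθ U V).trans ?_⟩
  rw [Real.div_sqrt]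
  calc _ ≤ (plainCost D U V * √(m : ℝ) + 2 * (plainCost D U V * √(m : ℝ)) +
        4 * (plainCost D U V * √(m : ℝ))) * (m : ℝ) ^ 2 := by
        gcongr
        exact le_mul_of_one_le_right (by positivity) hs1
    _ = _ := by ring

theorem prod_plainBoundary_eq_mul (U V : Finset VD) :
    ∏ i ∈ D.plainBoundary U, D.size i =
      (∏ i ∈ D.plainBoundary U \ D.plainBoundary V, D.size i) *
        ∏ i ∈ D.plainBoundary U ∩ D.plainBoundary V, D.size i := by
  rw [← Finset.prod_union (Finset.disjoint_sdiff_inter _ _), Finset.sdiff_union_inter]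

theorem plainCost_eq_mul (U V : Finset VD) :
    plainCost D U V = (∏ i ∈ D.plainBoundary U \ D.plainBoundary V, D.size i) *
      (∏ i ∈ D.plainBoundary V \ D.plainBoundary U, D.size i) *
        ∏ i ∈ D.plainBoundary U ∩ D.plainBoundary V, D.size i := by
  rw [mul_right_comm, ← prod_plainBoundary_eq_mul, ← Finset.prod_union Finset.disjoint_sdiff,
    Finset.union_sdiff_self_eq_union, plainCost]

theorem exists_splitCost_le_of_isGraph (hD : D.IsValid) (hG : D.IsGraph) {m : ℕ}
    {U V : Finset VD} (hU : U ⊆ D.verts) (hV : V ⊆ D.verts) (hUV : Disjoint U V)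
    (hle : GoesFirst D U V) {s : ℝ} (hs : 1 ≤ s) (hsm : s ^ 8 = m) :
    ∃ k ∈ Finset.Icc 1 m, (splitCost D m U V k : ℝ) ≤
      7 * s ^ 3 * (plainCost D U V * (m : ℝ) ^ 2 + (m : ℝ) ^ 2 * s ^ 4) := by
  set a := ∏ i ∈ D.plainBoundary U \ D.plainBoundary V, D.size i with ha
  set b := ∏ i ∈ D.plainBoundary V \ D.plainBoundary U, D.size i with hb
  set c := ∏ i ∈ D.plainBoundary U ∩ D.plainBoundary V, D.size i with hc
  have ha1 : (1 : ℝ) ≤ a := by exact_mod_cast Finset.prod_pos fun i _ => hD.size_pos i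
  have hc1 : (1 : ℝ) ≤ c := by exact_mod_cast Finset.prod_pos fun i _ => hD.size_pos i
  have hab : (a : ℝ) ≤ b := by exact_mod_cast hle
  obtain ⟨θ, hθ, hbound⟩ := exists_mul_add_le_of_le ha1 hab hc1 hs hsm
  have hmerged : ((∏ i ∈ D.plainBoundary (U ∪ V), D.size i : ℕ) : ℝ) ≤ a * b := by
    rw [ha, hb, ← Nat.cast_mul, ← Finset.prod_union disjoint_sdiff_sdiff]
    exact_mod_cast Finset.prod_le_prod_of_subset_of_one_le'
      (hG.plainBoundary_union_subset_union_sdiff hU hV hUV) fun i _ _ => hD.size_pos i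
  have hθ0 : 0 < θ := zero_lt_one.trans_le hθ.1
  refine ⟨_, floor_mem_Icc hθ, (splitCost_floor_le hθ U V).trans ?_⟩
  rw [prod_plainBoundary_eq_mul U V, plainCost_eq_mul, ← ha, ← hb, ← hc]
  simp only [Nat.cast_mul]
  calc _ ≤ ((a : ℝ) * c * θ + 2 * (a * b * c) + 4 * (a * b * (m / θ))) * (m : ℝ) ^ 2 := by gcongr
    _ ≤ 7 * s ^ 3 * (a * b * c + s ^ 4) * (m : ℝ) ^ 2 := by gcongr
    _ = _ := by ring

end Split

/-! ### Comparison with the optimum -/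

section Algorithm

variable {VD ED : Type*} [DecidableEq VD] [DecidableEq ED] {D : DataNetwork VD ED}
variable {T₀ : ContractionTree VD} {m : ℕ} {ch : AlgChoices VD ED} {p : Finset VD × Finset VD}

theorem stepCost_of_sketchOf_eq_singleton (hD : D.IsValid) (hT₀ : T₀.IsTreeOn D.verts)
    (hp : p ∈ T₀.contractions) {e : ED} (he : D.sketchOf (p.1 ∪ p.2) = {e}) :
    stepCost D ch m p =
      plainCost D p.1 p.2 * (if p.1 ∪ p.2 ⊆ ch.place e then D.size e else m) := by
  have hpD := ContractionTree.union_subset_of_mem_contractions hp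
  rw [hT₀.2] at hpD
  have hboth := not_bothSketched_of_subset_singleton hD (Finset.union_subset_left hpD)
    (Finset.union_subset_right hpD) (ContractionTree.disjoint_of_mem_contractions hT₀.1 hp) he.le
  rw [stepCost, if_neg (he ▸ Finset.singleton_ne_empty e), if_neg hboth, he]
  simp

theorem sum_placeCost_place (hD : D.IsValid) (hT₀ : T₀.IsTreeOn D.verts) :
    ∑ e ∈ D.sketch, placeCost D T₀ m e (ch.place e) =
      ∑ p ∈ T₀.contractions.toFinset with (D.sketchOf (p.1 ∪ p.2)).card = 1, stepCost D ch m p +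
      ∑ e ∈ D.sketch, (∏ i ∈ D.plainBoundary (ch.place e), D.size i) * D.size e * m := by
  rw [← sum_sum_filter_eq_singleton fun _ _ => sketchOf_subset_sketch _,
    ← Finset.sum_add_distrib]
  refine Finset.sum_congr rfl fun e _ => ?_
  rw [placeCost_eq hT₀.1]
  congr 1
  refine Finset.sum_congr rfl fun p hp => ?_
  obtain ⟨hp, hpe⟩ := Finset.mem_filter.1 hp
  rw [stepCost_of_sketchOf_eq_singleton hD hT₀ (List.mem_toFinset.1 hp) hpe]

theorem algCost_le_two_mul (hD : D.IsValid) (hT₀ : T₀.IsTreeOn D.verts) (hm : 0 < m)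
    (hms : ∀ e ∈ D.sketch, m < D.size e) (hch : ch.IsOptimal D T₀ m) :
    algCost D ch T₀ m ≤ 2 * (∑ e ∈ D.sketch, placeCost D T₀ m e (ch.place e) +
      ∑ p ∈ T₀.contractions.toFinset with (D.sketchOf (p.1 ∪ p.2)).card ≠ 1,
        stepCost D ch m p) := by
  have htree := (isPart_algInc D ch T₀).treeCost_algTree_le (T₀ := T₀) hD hm
    (fun e he => (hms e he).le) (fun e he => (hch.place_mem e he).2) hT₀.1 hT₀.2.le hch.split_mem
    (by rw [Finset.prod_singleton]; exact ⟨hm, by change m ≤ 2 * m; omega⟩)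
  refine htree.trans (Nat.mul_le_mul_left _ ?_)
  rw [ContractionTree.sum_map_contractions hT₀.1, sum_placeCost_place hD hT₀,
    ← Finset.sum_filter_add_sum_filter_not _ fun p => (D.sketchOf (p.1 ∪ p.2)).card = 1,
    add_right_comm]
  gcongr
  exact sketchOf_subset_sketch _

theorem stepCost_of_not_bothSketched (hpl : ∀ e ∈ D.sketch, D.sketchOf (ch.place e) = {e})
    (hp : (D.sketchOf (p.1 ∪ p.2)).card ≠ 1) (hboth : ¬ BothSketched D p.1 p.2) :
    (stepCost D ch m p : ℝ) = plainCost D p.1 p.2 * sketchWeight D m p := by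
  rw [stepCost, sketchWeight]
  by_cases hempty : D.sketchOf (p.1 ∪ p.2) = ∅
  · rw [if_pos hempty, if_pos hempty, mul_one]
  · have hplace : ¬ ∃ e ∈ D.sketchOf (p.1 ∪ p.2), p.1 ∪ p.2 ⊆ ch.place e := by
      rintro ⟨e, he, hsub⟩
      refine hp (Finset.card_eq_one.2 ⟨e, (Finset.subset_singleton_iff.1 ?_).resolve_left hempty⟩)
      exact hpl e (mem_sketchOf.1 he).2 ▸ sketchOf_mono hsub
    rw [if_neg hempty, if_neg hboth, if_neg hplace, if_neg hempty, if_neg hboth, Nat.cast_mul]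

theorem sketchWeight_of_bothSketched (hboth : BothSketched D p.1 p.2) (μ : ℝ) :
    sketchWeight D μ p = μ ^ 2 := by
  have hne : D.sketchOf (p.1 ∪ p.2) ≠ ∅ :=
    (hboth.1.mono (sketchOf_mono Finset.subset_union_left)).ne_empty
  rw [sketchWeight, if_neg hne, if_pos hboth]

theorem sq_mul_sketchWeight_le {κ μ : ℝ} (hκ0 : 0 ≤ κ) (hκ : κ ≤ 1) (hμ : 0 ≤ μ) :
    κ ^ 2 * sketchWeight D μ p ≤ sketchWeight D (κ * μ) p := by
  rw [sketchWeight, sketchWeight]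
  split_ifs
  · exact mul_le_one₀ (pow_le_one₀ hκ0 hκ) zero_le_one le_rfl
  · rw [mul_pow]
  · exact mul_le_mul_of_nonneg_right (pow_le_of_le_one hκ0 hκ two_ne_zero) hμ

theorem sketchWeight_nonneg {μ : ℝ} (hμ : 0 ≤ μ) : 0 ≤ sketchWeight D μ p := by
  rw [sketchWeight]
  split_ifs <;> positivity

theorem card_filter_bothSketched_le (hD : D.IsValid) (hT₀ : T₀.IsTreeOn D.verts) :
    {p ∈ T₀.contractions.toFinset | BothSketched D p.1 p.2}.card ≤ D.sketch.card - 1 := by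
  calc {p ∈ T₀.contractions.toFinset | BothSketched D p.1 p.2}.card
      = T₀.contractions.countP fun p => BothSketched D p.1 p.2 := by
        rw [List.countP_eq_length_filter, ← List.toFinset_card_of_nodup
          ((ContractionTree.nodup_contractions hT₀.1).filter _), List.toFinset_filter]
        simp only [decide_eq_true_eq]
    _ ≤ (D.sketchOf T₀.verts).card - 1 := hD.countP_bothSketched_le hT₀.1 hT₀.2.le
    _ ≤ D.sketch.card - 1 :=
        Nat.sub_le_sub_right (Finset.card_le_card (sketchOf_subset_sketch _)) 1

theorem sum_stepCost_le (hD : D.IsValid) (hT₀ : T₀.IsTreeOn D.verts) {Λ τ : ℝ}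
    (hΛ : 1 ≤ Λ) (hτ : 0 ≤ τ) (hpl : ∀ e ∈ D.sketch, D.sketchOf (ch.place e) = {e})
    (hboth : ∀ p ∈ T₀.contractions, BothSketched D p.1 p.2 →
      (stepCost D ch m p : ℝ) ≤ Λ * (plainCost D p.1 p.2 * (m : ℝ) ^ 2 + τ)) :
    ((∑ p ∈ T₀.contractions.toFinset with (D.sketchOf (p.1 ∪ p.2)).card ≠ 1,
        stepCost D ch m p : ℕ) : ℝ) ≤
      Λ * (∑ p ∈ T₀.contractions.toFinset, plainCost D p.1 p.2 * sketchWeight D m p +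
        (D.sketch.card - 1 : ℕ) * τ) := by
  have hweight : ∀ p, 0 ≤ plainCost D p.1 p.2 * sketchWeight D (m : ℝ) p := fun p =>
    mul_nonneg (Nat.cast_nonneg _) (sketchWeight_nonneg (Nat.cast_nonneg _))
  have hextra : ∀ p : Finset VD × Finset VD, 0 ≤ if BothSketched D p.1 p.2 then τ else 0 :=
    fun p => by split_ifs <;> positivity
  have hterm : ∀ p ∈ T₀.contractions, (D.sketchOf (p.1 ∪ p.2)).card ≠ 1 →
      (stepCost D ch m p : ℝ) ≤ Λ * (plainCost D p.1 p.2 * sketchWeight D m p +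
        if BothSketched D p.1 p.2 then τ else 0) := by
    intro p hp hcard
    by_cases hb : BothSketched D p.1 p.2
    · rw [sketchWeight_of_bothSketched hb, if_pos hb]
      exact hboth p hp hb
    · rw [if_neg hb, add_zero, stepCost_of_not_bothSketched hpl hcard hb]
      exact le_mul_of_one_le_left (hweight p) hΛ
  rw [Nat.cast_sum]
  calc _ ≤ ∑ p ∈ T₀.contractions.toFinset with (D.sketchOf (p.1 ∪ p.2)).card ≠ 1,
        Λ * (plainCost D p.1 p.2 * sketchWeight D m p +
          if BothSketched D p.1 p.2 then τ else 0) :=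
        Finset.sum_le_sum fun p hp => hterm p (List.mem_toFinset.1 (Finset.mem_filter.1 hp).1)
          (Finset.mem_filter.1 hp).2
    _ ≤ ∑ p ∈ T₀.contractions.toFinset, Λ * (plainCost D p.1 p.2 * sketchWeight D m p +
          if BothSketched D p.1 p.2 then τ else 0) :=
        Finset.sum_le_sum_of_subset_of_nonneg (Finset.filter_subset _ _) fun p _ _ =>
          mul_nonneg (by linarith) (add_nonneg (hweight p) (hextra p))
    _ ≤ _ := by
        rw [← Finset.mul_sum, Finset.sum_add_distrib, ← Finset.sum_filter, Finset.sum_const,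
          nsmul_eq_mul]
        gcongr
        exact card_filter_bothSketched_le hD hT₀

theorem AlgChoices.IsOptimal.exists_stepCost_le (hch : ch.IsOptimal D T₀ m)
    (hp : p ∈ T₀.contractions) (hb : BothSketched D p.1 p.2) :
    ∃ U V, (p = (U, V) ∨ p = (V, U)) ∧ GoesFirst D U V ∧
      ∀ k ∈ Finset.Icc 1 m, stepCost D ch m p ≤ splitCost D m U V k := by
  have hempty : D.sketchOf (p.1 ∪ p.2) ≠ ∅ :=
    (hb.1.mono (sketchOf_mono Finset.subset_union_left)).ne_empty
  have hmin := hch.split_min p hp hb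
  rw [stepCost, if_neg hempty, if_pos hb]
  by_cases hg : GoesFirst D p.1 p.2
  · simp only [if_pos hg] at hmin ⊢
    exact ⟨p.1, p.2, .inl rfl, hg, hmin⟩
  · simp only [if_neg hg] at hmin ⊢
    exact ⟨p.2, p.1, .inr rfl, (not_le.1 hg).le, hmin⟩

theorem AlgChoices.IsOptimal.stepCost_le_sqrt (hch : ch.IsOptimal D T₀ m) (hD : D.IsValid)
    (hm : 0 < m) (hp : p ∈ T₀.contractions) (hb : BothSketched D p.1 p.2) :
    (stepCost D ch m p : ℝ) ≤ 7 * √(m : ℝ) * (plainCost D p.1 p.2 * (m : ℝ) ^ 2) := by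
  obtain ⟨U, V, hpUV, -, hmin⟩ := hch.exists_stepCost_le hp hb
  obtain ⟨k, hk, hle⟩ := exists_splitCost_le_sqrt hD hm U V
  have hcost : plainCost D p.1 p.2 = plainCost D U V := by
    rcases hpUV with rfl | rfl
    exacts [rfl, plainCost_comm D V U]
  rw [hcost]
  exact (Nat.cast_le.2 (hmin k hk)).trans hle

theorem AlgChoices.IsOptimal.stepCost_le_of_isGraph (hch : ch.IsOptimal D T₀ m) (hD : D.IsValid)
    (hG : D.IsGraph) (hT₀ : T₀.IsTreeOn D.verts) {s : ℝ} (hs : 1 ≤ s) (hsm : s ^ 8 = m)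
    (hp : p ∈ T₀.contractions) (hb : BothSketched D p.1 p.2) :
    (stepCost D ch m p : ℝ) ≤
      7 * s ^ 3 * (plainCost D p.1 p.2 * (m : ℝ) ^ 2 + (m : ℝ) ^ 2 * s ^ 4) := by
  obtain ⟨U, V, hpUV, hg, hmin⟩ := hch.exists_stepCost_le hp hb
  have hpD := ContractionTree.union_subset_of_mem_contractions hp
  have hdisj := ContractionTree.disjoint_of_mem_contractions hT₀.1 hp
  rw [hT₀.2, Finset.union_subset_iff] at hpD
  obtain ⟨hU, hV, hUV, hcost⟩ : U ⊆ D.verts ∧ V ⊆ D.verts ∧ Disjoint U V ∧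
      plainCost D p.1 p.2 = plainCost D U V := by
    rcases hpUV with rfl | rfl
    exacts [⟨hpD.1, hpD.2, hdisj, rfl⟩, ⟨hpD.2, hpD.1, hdisj.symm, plainCost_comm D V U⟩]
  obtain ⟨k, hk, hle⟩ := exists_splitCost_le_of_isGraph hD hG hU hV hUV hg hs hsm
  rw [hcost]
  exact (Nat.cast_le.2 (hmin k hk)).trans hle

end Algorithm

theorem pow_three_mul_le_sqrt_pow_five {κ μ : ℝ} (hκ0 : 0 ≤ κ) (hκ : κ ≤ 1) (hμ : 0 ≤ μ) :
    κ ^ 3 * (μ ^ 2 * √μ) ≤ √(κ * μ) ^ 5 := by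
  have hpow : κ ^ 3 ≤ √κ ^ 5 := by
    calc κ ^ 3 = √κ ^ 6 := by nth_rw 1 [← Real.sq_sqrt hκ0]; ring
      _ ≤ √κ ^ 5 :=
        pow_le_pow_of_le_one (Real.sqrt_nonneg _) (Real.sqrt_le_one.2 hκ) (by norm_num)
  calc κ ^ 3 * (μ ^ 2 * √μ) = κ ^ 3 * √μ ^ 5 := by
        nth_rw 1 [← Real.sq_sqrt hμ]; ring
    _ ≤ √κ ^ 5 * √μ ^ 5 := by gcongr
    _ = √(κ * μ) ^ 5 := by rw [Real.sqrt_mul hκ0, mul_pow]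

section Comparison

variable {VD ED VE FE : Type*} [DecidableEq VD] [DecidableEq ED] [DecidableEq VE] [DecidableEq FE]
variable {D : DataNetwork VD ED} {T₀ : ContractionTree VD} {m : ℕ}
variable {S : Embedding ED VE FE} {ord : VE → ℕ} {T : ContractionTree (VD ⊕ VE)}

theorem SketchOrientation.card_sketch_mul_le (O : SketchOrientation D S ord) (hD : D.IsValid)
    (hS : S.IsGraphEmbedding D) (hm : 0 < m) (hms : ∀ e ∈ D.sketch, m < D.size e) {κ K r : ℝ}
    (hκ0 : 0 < κ) (hκ : κ ≤ 1) (hK : 1 ≤ K) (hr : κ * m ≤ r)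
    (hrow : ∀ x ∈ S.verts, r ≤ S.rowSize ord x) (hout : (S.sketchSize : ℝ) ≤ K * r)
    (hT : T.IsTreeOn (Embedding.total D S).verts) :
    ((D.sketch.card - 1 : ℕ) : ℝ) * ((m : ℝ) ^ 2 * √(m : ℝ)) ≤
      5 * K / κ ^ 3 * (Embedding.total D S).treeCost T := by
  have hσ : √(κ * m) ^ 2 = κ * m := Real.sq_sqrt (by positivity)
  have hdata : ∀ e ∈ D.sketch, √(κ * m) ^ 2 ≤ D.size e := fun e he =>
    hσ.trans_le ((mul_le_of_le_one_left m.cast_nonneg hκ).trans (Nat.cast_le.2 (hms e he).le))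
  have hcount := O.card_sketch_mul_le_treeCost hD (total_size_pos hD hS) (hS.verts_nonempty hD)
    (Real.sqrt_pos.2 (by positivity)) hK hdata hrow (hσ.trans_le hr) hout hT
  rw [← mul_div_assoc, div_le_iff₀ (by positivity)] at hcount
  rw [div_mul_eq_mul_div, le_div_iff₀ (by positivity)]
  calc ((D.sketch.card - 1 : ℕ) : ℝ) * ((m : ℝ) ^ 2 * √(m : ℝ)) * κ ^ 3
      = (D.sketch.card - 1 : ℕ) * (κ ^ 3 * ((m : ℝ) ^ 2 * √(m : ℝ))) := by ring
    _ ≤ (D.sketch.card - 1 : ℕ) * √(κ * m) ^ 5 := by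
        gcongr
        exact pow_three_mul_le_sqrt_pow_five hκ0.le hκ m.cast_nonneg
    _ ≤ 5 * (Embedding.total D S).treeCost T * K := hcount
    _ = 5 * K * (Embedding.total D S).treeCost T := by ring

theorem SketchOrientation.sum_plainCost_mul_sketchWeight_le_div (O : SketchOrientation D S ord)
    (hD : D.IsValid) (hS : S.IsGraphEmbedding D) (hms : ∀ e ∈ D.sketch, m < D.size e) {κ : ℝ}
    (hκ0 : 0 < κ) (hκ : κ ≤ 1) (hrow : ∀ x ∈ S.verts, κ * m ≤ S.rowSize ord x)
    (hT₀ : T₀.leaves.Nodup) (hT : T.IsTreeOn (Embedding.total D S).verts)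
    (hc : T.ConstrainedOn T₀) :
    ∑ p ∈ T₀.contractions.toFinset, plainCost D p.1 p.2 * sketchWeight D m p ≤
      (Embedding.total D S).treeCost T / κ ^ 2 := by
  have hdata : ∀ e ∈ D.sketch, κ * m ≤ D.size e := fun e he =>
    (mul_le_of_le_one_left m.cast_nonneg hκ).trans (Nat.cast_le.2 (hms e he).le)
  rw [le_div_iff₀ (by positivity), Finset.sum_mul]
  refine le_trans (Finset.sum_le_sum fun p _ => ?_) (O.sum_plainCost_mul_sketchWeight_le
    (total_size_pos hD hS) (by positivity) hdata hrow hT₀ hT hc)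
  rw [mul_assoc, mul_comm _ (κ ^ 2)]
  gcongr
  exact sq_mul_sketchWeight_le hκ0.le hκ m.cast_nonneg

theorem SketchOrientation.algCost_le (O : SketchOrientation D S ord) (hD : D.IsValid)
    (hS : S.IsGraphEmbedding D) (hT₀ : T₀.IsTreeOn D.verts) (hm : 0 < m)
    (hms : ∀ e ∈ D.sketch, m < D.size e) {ch : AlgChoices VD ED} (hch : ch.IsOptimal D T₀ m)
    {κ K r : ℝ} (hκ0 : 0 < κ) (hκ : κ ≤ 1) (hK : 1 ≤ K) (hr : κ * m ≤ r)
    (hrow : ∀ x ∈ S.verts, r ≤ S.rowSize ord x) (hout : (S.sketchSize : ℝ) ≤ K * r)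
    (hT : T.IsTreeOn (Embedding.total D S).verts) (hc : T.ConstrainedOn T₀) {Λ τ : ℝ} (hΛ : 1 ≤ Λ)
    (hτ0 : 0 ≤ τ) (hτ : τ ≤ (m : ℝ) ^ 2 * √(m : ℝ))
    (hstep : ∀ p ∈ T₀.contractions, BothSketched D p.1 p.2 →
      (stepCost D ch m p : ℝ) ≤ 7 * Λ * (plainCost D p.1 p.2 * (m : ℝ) ^ 2 + τ)) :
    (algCost D ch T₀ m : ℝ) ≤ 2 * (3 / κ + (7 / κ ^ 2 + 35 * K / κ ^ 3)) * Λ *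
      (Embedding.total D S).treeCost T := by
  set c := ((Embedding.total D S).treeCost T : ℝ)
  have : 0 ≤ c := Nat.cast_nonneg _
  have hrow' : ∀ x ∈ S.verts, κ * m ≤ S.rowSize ord x := fun x hx => hr.trans (hrow x hx)
  have hplace : ((∑ e ∈ D.sketch, placeCost D T₀ m e (ch.place e) : ℕ) : ℝ) ≤ 3 / κ * c := by
    rw [div_mul_eq_mul_div, le_div_iff₀' hκ0]
    exact O.sum_placeCost_le hD (total_size_pos hD hS) (hS.verts_nonempty hD) hκ0.le hκ hms hrow'
      hT₀ hT hc hch.place_min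
  have hplain : ∑ p ∈ T₀.contractions.toFinset, plainCost D p.1 p.2 * sketchWeight D m p ≤
      c / κ ^ 2 :=
    O.sum_plainCost_mul_sketchWeight_le_div hD hS hms hκ0 hκ hrow' hT₀.1 hT hc
  have hcount : ((D.sketch.card - 1 : ℕ) : ℝ) * τ ≤ 5 * K / κ ^ 3 * c :=
    (mul_le_mul_of_nonneg_left hτ (Nat.cast_nonneg _)).trans
      (O.card_sketch_mul_le hD hS hm hms hκ0 hκ hK hr hrow hout hT)
  have hsteps := sum_stepCost_le hD hT₀ (by linarith) hτ0 (fun e he => (hch.place_mem e he).2) hstep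
  have halg : (algCost D ch T₀ m : ℝ) ≤ 2 * ((∑ e ∈ D.sketch, placeCost D T₀ m e (ch.place e) : ℕ) +
      (∑ p ∈ T₀.contractions.toFinset with (D.sketchOf (p.1 ∪ p.2)).card ≠ 1,
        stepCost D ch m p : ℕ)) := by
    exact_mod_cast algCost_le_two_mul hD hT₀ hm hms hch
  calc (algCost D ch T₀ m : ℝ)
      ≤ 2 * (3 / κ * c + 7 * Λ * (c / κ ^ 2 + 5 * K / κ ^ 3 * c)) := by
        refine halg.trans ?_
        gcongr
        exact hsteps.trans (by gcongr)
    _ = 2 * (3 / κ) * c * 1 + 2 * (7 / κ ^ 2 + 35 * K / κ ^ 3) * c * Λ := by ring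
    _ ≤ 2 * (3 / κ) * c * Λ + 2 * (7 / κ ^ 2 + 35 * K / κ ^ 3) * c * Λ := by gcongr
    _ = 2 * (3 / κ + (7 / κ ^ 2 + 35 * K / κ ^ 3)) * Λ * c := by ring

end Comparison

theorem sketchUnit_pos {ε δ : ℝ} (hε : 0 < ε) (hδ : 0 < δ) (hδ1 : δ < 1) : 0 < sketchUnit ε δ :=
  div_pos (Real.log_pos ((one_lt_div hδ).2 hδ1)) (by positivity)

theorem sq_div_mul_le {c₁ c₂ m M N n u : ℝ} (hc₁ : 0 < c₁) (hc₂ : 0 < c₂)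
    (hm : m ≤ c₂ * N * u) (hNM : c₁ * N * u ≤ M) (hM : M ≤ c₂ * n * u) :
    (c₁ / c₂) ^ 2 * m ≤ c₁ * n * u := by
  calc (c₁ / c₂) ^ 2 * m ≤ (c₁ / c₂) ^ 2 * (c₂ * N * u) := by gcongr
    _ = c₁ / c₂ * (c₁ * N * u) := by field_simp
    _ ≤ c₁ / c₂ * (c₂ * n * u) := by exact mul_le_mul_of_nonneg_left (hNM.trans hM) (by positivity)
    _ = c₁ * n * u := by field_simp

/-- The factor lost against the optimum, apart from the loss `√m` or `m ^ 0.375` in the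
contractions of two sketched tensors. -/
noncomputable def approxFactor (c₁ c₂ : ℝ) : ℝ :=
  2 * (3 / (c₁ / c₂) ^ 2 +
    (7 / ((c₁ / c₂) ^ 2) ^ 2 + 35 * (c₂ / c₁) / ((c₁ / c₂) ^ 2) ^ 3))

section Approximation

variable {VD ED : Type*} [DecidableEq VD] [DecidableEq ED] {D : DataNetwork VD ED}
variable {T₀ : ContractionTree VD} {m : ℕ} {ch : AlgChoices VD ED}

theorem algCost_le_of_mem_feasibleCosts (hD : D.IsValid) (hT₀ : T₀.IsTreeOn D.verts)
    {c₁ c₂ ε δ : ℝ} (hc₁ : 0 < c₁) (hc₂ : 0 < c₂) (hc₁₂ : c₁ ≤ c₂) (hm : 0 < m)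
    (hm2 : m ≤ c₂ * D.sketch.card * sketchUnit ε δ) (hms : ∀ e ∈ D.sketch, m < D.size e)
    (hch : ch.IsOptimal D T₀ m) {c : ℕ} (hc : c ∈ feasibleCosts D T₀ c₁ c₂ ε δ) {Λ τ : ℝ}
    (hΛ : 1 ≤ Λ) (hτ0 : 0 ≤ τ) (hτ : τ ≤ (m : ℝ) ^ 2 * √(m : ℝ))
    (hstep : ∀ p ∈ T₀.contractions, BothSketched D p.1 p.2 →
      (stepCost D ch m p : ℝ) ≤ 7 * Λ * (plainCost D p.1 p.2 * (m : ℝ) ^ 2 + τ)) :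
    (algCost D ch T₀ m : ℝ) ≤ approxFactor c₁ c₂ * Λ * c := by
  obtain ⟨S, T, hS, hSN, hT, hTc, rfl⟩ := hc
  obtain ⟨ord, hinj, hrow⟩ := hS.accurate
  obtain ⟨O⟩ := nonempty_sketchOrientation hD hS.graph hinj
  have hout : (S.sketchSize : ℝ) ≤ c₂ / c₁ * (c₁ * S.verts.card * sketchUnit ε δ) :=
    hS.sketchSize_le.trans_eq (by field_simp)
  exact O.algCost_le hD hS.graph hT₀ hm hms hch (by positivity)
    (pow_le_one₀ (by positivity) ((div_le_one hc₂).2 hc₁₂)) ((one_le_div hc₁).2 hc₁₂)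
    (sq_div_mul_le hc₁ hc₂ hm2 hSN hS.sketchSize_le) hrow hout hT hTc hΛ hτ0 hτ hstep

end Approximation

theorem exists_eighth_root {x : ℝ} (hx : 1 ≤ x) :
    ∃ s : ℝ, 1 ≤ s ∧ s ^ 8 = x ∧ s ^ 3 = x ^ (0.375 : ℝ) ∧ s ^ 4 = √x := by
  have hx0 : 0 ≤ x := zero_le_one.trans hx
  have hpow : (x ^ (1 / 8 : ℝ)) ^ 8 = x := by
    rw [← Real.rpow_mul_natCast hx0]
    norm_num
  refine ⟨x ^ (1 / 8 : ℝ), Real.one_le_rpow hx (by norm_num), hpow, ?_, ?_⟩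
  · rw [← Real.rpow_mul_natCast hx0]
    norm_num
  · rw [Real.sqrt_eq_rpow, ← Real.rpow_mul_natCast hx0]
    norm_num

theorem theorem4p3 (c₁ c₂ : ℝ) (hc₁ : 0 < c₁) (hc₂ : 0 < c₂) :
    ∃ C : ℝ, 0 < C ∧
      ∀ (VD ED : Type*) [DecidableEq VD] [DecidableEq ED]
        (D : DataNetwork VD ED) (_ : D.IsValid)
        (T₀ : ContractionTree VD) (_ : T₀.IsTreeOn D.verts)
        (ε δ : ℝ) (_ : 0 < ε) (_ : 0 < δ) (_ : δ < 1)
        (m : ℕ) (_ : c₁ * D.sketch.card * sketchUnit ε δ ≤ m)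
        (_ : (m : ℝ) ≤ c₂ * D.sketch.card * sketchUnit ε δ)
        (_ : ∀ e ∈ D.sketch, m < D.size e)
        (ch : AlgChoices VD ED) (_ : ch.IsOptimal D T₀ m)
        (c_opt : ℕ) (_ : IsLeast (feasibleCosts D T₀ c₁ c₂ ε δ) c_opt),
        (algCost D ch T₀ m : ℝ) ≤ C * √(m : ℝ) * c_opt ∧
        (D.IsGraph → (algCost D ch T₀ m : ℝ) ≤ C * (m : ℝ) ^ (0.375 : ℝ) * c_opt) := by
  refine ⟨approxFactor c₁ c₂, by unfold approxFactor; positivity, ?_⟩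
  rintro VD ED _ _ D hD T₀ hT₀ ε δ hε hδ hδ1 m hm1 hm2 hms ch hch c ⟨hc, -⟩
  have hu : 0 < sketchUnit ε δ := sketchUnit_pos hε hδ hδ1
  have hN : (0 : ℝ) < D.sketch.card := Nat.cast_pos.2 hD.sketch_nonempty.card_pos
  have hm : 0 < m := Nat.cast_pos.1 ((by positivity : 0 < c₁ * _ * _).trans_le hm1)
  have hm' : (1 : ℝ) ≤ m := Nat.one_le_cast.2 hm
  have hc₁₂ : c₁ ≤ c₂ :=
    le_of_mul_le_mul_right (le_of_mul_le_mul_right (hm1.trans hm2) hu) hN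
  refine ⟨algCost_le_of_mem_feasibleCosts hD hT₀ hc₁ hc₂ hc₁₂ hm hm2 hms hch hc
    (Real.one_le_sqrt.2 hm') le_rfl (by positivity) fun p hp hb => ?_, fun hG => ?_⟩
  · rw [add_zero]
    exact hch.stepCost_le_sqrt hD hm hp hb
  · obtain ⟨s, hs, hs8, hs3, hs4⟩ := exists_eighth_root hm'
    rw [← hs3]
    exact algCost_le_of_mem_feasibleCosts hD hT₀ hc₁ hc₂ hc₁₂ hm hm2 hms hch hc
      (one_le_pow₀ hs) (by positivity) (by rw [hs4]) fun p hp hb =>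
      hch.stepCost_le_of_isGraph hD hG hT₀ hs hs8 hp hb
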